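/- Let $M$ be a closed connected smooth $3$-manifold with a smooth contact form $\alpha$, oriented so that $\alpha\wedge d\alpha>0$, and let $X_\alpha$ be its Reeb vector field ($\alpha(X_\alpha)=1$, $\iota_{X_\alpha}d\alpha=0$). A smooth Riemannian metric $g$ on $M$ is a contact metric adapted to $\alpha$ if $g(X_\alpha,\cdot)=\alpha$ and there is a $(1,1)$-tensor $\phi$ with $g(\cdot,\phi\,\cdot)=\tfrac12 d\alpha$ and $\phi^2=-I+\alpha\otimes X_\alpha$, where $d\alpha(V,W)=V\alpha(W)-W\alpha(V)-\alpha([V,W])$; write $\mathrm{Ricci}(X_\alpha)=\mathrm{Ric}_g(X_\alpha,X_\alpha)$. Call $(M,\alpha)$ an algebraic Anosov contact manifold if its Reeb flow is virtually $C^\infty$-conjugate to the geodesic flow on the unit tangent bundle $UT\Sigma$ of a closed connected surface $\Sigma$ of constant negative curvature, i.e. both flows lift to the same smooth flow on a common (closed, connected) finite smooth covering space of $M$ and $UT\Sigma$. Let $\bar h$ be the Liouville entropy of $(M,\alpha)$: the Kolmogorov–Sinai entropy of the Reeb flow (of its time-one map) with respect to the probability measure proportional to $\alpha\wedge d\alpha$.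 (1) If $(M,\alpha)$ is an algebraic Anosov contact manifold, then for every real $C\le 2-2\bar h^2$ there is a contact metric adapted to $\alpha$ with $\mathrm{Ricci}(X_\alpha)\equiv C$ on $M$. (2) In particular, let $\Sigma$ be a closed connected Riemannian surface of constant curvature $K<0$, and let $UT\Sigma$ be its unit tangent bundle, with the canonical contact form $\alpha_v(w)=g_\Sigma(v,d\pi(w))$, where $\pi:UT\Sigma\to\Sigma$ is the projection; this is indeed a contact form. Then for every real $C\le 2+2K$ there is a contact metric on $UT\Sigma$ adapted to $\alpha$ with $\mathrm{Ricci}(X_\alpha)\equiv C$. -/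

import Mathlib

open Set Filter Topology MeasureTheory Bundle
open scoped Manifold ContDiff ENNReal

noncomputable section

/-- The model space `ℝⁿ`. -/
abbrev Model (n : ℕ) : Type := EuclideanSpace ℝ (Fin n)

/-- The `i`-th standard basis vector of `ℝⁿ`. -/
def stdVec {n : ℕ} (i : Fin n) : Model n := EuclideanSpace.single i 1

/-! ### Riemannian metrics and their curvature -/

section Riemannian

variable {n : ℕ} {M : Type*} [TopologicalSpace M] [ChartedSpace (Model n) M]

/-- The inverse of the preferred chart around `x`, as a map from (an open subset of) `ℝⁿ`. -/
def chartInv (x : M) : Model n → M := (extChartAt (𝓡 n) x).symm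

/-- The differential of `chartInv x` at `u`. At `u = extChartAt (𝓡 n) x x` it is the identity, since
in Mathlib the tangent space `T_x M` is `ℝⁿ`, read in the preferred chart around `x`. -/
def chartInvDeriv (x : M) (u : Model n) :
    Model n →L[ℝ] TangentSpace (𝓡 n) (chartInv (n := n) x u) :=
  mfderiv 𝓘(ℝ, Model n) (𝓡 n) (chartInv (n := n) x) u

variable [IsManifold (𝓡 n) ∞ M]

variable (n M) in
/-- Smooth (`C^∞`) Riemannian metrics on an `n`-manifold. -/
abbrev SmoothMetric : Type _ :=
  ContMDiffRiemannianMetric (𝓡 n) ∞ (Model n) (fun x : M => TangentSpace (𝓡 n) x)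

variable (g : SmoothMetric n M)

/-- The matrix `g_{ij}(u)` of the metric in the preferred chart around `x`. -/
def metricMatrix (x : M) (u : Model n) : Matrix (Fin n) (Fin n) ℝ :=
  Matrix.of fun i j =>
    g.inner (chartInv x u) (chartInvDeriv x u (stdVec i)) (chartInvDeriv x u (stdVec j))

/-- The partial derivative `∂_l g_{ij}` at `u`, in the preferred chart around `x`. -/
def metricPartial (x : M) (l i j : Fin n) (u : Model n) : ℝ :=
  fderiv ℝ (fun y => metricMatrix g x y i j) u (stdVec l)

/-- The Christoffel symbol `Γ^k_{ij}` of the Levi-Civita connection at `u`, in the preferred chart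
around `x`. -/
def christoffel (x : M) (k i j : Fin n) (u : Model n) : ℝ :=
  (1 / 2) * ∑ l, (metricMatrix g x u)⁻¹ k l *
    (metricPartial g x i j l u + metricPartial g x j i l u - metricPartial g x l i j u)

/-- The partial derivative `∂_m Γ^k_{ij}` at `u`, in the preferred chart around `x`. -/
def christoffelPartial (x : M) (m k i j : Fin n) (u : Model n) : ℝ :=
  fderiv ℝ (fun y => christoffel g x k i j y) u (stdVec m)

/-- The coefficient of `∂_l` in `R(∂_i, ∂_j) ∂_k` at the point `x`, in the preferred chart around
`x`, where `R(U, V) W = ∇_U ∇_V W - ∇_V ∇_U W - ∇_[U, V] W`. -/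
def riemannCoeff (x : M) (l i j k : Fin n) : ℝ :=
  let u : Model n := extChartAt (𝓡 n) x x
  christoffelPartial g x i l j k u - christoffelPartial g x j l i k u
    + ∑ m, (christoffel g x l i m u * christoffel g x m j k u
      - christoffel g x l j m u * christoffel g x m i k u)

/-- The `i`-th coordinate of a tangent vector at `x`, in the preferred chart around `x`. -/
def tangentCoord {x : M} (v : TangentSpace (𝓡 n) x) (i : Fin n) : ℝ :=
  (show Model n from v) i

/-- The Riemann curvature `R(v, w) z ∈ T_x M`. -/
def riemann (x : M) (v w z : TangentSpace (𝓡 n) x) : TangentSpace (𝓡 n) x :=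
  show Model n from
    ∑ l, (∑ i, ∑ j, ∑ k,
      riemannCoeff g x l i j k * tangentCoord v i * tangentCoord w j * tangentCoord z k) • stdVec l

/-- The Ricci curvature `Ric(v, w)`, the trace of `z ↦ R(z, v) w`. -/
def ricci (x : M) (v w : TangentSpace (𝓡 n) x) : ℝ :=
  ∑ i : Fin n, tangentCoord (riemann g x (show TangentSpace (𝓡 n) x from stdVec i) v w) i

/-- All sectional curvatures are equal to `K`. -/
def HasConstantCurvature (K : ℝ) : Prop :=
  ∀ (x : M) (v w : TangentSpace (𝓡 n) x),
    g.inner x (riemann g x v w w) v =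
      K * (g.inner x v v * g.inner x w w - g.inner x v w ^ 2)

end Riemannian

/-! ### Contact forms, Reeb fields and contact metrics in dimension 3 -/

section Contact

variable {M : Type*} [TopologicalSpace M] [ChartedSpace (Model 3) M]

variable (M) in
/-- (Not necessarily continuous) 1-forms on a 3-manifold. -/
abbrev OneForm : Type _ := ∀ x : M, TangentSpace (𝓡 3) x →L[ℝ] ℝ

/-- The coordinate expression at `u` of a 1-form in the preferred chart around `x`, that is, its
pullback under `chartInv x`. -/
def formInChart (α : OneForm M) (x : M) (u : Model 3) : Model 3 →L[ℝ] ℝ :=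
  (α (chartInv x u)).comp (chartInvDeriv x u)

/-- The exterior derivative at `u` of the coordinate expression of `α` around `x`, with the
convention `dα(V, W) = V(α(W)) - W(α(V)) - α([V, W])`. -/
def dFormInChart (α : OneForm M) (x : M) (u v w : Model 3) : ℝ :=
  fderiv ℝ (formInChart α x) u v w - fderiv ℝ (formInChart α x) u w v

/-- The exterior derivative `dα` at `x`, evaluated on two tangent vectors at `x`. -/
def dForm (α : OneForm M) (x : M) (v w : TangentSpace (𝓡 3) x) : ℝ :=
  dFormInChart α x (extChartAt (𝓡 3) x x) v w

/-- `α` is a contact form: it is smooth and `α ∧ dα` vanishes nowhere. The 3-manifold is understood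
to carry the orientation for which `α ∧ dα` is positive. -/
structure IsContactForm [IsManifold (𝓡 3) ∞ M] (α : OneForm M) : Prop where
  smooth : ContMDiff (𝓡 3) ((𝓡 3).prod 𝓘(ℝ, Model 3 →L[ℝ] ℝ)) ∞
    (fun x => TotalSpace.mk' (Model 3 →L[ℝ] ℝ)
      (E := fun x : M => TangentSpace (𝓡 3) x →L[ℝ] Bundle.Trivial M ℝ x) x (α x))
  nondegenerate : ∀ x : M, ∃ u v w : TangentSpace (𝓡 3) x,
    α x u * dForm α x v w - α x v * dForm α x u w + α x w * dForm α x u v ≠ 0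

/-- The Reeb field of a contact form: the unique vector field `X` with `α(X) = 1`, `ι_X dα = 0`. -/
def reeb (α : OneForm M) (x : M) : TangentSpace (𝓡 3) x :=
  Classical.epsilon fun v => α x v = 1 ∧ ∀ w, dForm α x v w = 0

/-- `g` is a contact metric adapted to `α`: with `X` the Reeb field, `g(X, ·) = α`, and there is a
`(1, 1)`-tensor `φ` with `g(·, φ ·) = dα / 2` and `φ² = -1 + α ⊗ X`. (Such a `φ` is determined by
`g` and `α`; in particular it is smooth.) -/
def IsContactMetric [IsManifold (𝓡 3) ∞ M] (α : OneForm M) (g : SmoothMetric 3 M) : Prop :=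
  (∀ (x : M) (v : TangentSpace (𝓡 3) x), g.inner x (reeb α x) v = α x v) ∧
  ∃ φ : ∀ x : M, TangentSpace (𝓡 3) x →L[ℝ] TangentSpace (𝓡 3) x,
    (∀ (x : M) (v w : TangentSpace (𝓡 3) x), g.inner x v (φ x w) = (1 / 2) * dForm α x v w) ∧
    ∀ (x : M) (v : TangentSpace (𝓡 3) x), φ x (φ x v) = -v + α x v • reeb α x

/-- The time-`t` map of the Reeb flow: it sends `x` to `γ t`, where `γ : ℝ → M` is the integral curve
of the Reeb field with `γ 0 = x` (unique, and defined for all times on a closed manifold). -/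
def reebFlow (α : OneForm M) (t : ℝ) (x : M) : M :=
  (@Classical.epsilon (ℝ → M) ⟨fun _ => x⟩ fun γ =>
    γ 0 = x ∧ IsMIntegralCurve (I := 𝓡 3) γ (reeb α)) t

end Contact

/-! ### Liouville measure and Liouville entropy -/

section Entropy

/-- The Kolmogorov–Sinai entropy of a transformation `T` preserving a probability measure `μ`:
the supremum over finite measurable partitions `P` of the limit of `H(P ∨ ⋯ ∨ T^{-(n-1)} P) / n`.
A partition into (at most) `k` pieces is given by its labelling `P : Ω → Fin k`. -/
def measureEntropy {Ω : Type*} [MeasurableSpace Ω] (μ : Measure Ω) (T : Ω → Ω) : ℝ≥0∞ :=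
  ⨆ (k : ℕ) (P : Ω → Fin k) (_ : Measurable P),
    limsup (fun n : ℕ => ENNReal.ofReal
      ((∑ a : Fin n → Fin k, Real.negMulLog (μ.real {x | ∀ i : Fin n, P (T^[i] x) = a i})) / n))
      atTop

variable {M : Type*} [TopologicalSpace M] [ChartedSpace (Model 3) M]

/-- The absolute value of the density of `α ∧ dα` with respect to Lebesgue measure, in the
preferred chart around `x`. -/
def contactDensity (α : OneForm M) (x : M) (u : Model 3) : ℝ :=
  |formInChart α x u (stdVec 0) * dFormInChart α x u (stdVec 1) (stdVec 2)
    - formInChart α x u (stdVec 1) * dFormInChart α x u (stdVec 0) (stdVec 2)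
    + formInChart α x u (stdVec 2) * dFormInChart α x u (stdVec 0) (stdVec 1)|

variable [MeasurableSpace M]

/-- The measure on `M` given by the volume form `α ∧ dα`: the least measure whose restriction to
each chart domain is (at least, hence exactly) the one with the coordinate density of `α ∧ dα`. -/
def contactVolume (α : OneForm M) : Measure M :=
  ⨆ x : M, Measure.map (chartInv x)
    ((volume.withDensity fun u => ENNReal.ofReal (contactDensity α x u)).restrict
      (extChartAt (𝓡 3) x).target)

/-- The Liouville measure: the normalization of `α ∧ dα` to a probability measure. -/
def liouvilleMeasure (α : OneForm M) : Measure M :=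
  (contactVolume α univ)⁻¹ • contactVolume α

/-- The Liouville entropy: the measure entropy of the Reeb flow (that is, of its time-one map) with
respect to the Liouville measure. -/
def liouvilleEntropy (α : OneForm M) : ℝ≥0∞ :=
  measureEntropy (liouvilleMeasure α) (reebFlow α 1)

end Entropy

/-! ### Unit tangent bundles of surfaces -/

section UnitTangent

variable {S : Type*} [TopologicalSpace S] [ChartedSpace (Model 2) S] [IsManifold (𝓡 2) ∞ S]

/-- The unit tangent bundle of a Riemannian surface, with the subspace topology. -/
abbrev UnitTangent (g : SmoothMetric 2 S) : Type _ :=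
  {v : TangentBundle (𝓡 2) S // g.inner v.proj v.snd v.snd = 1}

/-- The given smooth structure on the unit tangent bundle is the one of a submanifold of the tangent
bundle: the inclusion, which is a topological embedding, is a smooth immersion. There is exactly one
such smooth structure. -/
def IsSubmanifoldStructure (g : SmoothMetric 2 S) [ChartedSpace (Model 3) (UnitTangent g)] : Prop :=
  ContMDiff (𝓡 3) (𝓡 2).tangent ∞ (fun v : UnitTangent g => v.1) ∧
  ∀ v : UnitTangent g,
    Function.Injective (mfderiv (𝓡 3) (𝓡 2).tangent (fun v : UnitTangent g => v.1) v)

/-- The canonical contact form on the unit tangent bundle: `α_v(w) = g(v, dπ(w))`, where `π` is the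
projection to the surface. Its Reeb flow is the geodesic flow. -/
def canonicalForm (g : SmoothMetric 2 S) [ChartedSpace (Model 3) (UnitTangent g)] :
    OneForm (UnitTangent g) := fun v =>
  (g.inner v.1.proj v.1.snd).comp
    (mfderiv (𝓡 3) (𝓡 2) (fun v : UnitTangent g => v.1.proj) v)

end UnitTangent

/-! ### Algebraic Anosov contact manifolds -/

section Algebraic

universe u

/-- A smooth finite covering map between 3-manifolds. -/
structure IsFiniteSmoothCovering {N M : Type*} [TopologicalSpace N] [ChartedSpace (Model 3) N]
    [TopologicalSpace M] [ChartedSpace (Model 3) M] (p : N → M) : Prop where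
  covering : IsCoveringMap p
  localDiffeo : IsLocalDiffeomorph (𝓡 3) (𝓡 3) ∞ p
  surjective : Function.Surjective p
  finite_fibers : ∀ y : M, (p ⁻¹' {y}).Finite

/-- The Reeb flows of `α` on `M` and `β` on `U` are virtually smoothly conjugate: they lift to one
and the same flow (generated by `Y`) on a common finite covering space `N`. -/
def VirtuallyConjugateReebFlows {M U : Type u} [TopologicalSpace M] [ChartedSpace (Model 3) M]
    [TopologicalSpace U] [ChartedSpace (Model 3) U] (α : OneForm M) (β : OneForm U) : Prop :=
  ∃ (N : Type u) (_ : TopologicalSpace N) (_ : ChartedSpace (Model 3) N)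
    (_ : IsManifold (𝓡 3) ∞ N) (_ : T2Space N) (_ : CompactSpace N) (_ : ConnectedSpace N)
    (p : N → M) (q : N → U) (Y : ∀ z : N, TangentSpace (𝓡 3) z),
    IsFiniteSmoothCovering p ∧ IsFiniteSmoothCovering q ∧
    (∀ z, mfderiv (𝓡 3) (𝓡 3) p z (Y z) = reeb α (p z)) ∧
    (∀ z, mfderiv (𝓡 3) (𝓡 3) q z (Y z) = reeb β (q z))

/-- `(M, α)` is an algebraic Anosov contact manifold: its Reeb flow is virtually smoothly conjugate
to the geodesic flow on the unit tangent bundle of a closed connected surface of constant negative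
curvature. -/
def IsAlgebraicAnosov {M : Type u} [TopologicalSpace M] [ChartedSpace (Model 3) M]
    (α : OneForm M) : Prop :=
  ∃ (S : Type u) (_ : TopologicalSpace S) (_ : ChartedSpace (Model 2) S)
    (_ : IsManifold (𝓡 2) ∞ S) (_ : T2Space S) (_ : CompactSpace S) (_ : ConnectedSpace S)
    (g : SmoothMetric 2 S) (K : ℝ)
    (_ : ChartedSpace (Model 3) (UnitTangent g)) (_ : IsManifold (𝓡 3) ∞ (UnitTangent g)),
    K < 0 ∧ HasConstantCurvature g K ∧ IsSubmanifoldStructure g ∧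
    VirtuallyConjugateReebFlows α (canonicalForm g)

end Algebraic

end

/-! Everything rests on a local normal form. Near each point the contact form is completed to a
coframe b = α, p, s with db = 2 p∧s, ι_X dp = μ p and ι_X ds = -μ s, where X is the Reeb field: p is
expanded and s contracted at the constant rate μ > 0 (`AnosovGerm`). The pair (p, s) matters only up
to a common sign, which is exactly what q = (p + i s)² forgets. Globally the data are therefore
carried by q (`HasGermAt`), and the invariant line fields need not be orientable.

Metrics. If P > 0 and P² - Q² = 1, then g = b² + P(p² + s²) + 2Q ps is adapted to α. By Koszul, 2
g(∇_v X, w) = dα(v, w) + (L_X g)(v, w), and L_X scales p² by 2μ and s² by -2μ and kills b² and ps.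
Hence ∇X has constant coefficients in the dual frame, X is geodesic and divergence free, and the
trace of the Riccati equation reads Ric(X, X) = -tr((∇X)²) = 2 - 2μ²P². As P² runs over [1, ∞) this
takes every value C ≤ 2 - 2μ² (`exists_contactMetric_of_germ`).

Unit tangent bundles. With ν a local unit normal to the vector ξ, the forms θ = ⟨ν, dx⟩ and η = ⟨ν,
Dξ⟩ satisfy Cartan's equations db = η∧θ, ι_X dθ = η, ι_X dη = -Kθ. For K = -μ² the combinations η ±
μθ are scaled by ±μ, which gives the normal form (`exists_germ_canonicalForm`) and part (2).

Algebraic Anosov manifolds. On the common covering the pullbacks of α and of the canonical form have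
the same Reeb field, and they coincide (`form_eq_of_reeb`): the value of one form on an invariant
direction of the other is scaled exponentially along X, so its square vanishes at its maximum on a
compact manifold. To descend to M, the framings coming from the finitely many sheets are compared by
the same maximum principle; they share their invariant lines, and p² is replaced by the sum of the
p_i² over the sheets (`IsGermFamily.exists_germ`).

Entropy. Part (1) then needs only μ ≤ h̄ (`ofReal_le_liouvilleEntropy`). For 0 < λ < 2μ the
quadratic form p² - s² - b² grows along X at rate at least λ, since 2μ(p² + s²) - λ(p² - s² - b²) is
positive definite. Embed M by F in a Euclidean space, extend the form to ambient bilinear forms B_x,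
and put W(x, y) = B_x(Fx - Fy, Fx - Fy). Near the diagonal the time-one map multiplies W by at least
e^λ, so two points of one n-cylinder of a fine partition have W ≤ const·e^{-λn}. On segments in the
expanded direction W dominates half the square of the length, so cylinders meet such lines in sets
of diameter O(e^{-λn/2}). By Fubini their volume is O(e^{-λn/2}), so the entropy is at least λ/2,
and λ → 2μ. Neither stable manifolds nor an entropy formula is used. -/

open Set Filter Topology MeasureTheory Bundle
open scoped Manifold ContDiff ENNReal

noncomputable section

set_option linter.unusedSectionVars false
set_option synthInstance.maxHeartbeats 200000
set_option maxHeartbeats 400000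

/-! ### Exterior calculus of 1-forms on a normed space -/

section ExteriorDerivative

variable {E F : Type*} [NormedAddCommGroup E] [NormedSpace ℝ E] [NormedAddCommGroup F]
  [NormedSpace ℝ F]

/-- The exterior derivative of a 1-form on a normed space. -/
def extD (b : E → E →L[ℝ] ℝ) (u v w : E) : ℝ := fderiv ℝ b u v w - fderiv ℝ b u w v

/-- The pullback of a 1-form. -/
def pullForm (τ : E → F) (b : F → F →L[ℝ] ℝ) (u : E) : E →L[ℝ] ℝ := (b (τ u)).comp (fderiv ℝ τ u)

lemma pullForm_apply (τ : E → F) (b : F → F →L[ℝ] ℝ) (u v : E) :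
    pullForm τ b u v = b (τ u) (fderiv ℝ τ u v) := rfl

lemma extD_congr {b b' : E → E →L[ℝ] ℝ} {u : E} (h : b =ᶠ[𝓝 u] b') (v w : E) :
    extD b u v w = extD b' u v w := by
  rw [extD, extD, h.fderiv_eq]

lemma eventually_extD_congr {b b' : E → E →L[ℝ] ℝ} {u : E} (h : b =ᶠ[𝓝 u] b') :
    ∀ᶠ x in 𝓝 u, ∀ v w, extD b x v w = extD b' x v w := by
  filter_upwards [h.eventuallyEq_nhds] with x hx v w using extD_congr hx v w

lemma extD_swap (b : E → E →L[ℝ] ℝ) (u v w : E) : extD b u w v = - extD b u v w := by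
  simp [extD]

lemma extD_add_left (b : E → E →L[ℝ] ℝ) (u v v' w : E) :
    extD b u (v + v') w = extD b u v w + extD b u v' w := by
  simp only [extD, map_add, add_apply]; ring

lemma extD_smul_left (b : E → E →L[ℝ] ℝ) (u v w : E) (c : ℝ) :
    extD b u (c • v) w = c * extD b u v w := by
  simp only [extD, map_smul, smul_apply, smul_eq_mul]; ring

lemma extD_add {b c : E → E →L[ℝ] ℝ} {u : E} (hb : DifferentiableAt ℝ b u)
    (hc : DifferentiableAt ℝ c u) (v w : E) :
    extD (fun x => b x + c x) u v w = extD b u v w + extD c u v w := by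
  simp only [extD, fderiv_fun_add hb hc, add_apply]; ring

lemma extD_smul {f : E → ℝ} {b : E → E →L[ℝ] ℝ} {u : E} (hf : DifferentiableAt ℝ f u)
    (hb : DifferentiableAt ℝ b u) (v w : E) :
    extD (fun x => f x • b x) u v w =
      f u * extD b u v w + (fderiv ℝ f u v * b u w - fderiv ℝ f u w * b u v) := by
  simp only [extD, fderiv_fun_smul hf hb, add_apply,
    smul_apply, ContinuousLinearMap.smulRight_apply, smul_eq_mul]; ring

lemma extD_const_smul {b : E → E →L[ℝ] ℝ} {u : E} (hb : DifferentiableAt ℝ b u) (c : ℝ)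
    (v w : E) :
    extD (fun x => c • b x) u v w = c * extD b u v w := by
  simp only [extD, fderiv_fun_const_smul hb, smul_apply, smul_eq_mul]; ring

/-- The terms with the second derivative of τ cancel because that derivative is symmetric; this is
why τ must be C². -/
lemma extD_pullForm {τ : E → F} {b : F → F →L[ℝ] ℝ} {u : E} (hb : DifferentiableAt ℝ b (τ u))
    (hτ : ContDiffAt ℝ 2 τ u) (v w : E) :
    extD (pullForm τ b) u v w = extD b (τ u) (fderiv ℝ τ u v) (fderiv ℝ τ u w) := by
  have h1 : DifferentiableAt ℝ τ u := hτ.differentiableAt (by norm_num)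
  have h2 : DifferentiableAt ℝ (fderiv ℝ τ) u :=
    (hτ.fderiv_right (m := 1) (by norm_num)).differentiableAt (by norm_num)
  have hsymm : fderiv ℝ (fderiv ℝ τ) u v w = fderiv ℝ (fderiv ℝ τ) u w v :=
    (hτ.isSymmSndFDerivAt (by simp)).eq v w
  have h3 : DifferentiableAt ℝ (fun x => b (τ x)) u := hb.comp u h1
  have h4 : fderiv ℝ (fun x => b (τ x)) u = (fderiv ℝ b (τ u)).comp (fderiv ℝ τ u) :=
    fderiv_comp u hb h1
  have h5 : fderiv ℝ (pullForm τ b) u = _ := fderiv_clm_comp h3 h2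
  simp only [extD, h5, h4]
  simp [hsymm]

lemma ContDiffAt.pullForm {τ : E → F} {b : F → F →L[ℝ] ℝ} {u : E} {k : WithTop ℕ∞}
    (hb : ContDiffAt ℝ k b (τ u)) (hτ : ContDiffAt ℝ ∞ τ u) (hk : k + 1 ≤ ((⊤ : ℕ∞) : WithTop ℕ∞)) :
    ContDiffAt ℝ k (pullForm τ b) u :=
  (hb.comp u (hτ.of_le (le_self_add.trans hk))).clm_comp (hτ.fderiv_right (m := k) hk)

/-- If `b(X)` is locally constant then `L_X b = ι_X db`. -/
lemma extD_eq_lie {b : E → E →L[ℝ] ℝ} {X : E → E} {u : E} {c : ℝ} (hb : DifferentiableAt ℝ b u)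
    (hX : DifferentiableAt ℝ X u) (hc : ∀ᶠ x in 𝓝 u, b x (X x) = c) (w : E) :
    fderiv ℝ b u (X u) w + b u (fderiv ℝ X u w) = extD b u (X u) w := by
  have h : fderiv ℝ (fun x => b x (X x)) u = 0 := by
    have : (fun x => b x (X x)) =ᶠ[𝓝 u] fun _ => c := hc
    rw [this.fderiv_eq]; simp
  rw [fderiv_clm_apply hb hX] at h
  have := congrArg (fun l => l w) h
  simp at this
  simp only [extD]; linarith

end ExteriorDerivative

/-! ### Coframes of ℝ³ and their dual frames -/

section Coframe

/-- Three covectors on `ℝ³` that vanish simultaneously only at `0`. -/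
def IsCoframe (b p s : Model 3 →L[ℝ] ℝ) : Prop := ∀ v, b v = 0 → p v = 0 → s v = 0 → v = 0

/-- `X, Y, Z` is the frame dual to the coframe `b, p, s`. -/
structure IsDualFrame (b p s : Model 3 →L[ℝ] ℝ) (X Y Z : Model 3) : Prop where
  bX : b X = 1
  pX : p X = 0
  sX : s X = 0
  bY : b Y = 0
  pY : p Y = 1
  sY : s Y = 0
  bZ : b Z = 0
  pZ : p Z = 0
  sZ : s Z = 1
  decomp : ∀ v, v = b v • X + p v • Y + s v • Z

/-- The map to `ℝ³` given by three covectors. -/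
def coframeMap (b p s : Model 3 →L[ℝ] ℝ) : Model 3 →L[ℝ] ℝ × ℝ × ℝ := b.prod (p.prod s)

lemma IsCoframe.exists_equiv {b p s : Model 3 →L[ℝ] ℝ} (h : IsCoframe b p s) :
    ∃ e : Model 3 ≃L[ℝ] ℝ × ℝ × ℝ, (e : Model 3 →L[ℝ] ℝ × ℝ × ℝ) = coframeMap b p s := by
  have hi : Function.Injective (coframeMap b p s).toLinearMap := by
    rw [← LinearMap.ker_eq_bot, LinearMap.ker_eq_bot']
    intro v hv
    have : b v = 0 ∧ p v = 0 ∧ s v = 0 := by simpa [coframeMap] using hv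
    exact h v this.1 this.2.1 this.2.2
  refine ⟨(LinearEquiv.ofInjectiveOfFinrankEq _ hi (by simp)).toContinuousLinearEquiv, ?_⟩
  ext v <;> rfl

lemma isDualFrame_of_equiv {b p s : Model 3 →L[ℝ] ℝ} (e : Model 3 ≃L[ℝ] ℝ × ℝ × ℝ)
    (he : (e : Model 3 →L[ℝ] ℝ × ℝ × ℝ) = coframeMap b p s) :
    IsDualFrame b p s (e.symm (1, 0, 0)) (e.symm (0, 1, 0)) (e.symm (0, 0, 1)) := by
  have h : ∀ v, (b v, p v, s v) = e v := fun v => by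
    rw [← ContinuousLinearEquiv.coe_coe, he]; rfl
  have h1 : ∀ c, (b (e.symm c), p (e.symm c), s (e.symm c)) = c := fun c => by rw [h]; simp
  have := h1 (1, 0, 0)
  have h2 := h1 (0, 1, 0)
  have h3 := h1 (0, 0, 1)
  simp only [Prod.mk.injEq] at this h2 h3
  refine ⟨this.1, this.2.1, this.2.2, h2.1, h2.2.1, h2.2.2, h3.1, h3.2.1, h3.2.2, fun v => ?_⟩
  apply e.injective
  simp [← h, this, h2, h3]

lemma IsDualFrame.isCoframe {b p s : Model 3 →L[ℝ] ℝ} {X Y Z : Model 3}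
    (h : IsDualFrame b p s X Y Z) : IsCoframe b p s := by
  intro v h1 h2 h3
  rw [h.decomp v, h1, h2, h3]; simp

lemma IsCoframe.exists_dualFrame {b p s : Model 3 →L[ℝ] ℝ} (h : IsCoframe b p s) :
    ∃ X Y Z, IsDualFrame b p s X Y Z := by
  obtain ⟨e, he⟩ := h.exists_equiv
  exact ⟨_, _, _, isDualFrame_of_equiv e he⟩

/-- The coframe is a linear isomorphism onto ℝ × ℝ × ℝ at the base point. Invertibility is an open
condition and inversion is smooth, so the preimages of the standard basis form a smooth frame
nearby. -/
lemma IsCoframe.exists_smooth_dualFrame {b p s : Model 3 → Model 3 →L[ℝ] ℝ} {u₀ : Model 3}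
    {k : WithTop ℕ∞}
    (hb : ContDiffAt ℝ k b u₀) (hp : ContDiffAt ℝ k p u₀) (hs : ContDiffAt ℝ k s u₀)
    (h : IsCoframe (b u₀) (p u₀) (s u₀)) :
    ∃ X Y Z : Model 3 → Model 3, ContDiffAt ℝ k X u₀ ∧ ContDiffAt ℝ k Y u₀ ∧ ContDiffAt ℝ k Z u₀ ∧
      ∀ᶠ u in 𝓝 u₀, IsDualFrame (b u) (p u) (s u) (X u) (Y u) (Z u) := by
  obtain ⟨e, he⟩ := h.exists_equiv
  set A : Model 3 → (Model 3 →L[ℝ] ℝ × ℝ × ℝ) := fun u => coframeMap (b u) (p u) (s u) with hA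
  have hAs : ContDiffAt ℝ k A u₀ := by
    have h1 : A = fun u =>
        (ContinuousLinearMap.inl ℝ ℝ (ℝ × ℝ)).comp (b u) +
        (((ContinuousLinearMap.inr ℝ ℝ (ℝ × ℝ)).comp (ContinuousLinearMap.inl ℝ ℝ ℝ)).comp (p u) +
        ((ContinuousLinearMap.inr ℝ ℝ (ℝ × ℝ)).comp (ContinuousLinearMap.inr ℝ ℝ ℝ)).comp (s u)) := by
      funext u; ext v <;> simp [hA, coframeMap]
    rw [h1]
    exact (contDiffAt_const.clm_comp hb).add
      ((contDiffAt_const.clm_comp hp).add (contDiffAt_const.clm_comp hs))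
  have hinv : ContDiffAt ℝ k (fun u => ContinuousLinearMap.inverse (A u)) u₀ := by
    have := contDiffAt_map_inverse (𝕜 := ℝ) (n := k) e
    rw [he] at this
    exact this.comp u₀ hAs
  refine ⟨fun u => ContinuousLinearMap.inverse (A u) (1, 0, 0),
    fun u => ContinuousLinearMap.inverse (A u) (0, 1, 0),
    fun u => ContinuousLinearMap.inverse (A u) (0, 0, 1),
    hinv.clm_apply contDiffAt_const, hinv.clm_apply contDiffAt_const,
    hinv.clm_apply contDiffAt_const, ?_⟩
  have hev : ∀ᶠ u in 𝓝 u₀, A u ∈ range ((↑) : (Model 3 ≃L[ℝ] ℝ × ℝ × ℝ) → _) := by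
    apply hAs.continuousAt
    have := ContinuousLinearEquiv.nhds e
    rwa [he] at this
  filter_upwards [hev] with u ⟨e', he'⟩
  have := isDualFrame_of_equiv (b := b u) (p := p u) (s := s u) e' he'
  simpa [← he'] using this

end Coframe

/-! ### Germs of Anosov contact forms -/

section Germ

/-- `ContDiffAt ℝ ∞` at a point yields, for each finite order, a neighbourhood that depends on the
order. Statements about nearby points are therefore extracted at a finite order. -/
lemma ContDiffAt.eventually_one {E F : Type*} [NormedAddCommGroup E] [NormedSpace ℝ E]
    [NormedAddCommGroup F] [NormedSpace ℝ F] {f : E → F} {u : E} (h : ContDiffAt ℝ ∞ f u) :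
    ∀ᶠ x in 𝓝 u, ContDiffAt ℝ 1 f x :=
  (h.of_le (by exact_mod_cast le_top)).eventually (by simp)

lemma ContDiffAt.eventually_two {E F : Type*} [NormedAddCommGroup E] [NormedSpace ℝ E]
    [NormedAddCommGroup F] [NormedSpace ℝ F] {f : E → F} {u : E} (h : ContDiffAt ℝ ∞ f u) :
    ∀ᶠ x in 𝓝 u, ContDiffAt ℝ 2 f x :=
  (h.of_le (WithTop.coe_le_coe.2 (le_top : (2 : ℕ∞) ≤ ⊤))).eventually (by simp)

lemma ContDiffAt.eventually_differentiableAt {E F : Type*} [NormedAddCommGroup E]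
    [NormedSpace ℝ E] [NormedAddCommGroup F] [NormedSpace ℝ F] {f : E → F} {u : E}
    (h : ContDiffAt ℝ ∞ f u) : ∀ᶠ x in 𝓝 u, DifferentiableAt ℝ f x :=
  h.eventually_one.mono fun _ hx => hx.differentiableAt (by norm_num)

lemma ContDiffAt.differentiableAt_infty {E F : Type*} [NormedAddCommGroup E]
    [NormedSpace ℝ E] [NormedAddCommGroup F] [NormedSpace ℝ F] {f : E → F} {u : E}
    (h : ContDiffAt ℝ ∞ f u) : DifferentiableAt ℝ f u := h.differentiableAt (by simp)

/-- The structure equations, near `u₀`, of an Anosov contact form `b` on `ℝ³`, with an expanded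
covector field `p` and a contracted covector field `s`, both with the constant rate `μ`. -/
structure AnosovGerm (μ : ℝ) (b p s : Model 3 → Model 3 →L[ℝ] ℝ) (u₀ : Model 3) : Prop where
  smooth_b : ContDiffAt ℝ ∞ b u₀
  smooth_p : ContDiffAt ℝ ∞ p u₀
  smooth_s : ContDiffAt ℝ ∞ s u₀
  coframe : IsCoframe (b u₀) (p u₀) (s u₀)
  -- The factor 2 absorbs the 1/2 in g(·, φ·) = dα/2: the form dα/2 becomes p∧s.
  db : ∀ᶠ u in 𝓝 u₀, ∀ v w, extD b u v w = 2 * (p u v * s u w - p u w * s u v)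
  -- The three conditions single out the Reeb vector without naming a frame, so that the structure
  -- pulls back directly.
  dp : ∀ᶠ u in 𝓝 u₀, ∀ X w, b u X = 1 → p u X = 0 → s u X = 0 → extD p u X w = μ * p u w
  ds : ∀ᶠ u in 𝓝 u₀, ∀ X w, b u X = 1 → p u X = 0 → s u X = 0 → extD s u X w = -μ * s u w

variable {μ : ℝ} {b p s : Model 3 → Model 3 →L[ℝ] ℝ} {u₀ : Model 3}

lemma AnosovGerm.exists_frame (h : AnosovGerm μ b p s u₀) :
    ∃ X Y Z : Model 3 → Model 3, ContDiffAt ℝ ∞ X u₀ ∧ ContDiffAt ℝ ∞ Y u₀ ∧ ContDiffAt ℝ ∞ Z u₀ ∧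
      ∀ᶠ u in 𝓝 u₀, IsDualFrame (b u) (p u) (s u) (X u) (Y u) (Z u) :=
  h.coframe.exists_smooth_dualFrame h.smooth_b h.smooth_p h.smooth_s

lemma AnosovGerm.congr (h : AnosovGerm μ b p s u₀) {b' : Model 3 → Model 3 →L[ℝ] ℝ}
    (hb : b' =ᶠ[𝓝 u₀] b) : AnosovGerm μ b' p s u₀ where
  smooth_b := h.smooth_b.congr_of_eventuallyEq hb
  smooth_p := h.smooth_p
  smooth_s := h.smooth_s
  coframe := by rw [hb.eq_of_nhds]; exact h.coframe
  db := by
    filter_upwards [h.db, eventually_extD_congr hb] with u hu hu' v w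
    rw [hu', hu]
  dp := by
    filter_upwards [h.dp, hb] with u hu hu' X w
    rw [hu']; exact hu X w
  ds := by
    filter_upwards [h.ds, hb] with u hu hu' X w
    rw [hu']; exact hu X w

lemma AnosovGerm.pull {τ : Model 3 → Model 3} {u₁ : Model 3} (h : AnosovGerm μ b p s (τ u₁))
    (hτ : ContDiffAt ℝ ∞ τ u₁) (hinj : Function.Injective (fderiv ℝ τ u₁)) :
    AnosovGerm μ (pullForm τ b) (pullForm τ p) (pullForm τ s) u₁ where
  smooth_b := h.smooth_b.pullForm hτ (by simp)
  smooth_p := h.smooth_p.pullForm hτ (by simp)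
  smooth_s := h.smooth_s.pullForm hτ (by simp)
  coframe := by
    intro v h1 h2 h3
    have := h.coframe _ h1 h2 h3
    exact hinj (by simpa using this)
  db := by
    filter_upwards [hτ.continuousAt.eventually h.db,
      hτ.continuousAt.eventually h.smooth_b.eventually_differentiableAt, hτ.eventually_two]
      with u hu hd h2 v w
    rw [extD_pullForm hd h2, hu]; rfl
  dp := by
    filter_upwards [hτ.continuousAt.eventually h.dp,
      hτ.continuousAt.eventually h.smooth_p.eventually_differentiableAt, hτ.eventually_two]
      with u hu hd h2 v w h3 h4 h5
    rw [extD_pullForm hd h2]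
    exact hu _ _ h3 h4 h5
  ds := by
    filter_upwards [hτ.continuousAt.eventually h.ds,
      hτ.continuousAt.eventually h.smooth_s.eventually_differentiableAt, hτ.eventually_two]
      with u hu hd h2 v w h3 h4 h5
    rw [extD_pullForm hd h2]
    exact hu _ _ h3 h4 h5

lemma extD_neg {E : Type*} [NormedAddCommGroup E] [NormedSpace ℝ E] (b : E → E →L[ℝ] ℝ)
    (u v w : E) : extD (fun x => -b x) u v w = -extD b u v w := by
  simp only [extD, fderiv_fun_neg, neg_apply]; ring

/-- Time reversal. -/
lemma AnosovGerm.swap (h : AnosovGerm μ b p s u₀) :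
    AnosovGerm (-μ) b s (fun u => -p u) u₀ where
  smooth_b := h.smooth_b
  smooth_p := h.smooth_s
  smooth_s := h.smooth_p.neg
  coframe := fun v h1 h2 h3 => h.coframe v h1 (by simpa using h3) h2
  -- The sign of the new contracted covector is forced here: s∧(-p) = p∧s.
  db := by
    filter_upwards [h.db] with u hu v w
    rw [hu]; simp only [neg_apply]; ring
  dp := by
    filter_upwards [h.ds] with u hu X w h1 h2 h3
    exact hu X w h1 (by simpa using h3) h2
  ds := by
    filter_upwards [h.dp] with u hu X w h1 h2 h3
    rw [extD_neg, hu X w h1 (by simpa using h3) h2]; simp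

/-- Rescaling by a function that is constant along the flow. -/
lemma AnosovGerm.rescale (h : AnosovGerm μ b p s u₀) {f : Model 3 → ℝ}
    (hf : ContDiffAt ℝ ∞ f u₀) (hf0 : f u₀ ≠ 0)
    (hX : ∀ᶠ u in 𝓝 u₀, ∀ X, b u X = 1 → p u X = 0 → s u X = 0 → fderiv ℝ f u X = 0) :
    AnosovGerm μ b (fun u => f u • p u) (fun u => (f u)⁻¹ • s u) u₀ where
  smooth_b := h.smooth_b
  smooth_p := hf.smul h.smooth_p
  smooth_s := (hf.inv hf0).smul h.smooth_s
  coframe := fun v h1 h2 h3 => h.coframe v h1 (by simpa [hf0] using h2) (by simpa [hf0] using h3)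
  db := by
    filter_upwards [h.db, hf.continuousAt.eventually_ne hf0] with u hu h0 v w
    rw [hu]; simp only [smul_apply, smul_eq_mul]; field_simp
  dp := by
    filter_upwards [h.dp, hf.continuousAt.eventually_ne hf0, hX, hf.eventually_differentiableAt,
      h.smooth_p.eventually_differentiableAt] with u hu h0 hx hfd hpd X w h1 h2 h3
    simp only [smul_apply, smul_eq_mul, mul_eq_zero, inv_eq_zero, h0, false_or] at h2 h3
    rw [extD_smul hfd hpd, hu X w h1 h2 h3, hx X h1 h2 h3, h2]
    simp only [smul_apply, smul_eq_mul]; ring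
  ds := by
    filter_upwards [h.ds, hf.continuousAt.eventually_ne hf0, hX, hf.eventually_differentiableAt,
      h.smooth_s.eventually_differentiableAt] with u hu h0 hx hfd hpd X w h1 h2 h3
    simp only [smul_apply, smul_eq_mul, mul_eq_zero, inv_eq_zero, h0, false_or] at h2 h3
    have h4 : fderiv ℝ (fun u => (f u)⁻¹) u X = 0 := by
      rw [show (fun u => (f u)⁻¹) = (fun y => y⁻¹) ∘ f from rfl,
        ((hasDerivAt_inv h0).comp_hasFDerivAt u hfd.hasFDerivAt).fderiv]; simp [hx X h1 h2 h3]
    rw [extD_smul (f := fun u => (f u)⁻¹) (hfd.inv h0) hpd, hu X w h1 h2 h3, h4, h3]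
    simp only [smul_apply, smul_eq_mul]; ring

/-- The derivative along the flow of the coefficients of a 1-form with respect to `b, p, s`. -/
lemma AnosovGerm.coeff_deriv (h : AnosovGerm μ b p s u₀) {X Y Z : Model 3 → Model 3}
    (hY : ContDiffAt ℝ ∞ Y u₀) (hZ : ContDiffAt ℝ ∞ Z u₀)
    (hfr : ∀ᶠ u in 𝓝 u₀, IsDualFrame (b u) (p u) (s u) (X u) (Y u) (Z u))
    {c : Model 3 → Model 3 →L[ℝ] ℝ} (hc : ContDiffAt ℝ ∞ c u₀) {k : ℝ}
    (hk : ∀ᶠ u in 𝓝 u₀, c u (X u) = k) :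
    ∀ᶠ u in 𝓝 u₀,
      fderiv ℝ (fun x => c x (Y x)) u (X u) = extD c u (X u) (Y u) - μ * c u (Y u) ∧
      fderiv ℝ (fun x => c x (Z x)) u (X u) = extD c u (X u) (Z u) + μ * c u (Z u) := by
  -- Take d of c = k b + c(Y) p + c(Z) s and contract with X: db contributes nothing, dp and ds
  -- contribute μp and -μs, and the derivatives of the two coefficients along X can be read off.
  have hdec : c =ᶠ[𝓝 u₀] fun u => k • b u + (c u (Y u) • p u + c u (Z u) • s u) := by
    filter_upwards [hfr, hk] with u hu hk
    ext v
    conv_lhs => rw [hu.decomp v]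
    simp [hk]; ring
  have hcY : ContDiffAt ℝ ∞ (fun x => c x (Y x)) u₀ := hc.clm_apply hY
  have hcZ : ContDiffAt ℝ ∞ (fun x => c x (Z x)) u₀ := hc.clm_apply hZ
  filter_upwards [hfr, h.db, h.dp, h.ds, eventually_extD_congr hdec,
    hcY.eventually_differentiableAt, hcZ.eventually_differentiableAt,
    h.smooth_b.eventually_differentiableAt, h.smooth_p.eventually_differentiableAt,
    h.smooth_s.eventually_differentiableAt] with u hu hdb hdp hds hext h1 h2 h3 h4 h5
  have key : ∀ w, extD c u (X u) w = k * extD b u (X u) w +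
      ((c u (Y u) * extD p u (X u) w + (fderiv ℝ (fun x => c x (Y x)) u (X u) * p u w -
        fderiv ℝ (fun x => c x (Y x)) u w * p u (X u))) +
      (c u (Z u) * extD s u (X u) w + (fderiv ℝ (fun x => c x (Z x)) u (X u) * s u w -
        fderiv ℝ (fun x => c x (Z x)) u w * s u (X u)))) := fun w => by
    rw [hext, extD_add (b := fun u => k • b u) (c := fun u => c u (Y u) • p u + c u (Z u) • s u)
      (h3.const_smul k) ((h1.smul h4).add (h2.smul h5)), extD_const_smul h3,
      extD_add (b := fun u => c u (Y u) • p u) (c := fun u => c u (Z u) • s u)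
      (h1.smul h4) (h2.smul h5), extD_smul h1 h4, extD_smul h2 h5]
  constructor
  · rw [key, hdb, hdp _ _ hu.bX hu.pX hu.sX, hds _ _ hu.bX hu.pX hu.sX]
    simp [hu.pX, hu.sX, hu.pY, hu.sY]; ring
  · rw [key, hdb, hdp _ _ hu.bX hu.pX hu.sX, hds _ _ hu.bX hu.pX hu.sX]
    simp [hu.pX, hu.sX, hu.pZ, hu.sZ]; ring

end Germ

/-! ### Recovering a pair of covectors from its square -/

section Signs

open Complex

/-- A pair of covectors is determined up to a common sign by the square of `p + i s`. -/
lemma covector_pair_eq_or_neg {V : Type*} [AddCommGroup V] [Module ℝ V] {p s p' s' : V →ₗ[ℝ] ℝ}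
    (h : ∀ v, ((p v : ℂ) + s v * I) ^ 2 = ((p' v : ℂ) + s' v * I) ^ 2) :
    (p' = p ∧ s' = s) ∨ (p' = -p ∧ s' = -s) := by
  have h1 : ∀ v, (p' v = p v ∧ s' v = s v) ∨ (p' v = - p v ∧ s' v = - s v) := fun v => by
    rcases sq_eq_sq_iff_eq_or_eq_neg.1 (h v) with h | h
    · left
      have h1 := congrArg re h
      have h2 := congrArg im h
      simp at h1 h2
      exact ⟨h1.symm, h2.symm⟩
    · right
      have h1 := congrArg re h
      have h2 := congrArg im h
      simp at h1 h2
      constructor <;> linarith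
  by_contra hcon
  push Not at hcon
  have hA : ∃ v, ¬ (p' v = p v ∧ s' v = s v) := by
    by_contra hA
    push Not at hA
    exact hcon.1 (LinearMap.ext fun v => (hA v).1) (LinearMap.ext fun v => (hA v).2)
  have hB : ∃ v, ¬ (p' v = -p v ∧ s' v = -s v) := by
    by_contra hB
    push Not at hB
    exact hcon.2 (LinearMap.ext fun v => (hB v).1) (LinearMap.ext fun v => (hB v).2)
  obtain ⟨v, hv⟩ := hA
  obtain ⟨w, hw⟩ := hB
  have hv' := (h1 v).resolve_left hv
  have hw' := (h1 w).resolve_right hw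
  -- A vector space is not the union of two proper subspaces: v violates the first alternative, w
  -- the second, and v + w would have to satisfy one of them.
  rcases h1 (v + w) with h2 | h2
  · simp only [map_add] at h2
    exact hv ⟨by linarith [h2.1, h2.2, hw'.1, hw'.2], by linarith [h2.1, h2.2, hw'.1, hw'.2]⟩
  · simp only [map_add] at h2
    exact hw ⟨by linarith [h2.1, h2.2, hv'.1, hv'.2], by linarith [h2.1, h2.2, hv'.1, hv'.2]⟩

end Signs

/-! ### Tensors and maps in preferred charts -/

section Charts

variable {n : ℕ} {M : Type*} [TopologicalSpace M] [ChartedSpace (Model n) M]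

lemma extChartAt_target_mem_nhds_of_mem {x : M} {u : Model n}
    (hu : u ∈ (extChartAt (𝓡 n) x).target) : (extChartAt (𝓡 n) x).target ∈ 𝓝 u :=
  (isOpen_extChartAt_target x).mem_nhds hu

lemma eventually_mem_target (x : M) :
    ∀ᶠ u in 𝓝 (extChartAt (𝓡 n) x x), u ∈ (extChartAt (𝓡 n) x).target :=
  extChartAt_target_mem_nhds x

lemma extChartAt_chartInv {x : M} {u : Model n} (hu : u ∈ (extChartAt (𝓡 n) x).target) :
    extChartAt (𝓡 n) x (chartInv x u) = u := (extChartAt (𝓡 n) x).right_inv hu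

lemma chartInv_extChartAt {x y : M} (hy : y ∈ (extChartAt (𝓡 n) x).source) :
    chartInv x (extChartAt (𝓡 n) x y) = y := (extChartAt (𝓡 n) x).left_inv hy

lemma chartInv_center (x : M) : chartInv x (extChartAt (𝓡 n) x x) = x :=
  chartInv_extChartAt (mem_extChartAt_source x)

lemma chartInv_mem_source {x : M} {u : Model n} (hu : u ∈ (extChartAt (𝓡 n) x).target) :
    chartInv x u ∈ (extChartAt (𝓡 n) x).source := (extChartAt (𝓡 n) x).map_target hu

variable [IsManifold (𝓡 n) ∞ M]

lemma contMDiffAt_chartInv {x : M} {u : Model n} (hu : u ∈ (extChartAt (𝓡 n) x).target) :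
    ContMDiffAt 𝓘(ℝ, Model n) (𝓡 n) ∞ (chartInv (n := n) x) u :=
  (contMDiffOn_extChartAt_symm x).contMDiffAt (extChartAt_target_mem_nhds_of_mem hu)

lemma mdifferentiableAt_chartInv {x : M} {u : Model n} (hu : u ∈ (extChartAt (𝓡 n) x).target) :
    MDifferentiableAt 𝓘(ℝ, Model n) (𝓡 n) (chartInv (n := n) x) u :=
  (contMDiffAt_chartInv hu).mdifferentiableAt (by simp)

lemma continuousAt_chartInv {x : M} {u : Model n} (hu : u ∈ (extChartAt (𝓡 n) x).target) :
    ContinuousAt (chartInv (n := n) x) u :=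
  (continuousOn_extChartAt_symm x).continuousAt (extChartAt_target_mem_nhds_of_mem hu)

lemma chartInvDeriv_center (x : M) (v : Model n) :
    (chartInvDeriv x (extChartAt (𝓡 n) x x) v : Model n) = v := by
  have : IsManifold (𝓡 n) 1 M := IsManifold.of_le (n := ∞) (by simp)
  have h := mfderivWithin_range_extChartAt_symm (I := 𝓡 n) (x := x)
  have h2 : (𝓡 n).toFun '' univ = univ := by simp
  rw [show range (𝓡 n) = univ from by simp, mfderivWithin_univ] at h
  unfold chartInvDeriv chartInv
  rw [h]; rfl

/-- The coordinate expression of a map. -/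
def chartRep (m n : ℕ) {M N : Type*} [TopologicalSpace M] [ChartedSpace (Model n) M]
    [TopologicalSpace N] [ChartedSpace (Model m) N] (f : N → M) (z : N) (y : M) (u : Model m) : Model n := extChartAt (𝓡 n) y (f (chartInv z u))

section Rep

variable {m : ℕ} {N : Type*} [TopologicalSpace N] [ChartedSpace (Model m) N]
  [IsManifold (𝓡 m) ∞ N] {f : N → M} {z : N} {y : M}

lemma contDiffAt_chartRep (hf : ContMDiffAt (𝓡 m) (𝓡 n) ∞ f z)
    (hy : f z ∈ (extChartAt (𝓡 n) y).source) :
    ContDiffAt ℝ ∞ (chartRep m n f z y) (extChartAt (𝓡 m) z z) := by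
  rw [← contMDiffAt_iff_contDiffAt]
  have h1 := contMDiffAt_chartInv (mem_extChartAt_target (I := 𝓡 m) z)
  have h2 : ContMDiffAt (𝓡 n) 𝓘(ℝ, Model n) ∞ (extChartAt (𝓡 n) y) (f z) :=
    contMDiffAt_extChartAt' (by rwa [extChartAt_source] at hy)
  have hf' : ContMDiffAt (𝓡 m) (𝓡 n) ∞ f (chartInv z (extChartAt (𝓡 m) z z)) := by
    rwa [chartInv_center]
  have h2' : ContMDiffAt (𝓡 n) 𝓘(ℝ, Model n) ∞ (extChartAt (𝓡 n) y)
    ((f ∘ chartInv z) (extChartAt (𝓡 m) z z)) := by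
    rwa [Function.comp_apply, chartInv_center]
  exact h2'.comp _ (hf'.comp _ h1)

lemma eventually_chartRep (hf : ContMDiffAt (𝓡 m) (𝓡 n) ∞ f z)
    (hy : f z ∈ (extChartAt (𝓡 n) y).source) :
    ∀ᶠ u in 𝓝 (extChartAt (𝓡 m) z z), u ∈ (extChartAt (𝓡 m) z).target ∧
      chartRep m n f z y u ∈ (extChartAt (𝓡 n) y).target ∧
      f (chartInv z u) = chartInv y (chartRep m n f z y u) := by
  have h1 : ContinuousAt (fun u => f (chartInv z u)) (extChartAt (𝓡 m) z z) :=
    ContinuousAt.comp (f := chartInv z) (g := f) (by rw [chartInv_center]; exact hf.continuousAt)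
      (continuousAt_chartInv (mem_extChartAt_target z))
  have h2 : ∀ᶠ u in 𝓝 (extChartAt (𝓡 m) z z), f (chartInv z u) ∈ (extChartAt (𝓡 n) y).source := by
    apply h1
    simp only [chartInv_center]
    exact (isOpen_extChartAt_source y).mem_nhds hy
  filter_upwards [h2, eventually_mem_target z] with u hu hu'
  exact ⟨hu', (extChartAt (𝓡 n) y).map_source hu, (chartInv_extChartAt hu).symm⟩

lemma eventually_mfderiv_chartRep (hf : ContMDiffAt (𝓡 m) (𝓡 n) ∞ f z)
    (hy : f z ∈ (extChartAt (𝓡 n) y).source) :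
    ∀ᶠ u in 𝓝 (extChartAt (𝓡 m) z z), ∀ v : Model m,
      (mfderiv (𝓡 m) (𝓡 n) f (chartInv z u) (chartInvDeriv z u v) : Model n) =
        (chartInvDeriv y (chartRep m n f z y u) (fderiv ℝ (chartRep m n f z y) u v) : Model n) := by
  have h1 : ∀ᶠ z' in 𝓝 z, ContMDiffAt (𝓡 m) (𝓡 n) 1 f z' :=
    contMDiffAt_iff_contMDiffAt_nhds (by simp) |>.1
      (hf.of_le (by exact_mod_cast le_top))
  have h2 : ∀ᶠ u in 𝓝 (extChartAt (𝓡 m) z z), ContMDiffAt (𝓡 m) (𝓡 n) 1 f (chartInv z u) := by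
    have := continuousAt_chartInv (mem_extChartAt_target (I := 𝓡 m) z)
    rw [ContinuousAt, chartInv_center] at this
    exact this.eventually h1
  filter_upwards [(eventually_chartRep hf hy).eventually_nhds, h2,
    (contDiffAt_chartRep hf hy).eventually_differentiableAt] with u hu hfu hd v
  have hu0 := hu.self_of_nhds
  have e1 := mfderiv_comp u (hfu.mdifferentiableAt (by simp)) (mdifferentiableAt_chartInv hu0.1)
  have e2 := mfderiv_comp u (mdifferentiableAt_chartInv hu0.2.1) hd.mdifferentiableAt
  have e3 : (f ∘ chartInv z) =ᶠ[𝓝 u] (chartInv y ∘ chartRep m n f z y) := hu.mono fun _ h => h.2.2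
  have e4 := e3.mfderiv_eq (I := 𝓘(ℝ, Model m)) (I' := 𝓡 n)
  rw [mfderiv_eq_fderiv] at e2
  have e5 := congrArg (fun L : Model m →L[ℝ] Model n => L v) e1
  have e6 := congrArg (fun L : Model m →L[ℝ] Model n => L v) e2
  have e7 := congrArg (fun L : Model m →L[ℝ] Model n => L v) e4
  exact e5.symm.trans (e7.trans e6)

lemma fderiv_chartRep_center (hf : ContMDiffAt (𝓡 m) (𝓡 n) ∞ f z) (v : Model m) :
    fderiv ℝ (chartRep m n f z (f z)) (extChartAt (𝓡 m) z z) v =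
      (mfderiv (𝓡 m) (𝓡 n) f z (show TangentSpace (𝓡 m) z from v) : Model n) := by
  have h := (eventually_mfderiv_chartRep hf (mem_extChartAt_source (I := 𝓡 n) (f z))).self_of_nhds v
  have hc : chartRep m n f z (f z) (extChartAt (𝓡 m) z z) = extChartAt (𝓡 n) (f z) (f z) := by
    rw [chartRep, chartInv_center]
  have h1 : (chartInvDeriv (f z) (chartRep m n f z (f z) (extChartAt (𝓡 m) z z))
      (fderiv ℝ (chartRep m n f z (f z)) (extChartAt (𝓡 m) z z) v) : Model n) =
      fderiv ℝ (chartRep m n f z (f z)) (extChartAt (𝓡 m) z z) v := by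
    rw [hc]; exact chartInvDeriv_center (f z) _
  rw [h1] at h
  rw [← h]
  have h2 := chartInvDeriv_center z v
  have h3 : ∀ a : N, a = z → ∀ w : Model m, w = v →
      (mfderiv (𝓡 m) (𝓡 n) f a (show TangentSpace (𝓡 m) a from w) : Model n) =
      (mfderiv (𝓡 m) (𝓡 n) f z (show TangentSpace (𝓡 m) z from v) : Model n) := by
    rintro a rfl w rfl; rfl
  exact h3 _ (chartInv_center z) _ h2

end Rep

/-- The coordinate expression of a field of bilinear forms. -/
def bilinInChart (T : ∀ x : M, TangentSpace (𝓡 n) x →L[ℝ] TangentSpace (𝓡 n) x →L[ℝ] ℝ) (x : M)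
    (u : Model n) : Model n →L[ℝ] Model n →L[ℝ] ℝ :=
  ((ContinuousLinearMap.compL ℝ (Model n) (Model n) ℝ).flip (chartInvDeriv x u)).comp
    ((show Model n →L[ℝ] Model n →L[ℝ] ℝ from T (chartInv x u)).comp (chartInvDeriv x u))

lemma bilinInChart_apply (T : ∀ x : M, TangentSpace (𝓡 n) x →L[ℝ] TangentSpace (𝓡 n) x →L[ℝ] ℝ)
    (x : M) (u v w : Model n) : bilinInChart T x u v w =
      T (chartInv x u) (chartInvDeriv x u v) (chartInvDeriv x u w) := rfl

/-- Identifies the differential of the inverse chart with the tangent bundle trivialization, in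
terms of which smoothness of sections is defined. -/
lemma chartInvDeriv_eq_symmL {x y : M}
    (hy : y ∈ (chartAt (Model n) x).source) (v : Model n) :
    (chartInvDeriv x (extChartAt (𝓡 n) x y) v : Model n) =
      ((trivializationAt (Model n) (TangentSpace (𝓡 n)) x).symm y v : Model n) := by
  have : IsManifold (𝓡 n) 1 M := IsManifold.of_le (n := ∞) (by simp)
  have h := TangentBundle.symmL_trivializationAt (I := 𝓡 n) hy
  rw [show range (𝓡 n) = univ from by simp, mfderivWithin_univ] at h
  refine (congrArg (fun L : Model n →L[ℝ] Model n => L v) h).symm.trans ?_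
  exact Trivialization.symmL_apply _ (by simpa using hy) v

lemma contMDiffAt_comp_extChartAt_iff {F : Type*} [NormedAddCommGroup F] [NormedSpace ℝ F]
    {G : Model n → F} {x : M} :
    ContMDiffAt (𝓡 n) 𝓘(ℝ, F) ∞ (fun y => G (extChartAt (𝓡 n) x y)) x ↔
      ContDiffAt ℝ ∞ G (extChartAt (𝓡 n) x x) := by
  constructor
  · intro h
    rw [← contMDiffAt_iff_contDiffAt]
    have h1 := contMDiffAt_chartInv (mem_extChartAt_target (I := 𝓡 n) x)
    have h' : ContMDiffAt (𝓡 n) 𝓘(ℝ, F) ∞ (fun y => G (extChartAt (𝓡 n) x y))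
      (chartInv x (extChartAt (𝓡 n) x x)) := by rwa [chartInv_center]
    refine (h'.comp _ h1).congr_of_eventuallyEq ?_
    filter_upwards [eventually_mem_target x] with u hu
    exact congrArg G (extChartAt_chartInv hu).symm
  · intro h
    exact (contMDiffAt_iff_contDiffAt.2 h).comp x contMDiffAt_extChartAt

/-- In the trivializations around x, the field becomes its coordinate expression, so its smoothness
is that of a function on ℝⁿ. `contMDiffAt_form_iff` does the same for 1-forms. -/
lemma contMDiffAt_bilin_iff
    (T : ∀ x : M, TangentSpace (𝓡 n) x →L[ℝ] TangentSpace (𝓡 n) x →L[ℝ] ℝ) (x : M) :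
    ContMDiffAt (𝓡 n) ((𝓡 n).prod 𝓘(ℝ, Model n →L[ℝ] Model n →L[ℝ] ℝ)) ∞
      (fun x => TotalSpace.mk' (Model n →L[ℝ] Model n →L[ℝ] ℝ)
        (E := fun x : M => TangentSpace (𝓡 n) x →L[ℝ] TangentSpace (𝓡 n) x →L[ℝ] ℝ) x (T x)) x ↔
      ContDiffAt ℝ ∞ (bilinInChart T x) (extChartAt (𝓡 n) x x) := by
  have : IsManifold (𝓡 n) 1 M := IsManifold.of_le (n := ∞) (by simp)
  rw [← contMDiffAt_comp_extChartAt_iff]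
  refine (contMDiffAt_hom_bundle _).trans ?_
  have key : (fun y : M => ContinuousLinearMap.inCoordinates (Model n) (TangentSpace (𝓡 n))
      (Model n →L[ℝ] ℝ) (fun x : M => TangentSpace (𝓡 n) x →L[ℝ] ℝ) x y x y (T y)) =ᶠ[𝓝 x]
      fun y => bilinInChart T x (extChartAt (𝓡 n) x y) := by
    filter_upwards [extChartAt_source_mem_nhds (I := 𝓡 n) x] with y hy
    have hy' : y ∈ (chartAt (Model n) x).source := by rwa [extChartAt_source] at hy
    ext v w
    have h1 := inCoordinates_apply_eq₂ (𝕜 := ℝ) (F₁ := Model n) (F₂ := Model n) (F₃ := ℝ)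
      (E₁ := fun x : M => TangentSpace (𝓡 n) x) (E₂ := fun x : M => TangentSpace (𝓡 n) x)
      (E₃ := Bundle.Trivial M ℝ) (x₀ := x) (x := y) (ϕ := T y) (v := v) (w := w)
      (by simpa using hy') (by simpa using hy') (by simp)
    refine h1.trans ?_
    rw [bilinInChart_apply]
    have e : ∀ a : M, a = y → ∀ v' w' v'' w'' : Model n, v' = v'' → w' = w'' →
        T y (show TangentSpace (𝓡 n) y from v') (show TangentSpace (𝓡 n) y from w') =
        T a (show TangentSpace (𝓡 n) a from v'') (show TangentSpace (𝓡 n) a from w'') := by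
      rintro a rfl v' w' _ _ rfl rfl; rfl
    have e2 := e _ (chartInv_extChartAt hy) _ _ _ _ (chartInvDeriv_eq_symmL hy' v).symm
      (chartInvDeriv_eq_symmL hy' w).symm
    simpa using e2
  constructor
  · intro h
    exact h.2.congr_of_eventuallyEq key.symm
  · intro h
    exact ⟨contMDiffAt_id, h.congr_of_eventuallyEq key⟩

end Charts

section Forms

variable {M : Type*} [TopologicalSpace M] [ChartedSpace (Model 3) M] [IsManifold (𝓡 3) ∞ M]

lemma contMDiffAt_form_iff (α : OneForm M) (x : M) :
    ContMDiffAt (𝓡 3) ((𝓡 3).prod 𝓘(ℝ, Model 3 →L[ℝ] ℝ)) ∞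
      (fun x => TotalSpace.mk' (Model 3 →L[ℝ] ℝ)
        (E := fun x : M => TangentSpace (𝓡 3) x →L[ℝ] Bundle.Trivial M ℝ x) x (α x)) x ↔
      ContDiffAt ℝ ∞ (formInChart α x) (extChartAt (𝓡 3) x x) := by
  have : IsManifold (𝓡 3) 1 M := IsManifold.of_le (n := ∞) (by simp)
  rw [← contMDiffAt_comp_extChartAt_iff]
  refine (contMDiffAt_hom_bundle _).trans ?_
  have key : (fun y : M => ContinuousLinearMap.inCoordinates (Model 3) (TangentSpace (𝓡 3))
      ℝ (Bundle.Trivial M ℝ) x y x y (α y)) =ᶠ[𝓝 x]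
      fun y => formInChart α x (extChartAt (𝓡 3) x y) := by
    filter_upwards [extChartAt_source_mem_nhds (I := 𝓡 3) x] with y hy
    have hy' : y ∈ (chartAt (Model 3) x).source := by rwa [extChartAt_source] at hy
    ext v
    have h1 := ContinuousLinearMap.inCoordinates_eq (𝕜₁ := ℝ) (𝕜₂ := ℝ) (σ := RingHom.id ℝ)
      (F := Model 3) (F' := ℝ)
      (E := fun x : M => TangentSpace (𝓡 3) x)
      (E' := Bundle.Trivial M ℝ) (x₀ := x) (x := y) (y₀ := x) (y := y) (ϕ := α y)
      (by simpa using hy') (by simp)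
    have e : ∀ a : M, a = y → ∀ v' v'' : Model 3, v' = v'' →
        α y (show TangentSpace (𝓡 3) y from v') =
        α a (show TangentSpace (𝓡 3) a from v'') := by
      rintro a rfl v' _ rfl; rfl
    have e2 := e _ (chartInv_extChartAt hy) _ _ (chartInvDeriv_eq_symmL hy' v).symm
    have h2 := congrArg (fun L : Model 3 →L[ℝ] ℝ => L v) h1
    refine h2.trans (Eq.trans ?_ e2)
    simp
  constructor
  · intro h
    exact h.2.congr_of_eventuallyEq key.symm
  · intro h
    exact ⟨contMDiffAt_id, h.congr_of_eventuallyEq key⟩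

variable {N : Type*} [TopologicalSpace N] [ChartedSpace (Model 3) N] [IsManifold (𝓡 3) ∞ N]

/-- The pullback of a 1-form under a map. -/
def pullBack (f : N → M) (α : OneForm M) : OneForm N := fun z =>
  (α (f z)).comp (mfderiv (𝓡 3) (𝓡 3) f z)

/-- The pullback of a function on the tangent bundle under a map. -/
def pullTangentFun {R : Type*} (f : N → M) (q : ∀ x : M, TangentSpace (𝓡 3) x → R) (z : N)
    (v : TangentSpace (𝓡 3) z) : R := q (f z) (mfderiv (𝓡 3) (𝓡 3) f z v)

/-- The coordinate expression of a function on the tangent bundle. -/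
def funInChart {R : Type*} (q : ∀ x : M, TangentSpace (𝓡 3) x → R) (x : M) (u v : Model 3) : R :=
  q (chartInv x u) (chartInvDeriv x u v)

lemma formInChart_apply (α : OneForm M) (x : M) (u v : Model 3) :
    formInChart α x u v = α (chartInv x u) (chartInvDeriv x u v) := rfl

/-- The tangent spaces at two points that are only propositionally equal are different types,
although both unfold to `Model 3`. This performs the transport between them, mostly for `chartInv`
of the chart centre. -/
lemma apply_congr_point {R : Type*} (q : ∀ x : M, TangentSpace (𝓡 3) x → R) {a b : M} (h : a = b)
    {v w : Model 3} (hv : v = w) :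
    q a (show TangentSpace (𝓡 3) a from v) = q b (show TangentSpace (𝓡 3) b from w) := by
  subst h; subst hv; rfl

lemma funInChart_center {R : Type*} (q : ∀ x : M, TangentSpace (𝓡 3) x → R) (x : M)
    (v : Model 3) : funInChart q x (extChartAt (𝓡 3) x x) v =
      q x (show TangentSpace (𝓡 3) x from v) :=
  apply_congr_point q (chartInv_center x) (chartInvDeriv_center x v)

lemma formInChart_center (α : OneForm M) (x : M) (v : Model 3) :
    formInChart α x (extChartAt (𝓡 3) x x) v = α x (show TangentSpace (𝓡 3) x from v) :=
  funInChart_center (fun x v => α x v) x v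

lemma funInChart_pullTangentFun {R : Type*} {f : N → M} {z : N} {y : M}
    (q : ∀ x : M, TangentSpace (𝓡 3) x → R)
    (hf : ContMDiffAt (𝓡 3) (𝓡 3) ∞ f z) (hy : f z ∈ (extChartAt (𝓡 3) y).source) :
    ∀ᶠ u in 𝓝 (extChartAt (𝓡 3) z z), ∀ v, funInChart (pullTangentFun f q) z u v =
      funInChart q y (chartRep 3 3 f z y u) (fderiv ℝ (chartRep 3 3 f z y) u v) := by
  filter_upwards [eventually_chartRep hf hy, eventually_mfderiv_chartRep hf hy] with u h1 h2 v
  exact apply_congr_point q h1.2.2 (h2 v)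

lemma formInChart_pullBack {f : N → M} {z : N} {y : M} (α : OneForm M)
    (hf : ContMDiffAt (𝓡 3) (𝓡 3) ∞ f z) (hy : f z ∈ (extChartAt (𝓡 3) y).source) :
    formInChart (pullBack f α) z =ᶠ[𝓝 (extChartAt (𝓡 3) z z)]
      pullForm (chartRep 3 3 f z y) (formInChart α y) := by
  filter_upwards [funInChart_pullTangentFun (fun x v => α x v) hf hy] with u hu
  ext v
  exact hu v

lemma pullBack_id (α : OneForm M) : pullBack id α = α := by
  funext x
  simp only [pullBack, mfderiv_id]
  rfl

lemma pullTangentFun_id {R : Type*} (q : ∀ x : M, TangentSpace (𝓡 3) x → R) : pullTangentFun id q = q := by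
  funext x v
  simp only [pullTangentFun, mfderiv_id]
  rfl

end Forms

/-! ### Levi-Civita connection and curvature without indices -/

section Matrices

variable {E : Type*} [NormedAddCommGroup E] [NormedSpace ℝ E] {m : WithTop ℕ∞}

lemma ContDiffAt.matrix_det {ι : Type*} [Fintype ι] [DecidableEq ι] {A : E → Matrix ι ι ℝ} {u : E}
    (hA : ∀ i j, ContDiffAt ℝ m (fun y => A y i j) u) : ContDiffAt ℝ m (fun y => (A y).det) u := by
  simp only [Matrix.det_apply']
  exact ContDiffAt.sum fun σ _ => contDiffAt_const.mul (contDiffAt_prod fun i _ => hA _ _)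

/-- By Cramer's rule the entries of the inverse are quotients of determinants. -/
lemma ContDiffAt.matrix_inv {ι : Type*} [Fintype ι] [DecidableEq ι] {A : E → Matrix ι ι ℝ} {u : E}
    (hA : ∀ i j, ContDiffAt ℝ m (fun y => A y i j) u) (h0 : (A u).det ≠ 0) (i j : ι) :
    ContDiffAt ℝ m (fun y => (A y)⁻¹ i j) u := by
  have h1 : (fun y => (A y)⁻¹ i j) = fun y => ((A y).det)⁻¹ * ((A y).updateRow j (Pi.single i 1)).det := by
    funext y
    rw [Matrix.inv_def, Matrix.smul_apply, Matrix.adjugate_apply]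
    simp
  rw [h1]
  refine ((ContDiffAt.matrix_det hA).inv h0).mul (ContDiffAt.matrix_det fun k l => ?_)
  by_cases hk : k = j
  · subst hk; simp only [Matrix.updateRow_self]; exact contDiffAt_const
  · simp only [Matrix.updateRow_ne hk]; exact hA k l

end Matrices

section Coordinates

variable {n : ℕ}

lemma stdVec_apply (i j : Fin n) : (stdVec i : Model n) j = if j = i then 1 else 0 := by
  simp [stdVec]

lemma model_eq_sum (v : Model n) : v = ∑ i, v i • (stdVec i : Model n) := by
  ext j
  simp [stdVec_apply]

end Coordinates

section Trilinear

variable {ι E : Type*} [Finite ι] [NormedAddCommGroup E] [NormedSpace ℝ E]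

lemma eq_zero_of_basis_trilinear (b : Module.Basis ι ℝ E) {T : E → E → E → ℝ}
    (h₁ : ∀ w z, IsLinearMap ℝ fun v => T v w z) (h₂ : ∀ v z, IsLinearMap ℝ fun w => T v w z)
    (h₃ : ∀ v w, IsLinearMap ℝ fun z => T v w z) (h : ∀ i j k, T (b i) (b j) (b k) = 0)
    (v w z : E) : T v w z = 0 := by
  have key : ∀ {f : E → ℝ}, IsLinearMap ℝ f → (∀ i, f (b i) = 0) → ∀ v, f v = 0 :=
    fun {f} hf h0 v => LinearMap.congr_fun (b.ext (f₁ := hf.mk' f) (f₂ := 0) h0) v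
  exact key (h₁ w z) (fun i => key (h₂ (b i) z) (fun j => key (h₃ (b i) (b j)) (h i j) z) w) v

/-- Both sides are trilinear, so the identity for basis vectors, which is what the Christoffel
symbols provide, implies it for all vectors. -/
lemma koszul_of_basis (b : Module.Basis ι ℝ E) {G : E →L[ℝ] E →L[ℝ] ℝ} {Γ : E →L[ℝ] E →L[ℝ] E}
    {D : E →L[ℝ] E →L[ℝ] E →L[ℝ] ℝ}
    (h : ∀ i j k, 2 * G (Γ (b i) (b j)) (b k) =
      D (b i) (b j) (b k) + D (b j) (b i) (b k) - D (b k) (b i) (b j)) (v w z : E) :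
    2 * G (Γ v w) z = D v w z + D w v z - D z v w := by
  have hD1 : ∀ v v' w z, D (v + v') w z = D v w z + D v' w z := fun v v' w z => by
    rw [D.map_add]; rfl
  have hD2 : ∀ v w w' z, D v (w + w') z = D v w z + D v w' z := fun v w w' z => by
    rw [(D v).map_add]; rfl
  have hD3 : ∀ v w z z', D v w (z + z') = D v w z + D v w z' := fun v w => (D v w).map_add
  have hC1 : ∀ (c : ℝ) v w z, D (c • v) w z = c * D v w z := fun c v w z => by
    rw [D.map_smul]; rfl
  have hC2 : ∀ (c : ℝ) v w z, D v (c • w) z = c * D v w z := fun c v w z => by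
    rw [(D v).map_smul]; rfl
  have hC3 : ∀ (c : ℝ) v w z, D v w (c • z) = c * D v w z := fun c v w => (D v w).map_smul c
  have hG1 : ∀ v v' w z, G (Γ (v + v') w) z = G (Γ v w) z + G (Γ v' w) z := fun v v' w z => by
    rw [Γ.map_add, add_apply, G.map_add, add_apply]
  have hG2 : ∀ v w w' z, G (Γ v (w + w')) z = G (Γ v w) z + G (Γ v w') z := fun v w w' z => by
    rw [(Γ v).map_add, G.map_add, add_apply]
  have hG3 : ∀ v w z z', G (Γ v w) (z + z') = G (Γ v w) z + G (Γ v w) z' := fun v w =>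
    (G (Γ v w)).map_add
  have hS1 : ∀ (c : ℝ) v w z, G (Γ (c • v) w) z = c * G (Γ v w) z := fun c v w z => by
    rw [Γ.map_smul, smul_apply, G.map_smul, smul_apply, smul_eq_mul]
  have hS2 : ∀ (c : ℝ) v w z, G (Γ v (c • w)) z = c * G (Γ v w) z := fun c v w z => by
    rw [(Γ v).map_smul, G.map_smul, smul_apply, smul_eq_mul]
  have hS3 : ∀ (c : ℝ) v w z, G (Γ v w) (c • z) = c * G (Γ v w) z := fun c v w =>
    (G (Γ v w)).map_smul c
  have key := eq_zero_of_basis_trilinear b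
    (T := fun v w z => 2 * G (Γ v w) z - (D v w z + D w v z - D z v w))
    (fun w z => ⟨fun v v' => by simp only [hD1, hD2, hG1]; ring,
      fun c v => by simp only [hC1, hC2, hS1, smul_eq_mul]; ring⟩)
    (fun v z => ⟨fun w w' => by simp only [hD1, hD2, hD3, hG2]; ring,
      fun c w => by simp only [hC1, hC2, hC3, hS2, smul_eq_mul]; ring⟩)
    (fun v w => ⟨fun z z' => by simp only [hD1, hD3, hG3]; ring,
      fun c z => by simp only [hC1, hC3, hS3, smul_eq_mul]; ring⟩)
    (fun i j k => sub_eq_zero.2 (h i j k)) v w z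
  exact sub_eq_zero.1 key

lemma contDiffAt_smul_const {F : Type*} [NormedAddCommGroup F] [NormedSpace ℝ F] {f : E → ℝ} {u : E}
    (hf : ContDiffAt ℝ ∞ f u) (c : F) : ContDiffAt ℝ ∞ (fun y => f y • c) u :=
  hf.smul contDiffAt_const

end Trilinear

section LeviCivita

variable {n : ℕ} {M : Type*} [TopologicalSpace M] [ChartedSpace (Model n) M]
  [IsManifold (𝓡 n) ∞ M] (g : SmoothMetric n M) (x : M)

lemma chartInvDeriv_injective {x : M} {u : Model n} (hu : u ∈ (extChartAt (𝓡 n) x).target) :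
    Function.Injective (chartInvDeriv x u) := by
  have : IsManifold (𝓡 n) 1 M := IsManifold.of_le (n := ∞) (by simp)
  have h := isInvertible_mfderivWithin_extChartAt_symm (I := 𝓡 n) hu
  rw [show range (𝓡 n) = univ from by simp, mfderivWithin_univ] at h
  exact h.injective

/-- The coordinate expression of a metric. -/
abbrev chartMetric (u : Model n) : Model n →L[ℝ] Model n →L[ℝ] ℝ :=
  bilinInChart (fun y => g.inner y) x u

lemma chartMetric_symm (u v w : Model n) : chartMetric g x u v w = chartMetric g x u w v :=
  g.symm _ _ _

lemma chartMetric_pos {u : Model n} (hu : u ∈ (extChartAt (𝓡 n) x).target) {v : Model n}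
    (hv : v ≠ 0) : 0 < chartMetric g x u v v :=
  g.pos _ _ fun h => hv (chartInvDeriv_injective hu (h.trans (map_zero (chartInvDeriv x u)).symm))

lemma contDiffAt_chartMetric : ContDiffAt ℝ ∞ (chartMetric g x) (extChartAt (𝓡 n) x x) :=
  (contMDiffAt_bilin_iff _ x).1 (g.contMDiff x)

lemma metricMatrix_apply (u : Model n) (i j : Fin n) :
    metricMatrix g x u i j = chartMetric g x u (stdVec i) (stdVec j) := rfl

lemma chartMetric_eq_sum (u v w : Model n) :
    chartMetric g x u v w = ∑ i, ∑ j, v i * w j * metricMatrix g x u i j := by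
  conv_lhs => rw [model_eq_sum v, model_eq_sum w]
  simp only [map_sum, map_smul, sum_apply, smul_apply, smul_eq_mul, metricMatrix_apply,
    Finset.mul_sum]
  rw [Finset.sum_comm]
  exact Finset.sum_congr rfl fun i _ => Finset.sum_congr rfl fun j _ => by ring

/-- A vector in the kernel of the Gram matrix would have length zero. -/
lemma metricMatrix_det_ne_zero {u : Model n} (hu : u ∈ (extChartAt (𝓡 n) x).target) :
    (metricMatrix g x u).det ≠ 0 := by
  intro h
  obtain ⟨v, hv, hv0⟩ := Matrix.exists_mulVec_eq_zero_iff.2 h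
  have h1 := chartMetric_pos g x hu (v := WithLp.toLp 2 v)
    (fun h => hv (by simpa using congrArg WithLp.ofLp h))
  rw [chartMetric_eq_sum] at h1
  have h2 : ∀ i, ∑ j, metricMatrix g x u i j * v j = 0 := fun i => congrFun hv0 i
  have h3 : ∑ i, ∑ j, v i * v j * metricMatrix g x u i j = 0 := by
    apply Finset.sum_eq_zero fun i _ => ?_
    rw [← mul_zero (v i), ← h2 i, Finset.mul_sum]
    exact Finset.sum_congr rfl fun j _ => by ring
  simp only at h1
  linarith

lemma contDiffAt_metricMatrix (i j : Fin n) :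
    ContDiffAt ℝ ∞ (fun u => metricMatrix g x u i j) (extChartAt (𝓡 n) x x) :=
  ((contDiffAt_chartMetric g x).clm_apply contDiffAt_const).clm_apply contDiffAt_const

lemma metricPartial_eq {u : Model n} (hu : DifferentiableAt ℝ (chartMetric g x) u) (l i j : Fin n) :
    metricPartial g x l i j u = fderiv ℝ (chartMetric g x) u (stdVec l) (stdVec i) (stdVec j) := by
  have h1 : (fun y => metricMatrix g x y i j) =
      fun y => chartMetric g x y (stdVec i) (stdVec j) := rfl
  rw [metricPartial, h1, fderiv_clm_apply (hu.clm_apply (differentiableAt_const _))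
    (differentiableAt_const _), fderiv_clm_apply hu (differentiableAt_const _)]
  simp

lemma contDiffAt_metricPartial (l i j : Fin n) :
    ContDiffAt ℝ ∞ (metricPartial g x l i j) (extChartAt (𝓡 n) x x) :=
  ((contDiffAt_metricMatrix g x i j).fderiv_right (m := ∞) (by simp)).clm_apply contDiffAt_const

lemma contDiffAt_christoffel (k i j : Fin n) :
    ContDiffAt ℝ ∞ (christoffel g x k i j) (extChartAt (𝓡 n) x x) := by
  unfold christoffel
  refine contDiffAt_const.mul (ContDiffAt.sum fun l _ => ?_)
  exact (ContDiffAt.matrix_inv (contDiffAt_metricMatrix g x)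
    (metricMatrix_det_ne_zero g x (mem_extChartAt_target x)) k l).mul
    (((contDiffAt_metricPartial g x _ _ _).add (contDiffAt_metricPartial g x _ _ _)).sub
      (contDiffAt_metricPartial g x _ _ _))

/-- The Christoffel symbols of a metric as a bilinear map. -/
def christoffelMap (u : Model n) : Model n →L[ℝ] Model n →L[ℝ] Model n :=
  ∑ k, ∑ i, ∑ j, christoffel g x k i j u • ((EuclideanSpace.proj i : Model n →L[ℝ] ℝ).smulRight
    ((EuclideanSpace.proj j : Model n →L[ℝ] ℝ).smulRight (stdVec k : Model n)))

lemma christoffelMap_apply (u v w : Model n) (l : Fin n) :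
    christoffelMap g x u v w l = ∑ i, ∑ j, christoffel g x l i j u * v i * w j := by
  simp only [christoffelMap, sum_apply, smul_apply, ContinuousLinearMap.smulRight_apply]
  simp [stdVec_apply, mul_assoc]

lemma contDiffAt_christoffelMap :
    ContDiffAt ℝ ∞ (christoffelMap g x) (extChartAt (𝓡 n) x x) :=
  ContDiffAt.sum fun k _ => ContDiffAt.sum fun i _ => ContDiffAt.sum fun j _ =>
    contDiffAt_smul_const (contDiffAt_christoffel g x k i j) _

lemma fderiv_christoffelMap_apply (a v w : Model n) (l : Fin n) :
    fderiv ℝ (christoffelMap g x) (extChartAt (𝓡 n) x x) a v w l =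
      ∑ m, ∑ i, ∑ j, christoffelPartial g x m l i j (extChartAt (𝓡 n) x x) * a m * v i * w j := by
  set u := extChartAt (𝓡 n) x x
  have hd := (contDiffAt_christoffelMap g x).differentiableAt_infty
  have h1 : fderiv ℝ (christoffelMap g x) u a v w l =
      fderiv ℝ (fun y => christoffelMap g x y v w l) u a := by
    have h2 := ((hd.hasFDerivAt.clm_apply (hasFDerivAt_const v u)).clm_apply
      (hasFDerivAt_const w u))
    have h3 := ((EuclideanSpace.proj l : Model n →L[ℝ] ℝ).hasFDerivAt.comp u h2).fderiv
    have h4 : (fun y => christoffelMap g x y v w l) =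
      (EuclideanSpace.proj l : Model n →L[ℝ] ℝ) ∘ fun y => christoffelMap g x y v w := rfl
    rw [h4, h3]
    simp [u]
  rw [h1]
  simp only [christoffelMap_apply]
  have h5 : HasFDerivAt (fun y => ∑ i, ∑ j, christoffel g x l i j y * v i * w j)
      (∑ i, ∑ j, (w j * v i) • fderiv ℝ (christoffel g x l i j) u) u := by
    refine HasFDerivAt.fun_sum fun i _ => HasFDerivAt.fun_sum fun j _ => ?_
    have := ((contDiffAt_christoffel g x l i j).differentiableAt_infty.hasFDerivAt.mul_const
      (v i)).mul_const (w j)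
    rwa [smul_smul] at this
  rw [h5.fderiv]
  simp only [sum_apply, smul_apply, smul_eq_mul]
  rw [Finset.sum_comm (s := Finset.univ (α := Fin n)) (t := Finset.univ (α := Fin n))
    (f := fun m i => ∑ j, christoffelPartial g x m l i j u * a m * v i * w j)]
  refine Finset.sum_congr rfl fun i _ => ?_
  rw [Finset.sum_comm]
  refine Finset.sum_congr rfl fun j _ => ?_
  conv_lhs => rw [model_eq_sum a]
  simp only [map_sum, map_smul, Finset.mul_sum, smul_eq_mul]
  exact Finset.sum_congr rfl fun m _ => by rw [christoffelPartial]; ring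

/-- Gathers the index sums into dΓ(v)(w, z) - dΓ(w)(v, z) + Γ(v, Γ(w, z)) - Γ(w, Γ(v, z)). All later
curvature computations start from this form and use no coordinates. -/
lemma riemann_eq (v w z : Model n) :
    (riemann g x v w z : Model n) =
      (fderiv ℝ (christoffelMap g x) (extChartAt (𝓡 n) x x) v w z
      - fderiv ℝ (christoffelMap g x) (extChartAt (𝓡 n) x x) w v z
      + (christoffelMap g x (extChartAt (𝓡 n) x x) v (christoffelMap g x (extChartAt (𝓡 n) x x) w z)
      - christoffelMap g x (extChartAt (𝓡 n) x x) w
        (christoffelMap g x (extChartAt (𝓡 n) x x) v z)) : Model n) := by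
  set u := extChartAt (𝓡 n) x x with hu
  refine (show ∀ a b : Model n, (∀ l, a l = b l) → a = b from fun a b h => PiLp.ext h) _ _ fun l => ?_
  have h1 : (show Model n from riemann g x v w z) l =
      ∑ i, ∑ j, ∑ k, riemannCoeff g x l i j k * v i * w j * z k := by
    unfold riemann
    simp [stdVec_apply, tangentCoord]
  rw [h1]
  have hf := fderiv_christoffelMap_apply g x
  simp only [← hu] at hf
  simp only [PiLp.add_apply, PiLp.sub_apply, hf, christoffelMap_apply,
    riemannCoeff, ← hu]
  have e2 : ∑ m, ∑ i, ∑ j, christoffelPartial g x m l i j u * w m * v i * z j =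
      ∑ i, ∑ m, ∑ j, christoffelPartial g x m l i j u * w m * v i * z j := Finset.sum_comm
  have e3 : ∀ v w : Model n, ∑ i, ∑ m, christoffel g x l i m u * v i *
      (∑ j, ∑ k, christoffel g x m j k u * w j * z k) =
      ∑ i, ∑ j, ∑ k, (∑ m, christoffel g x l i m u * christoffel g x m j k u) * v i * w j * z k := by
    intro v w
    refine Finset.sum_congr rfl fun i _ => ?_
    simp only [Finset.mul_sum, Finset.sum_mul]
    rw [Finset.sum_comm]
    refine Finset.sum_congr rfl fun j _ => ?_
    rw [Finset.sum_comm]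
    exact Finset.sum_congr rfl fun k _ => Finset.sum_congr rfl fun m _ => by ring
  rw [e3 v w, e3 w v, e2]
  rw [Finset.sum_comm (f := fun i j => ∑ k, (∑ m, christoffel g x l i m u * christoffel g x m j k u)
    * w i * v j * z k)]
  simp only [← Finset.sum_sub_distrib, ← Finset.sum_add_distrib]
  refine Finset.sum_congr rfl fun i _ => Finset.sum_congr rfl fun j _ =>
    Finset.sum_congr rfl fun k _ => ?_
  rw [Finset.sum_sub_distrib]
  ring

lemma christoffel_symm (u : Model n) (k i j : Fin n) :
    christoffel g x k i j u = christoffel g x k j i u := by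
  have h : ∀ a b c, metricPartial g x a b c u = metricPartial g x a c b u := fun a b c => by
    unfold metricPartial
    have : (fun y => metricMatrix g x y b c) = fun y => metricMatrix g x y c b := by
      funext y; exact g.symm _ _ _
    rw [this]
  unfold christoffel
  congr 1
  refine Finset.sum_congr rfl fun l _ => ?_
  rw [h l i j]; ring

lemma christoffelMap_symm (u v w : Model n) :
    christoffelMap g x u v w = christoffelMap g x u w v := by
  ext l
  rw [christoffelMap_apply, christoffelMap_apply, Finset.sum_comm]
  refine Finset.sum_congr rfl fun i _ => Finset.sum_congr rfl fun j _ => ?_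
  rw [christoffel_symm]; ring

/-- The first-kind Christoffel identity. -/
lemma two_mul_chartMetric_christoffelMap {u : Model n} (hu : u ∈ (extChartAt (𝓡 n) x).target)
    (hd : DifferentiableAt ℝ (chartMetric g x) u) (v w z : Model n) :
    2 * chartMetric g x u (christoffelMap g x u v w) z =
      fderiv ℝ (chartMetric g x) u v w z + fderiv ℝ (chartMetric g x) u w v z
        - fderiv ℝ (chartMetric g x) u z v w := by
  have hs : ∀ a b, metricMatrix g x u a b = metricMatrix g x u b a := fun a b => g.symm _ _ _
  have hG := metricMatrix_apply g x u
  have hD := metricPartial_eq g x hd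
  have hΓ : ∀ i j, christoffelMap g x u (stdVec i) (stdVec j) =
      ∑ k, christoffel g x k i j u • (stdVec k : Model n) := fun i j => by
    ext k
    rw [christoffelMap_apply]
    simp [stdVec_apply]
  refine koszul_of_basis (EuclideanSpace.basisFun (Fin n) ℝ).toBasis (fun i j l => ?_) v w z
  have hb : ∀ i, (EuclideanSpace.basisFun (Fin n) ℝ).toBasis i = stdVec i := fun i => by
    rw [OrthonormalBasis.coe_toBasis, EuclideanSpace.basisFun_apply]; rfl
  rw [hb, hb, hb, hΓ, map_sum, sum_apply, ← hD, ← hD, ← hD]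
  have h3 : ∀ k, chartMetric g x u (christoffel g x k i j u • (stdVec k : Model n)) (stdVec l) =
      christoffel g x k i j u * metricMatrix g x u k l := fun k => by
    rw [map_smul, smul_apply, smul_eq_mul, hG]
  simp only [h3]
  have hinv : (metricMatrix g x u)⁻¹ * metricMatrix g x u = 1 :=
    Matrix.nonsing_inv_mul _ (isUnit_iff_ne_zero.2 (metricMatrix_det_ne_zero g x hu))
  have hsi : ∀ a b, (metricMatrix g x u)⁻¹ a b = (metricMatrix g x u)⁻¹ b a := fun a b => by
    have : (metricMatrix g x u).transpose = metricMatrix g x u := by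
      ext a b; exact hs b a
    conv_lhs => rw [← this, ← Matrix.transpose_nonsing_inv]
    rfl
  simp only [christoffel, Finset.sum_mul, Finset.mul_sum]
  rw [Finset.sum_comm]
  have h2 : ∀ y, ∑ k, 2 * (1 / 2 * ((metricMatrix g x u)⁻¹ k y *
      (metricPartial g x i j y u + metricPartial g x j i y u - metricPartial g x y i j u)) *
      metricMatrix g x u k l) = ((metricMatrix g x u)⁻¹ * metricMatrix g x u) y l *
      (metricPartial g x i j y u + metricPartial g x j i y u - metricPartial g x y i j u) := by
    intro y
    rw [Matrix.mul_apply, Finset.sum_mul]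
    exact Finset.sum_congr rfl fun k _ => by rw [hsi k y]; ring
  simp only [h2, hinv, Matrix.one_apply]
  simp

end LeviCivita

/-! ### The Riccati equation and its trace -/

section Riccati

variable {E : Type*} [NormedAddCommGroup E] [NormedSpace ℝ E]

/-- The covariant derivative of the field `X` for the connection with Christoffel symbols `Γ`. -/
def covDeriv (Γ : E → E →L[ℝ] E →L[ℝ] E) (X : E → E) (u : E) : E →L[ℝ] E :=
  fderiv ℝ X u + (Γ u).flip (X u)

lemma covDeriv_apply (Γ : E → E →L[ℝ] E →L[ℝ] E) (X : E → E) (u v : E) :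
    covDeriv Γ X u v = fderiv ℝ X u v + Γ u v (X u) := rfl

/-- The Riccati equation along a geodesic field. -/
lemma riccati {Γ : E → E →L[ℝ] E →L[ℝ] E} {X : E → E} {u : E} (hΓ : DifferentiableAt ℝ Γ u)
    (hX : ContDiffAt ℝ 2 X u) (hsymm : ∀ v w, Γ u v w = Γ u w v)
    (hgeo : ∀ᶠ y in 𝓝 u, covDeriv Γ X y (X y) = 0) (v : E) :
    fderiv ℝ Γ u v (X u) (X u) - fderiv ℝ Γ u (X u) v (X u)
      + (Γ u v (Γ u (X u) (X u)) - Γ u (X u) (Γ u v (X u))) =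
    - covDeriv Γ X u (covDeriv Γ X u v) + covDeriv Γ X u (Γ u (X u) v)
      - Γ u (X u) (covDeriv Γ X u v) - fderiv ℝ (covDeriv Γ X) u (X u) v := by
  have hX1 : DifferentiableAt ℝ X u := hX.differentiableAt (by norm_num)
  have hX2 : DifferentiableAt ℝ (fderiv ℝ X) u :=
    (hX.fderiv_right (m := 1) (by norm_num)).differentiableAt (by norm_num)
  have hsec : ∀ v w, fderiv ℝ (fderiv ℝ X) u v w = fderiv ℝ (fderiv ℝ X) u w v :=
    (hX.isSymmSndFDerivAt (by simp)).eq
  have hflip : HasFDerivAt (fun y => (Γ y).flip (X y)) _ u :=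
    ((ContinuousLinearMap.flipₗᵢ ℝ E E E).toContinuousLinearEquiv.hasFDerivAt.comp u
      hΓ.hasFDerivAt).clm_apply hX1.hasFDerivAt
  have hB : HasFDerivAt (covDeriv Γ X) _ u := hX2.hasFDerivAt.add hflip
  have hDB : ∀ a w, fderiv ℝ (covDeriv Γ X) u a w =
      fderiv ℝ (fderiv ℝ X) u a w + (fderiv ℝ Γ u a w (X u) + Γ u w (fderiv ℝ X u a)) := by
    intro a w
    rw [hB.fderiv]
    simp [add_comm]
  have h0 : fderiv ℝ (fun y => covDeriv Γ X y (X y)) u = 0 := by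
    have : (fun y => covDeriv Γ X y (X y)) =ᶠ[𝓝 u] fun _ => 0 := hgeo
    rw [this.fderiv_eq]; simp
  -- The derivative of the geodesic equation ∇_X X = 0 in the direction v.
  have h1 : fderiv ℝ (covDeriv Γ X) u v (X u) + covDeriv Γ X u (fderiv ℝ X u v) = 0 := by
    rw [fderiv_clm_apply hB.differentiableAt hX1] at h0
    have := congrArg (fun L => L v) h0
    simpa [add_comm] using this
  have h2 := hgeo.self_of_nhds
  rw [covDeriv_apply] at h2
  have h3 : Γ u (X u) (X u) = - fderiv ℝ X u (X u) := (neg_eq_of_add_eq_zero_right h2).symm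
  have h4 : fderiv ℝ X u v = covDeriv Γ X u v - Γ u (X u) v := by
    rw [covDeriv_apply, hsymm v]; abel
  have h5 : covDeriv Γ X u (fderiv ℝ X u v) =
      covDeriv Γ X u (covDeriv Γ X u v) - covDeriv Γ X u (Γ u (X u) v) := by
    rw [h4, map_sub]
  have h6 : Γ u (X u) (covDeriv Γ X u v) = Γ u (X u) (fderiv ℝ X u v) + Γ u (X u) (Γ u v (X u)) := by
    rw [covDeriv_apply, map_add]
  rw [hDB] at h1 ⊢
  rw [h5] at h1
  rw [h6, h3, map_neg, hsec (X u) v]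
  have h7 : fderiv ℝ Γ u v (X u) (X u) = - fderiv ℝ (fderiv ℝ X) u v (X u) -
      Γ u (X u) (fderiv ℝ X u v) - (covDeriv Γ X u (covDeriv Γ X u v) -
        covDeriv Γ X u (Γ u (X u) v)) := by
    rw [← sub_eq_zero, ← h1]; abel
  rw [h7]
  abel

variable [FiniteDimensional ℝ E]

/-- The trace of a continuous linear endomorphism. -/
def clmTrace : (E →L[ℝ] E) →ₗ[ℝ] ℝ :=
  (LinearMap.trace ℝ E).comp (ContinuousLinearMap.coeLM ℝ)

lemma clmTrace_comp_comm (A B : E →L[ℝ] E) : clmTrace (A.comp B) = clmTrace (B.comp A) :=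
  LinearMap.trace_mul_comm ℝ (A : E →ₗ[ℝ] E) (B : E →ₗ[ℝ] E)

lemma clmTrace_smulRight (p : E →L[ℝ] ℝ) (Y : E) : clmTrace (p.smulRight Y) = p Y := by
  exact LinearMap.trace_smulRight (p : E →ₗ[ℝ] ℝ) Y

lemma fderiv_clmTrace {B : E → E →L[ℝ] E} {u : E} (hB : DifferentiableAt ℝ B u)
    (h0 : ∀ᶠ y in 𝓝 u, clmTrace (B y) = 0) (v : E) : clmTrace (fderiv ℝ B u v) = 0 := by
  have h1 : HasFDerivAt (fun y => clmTrace (B y)) _ u :=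
    (LinearMap.toContinuousLinearMap (clmTrace (E := E))).hasFDerivAt.comp u hB.hasFDerivAt
  have h2 : fderiv ℝ (fun y => clmTrace (B y)) u = 0 := by
    have : (fun y => clmTrace (B y)) =ᶠ[𝓝 u] fun _ => 0 := h0
    rw [this.fderiv_eq]; simp
  rw [h1.fderiv] at h2
  exact congrArg (fun L => L v) h2

/-- The Ricci curvature of a divergence free geodesic field. -/
lemma trace_riccati {Γ : E → E →L[ℝ] E →L[ℝ] E} {X : E → E} {u : E} (hΓ : DifferentiableAt ℝ Γ u)
    (hX : ContDiffAt ℝ 2 X u) (hsymm : ∀ v w, Γ u v w = Γ u w v)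
    (hgeo : ∀ᶠ y in 𝓝 u, covDeriv Γ X y (X y) = 0)
    (hdiv : ∀ᶠ y in 𝓝 u, clmTrace (covDeriv Γ X y) = 0)
    {R : E →L[ℝ] E} (hR : ∀ v, R v = fderiv ℝ Γ u v (X u) (X u) - fderiv ℝ Γ u (X u) v (X u)
      + (Γ u v (Γ u (X u) (X u)) - Γ u (X u) (Γ u v (X u)))) :
    clmTrace R = - clmTrace ((covDeriv Γ X u).comp (covDeriv Γ X u)) := by
  have hX1 : DifferentiableAt ℝ X u := hX.differentiableAt (by norm_num)
  have hX2 : DifferentiableAt ℝ (fderiv ℝ X) u :=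
    (hX.fderiv_right (m := 1) (by norm_num)).differentiableAt (by norm_num)
  have hB : DifferentiableAt ℝ (covDeriv Γ X) u :=
    hX2.add ((((ContinuousLinearMap.flipₗᵢ ℝ E E E).toContinuousLinearEquiv.differentiableAt).comp u
      hΓ).clm_apply hX1)
  have h1 : R = -((covDeriv Γ X u).comp (covDeriv Γ X u)) + (covDeriv Γ X u).comp (Γ u (X u))
      - (Γ u (X u)).comp (covDeriv Γ X u) - fderiv ℝ (covDeriv Γ X) u (X u) := by
    ext v
    rw [hR, riccati hΓ hX hsymm hgeo]
    simp
  -- The commutator of ∇X with Γ(X) is traceless, and tr(∂_X ∇X) is the derivative of the vanishing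
  -- divergence, so only -tr((∇X)²) remains.
  rw [h1, map_sub, map_sub, map_add, map_neg, fderiv_clmTrace hB hdiv,
    clmTrace_comp_comm (Γ u (X u))]
  ring

end Riccati

/-! ### The metrics b² + P(p² + s²) + 2Q ps -/

section FramedMetric

/-- The bilinear form `b² + P (p² + s²) + 2 Q p s`. -/
def framedMetric {E : Type*} [NormedAddCommGroup E] [NormedSpace ℝ E] (P Q : ℝ) (b p s : E →L[ℝ] ℝ) :
    E →L[ℝ] E →L[ℝ] ℝ :=
  b.smulRight b + P • (p.smulRight p + s.smulRight s) + Q • (p.smulRight s + s.smulRight p)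

lemma framedMetric_apply {E : Type*} [NormedAddCommGroup E] [NormedSpace ℝ E] (P Q : ℝ)
    (b p s : E →L[ℝ] ℝ) (v w : E) : framedMetric P Q b p s v w =
      b v * b w + P * (p v * p w + s v * s w) + Q * (p v * s w + s v * p w) := by
  simp only [framedMetric, add_apply, smul_apply, ContinuousLinearMap.smulRight_apply, smul_eq_mul]

lemma contDiff_framedMetric {E : Type*} [NormedAddCommGroup E] [NormedSpace ℝ E] (P Q : ℝ)
    {n : WithTop ℕ∞} : ContDiff ℝ n (fun x : (E →L[ℝ] ℝ) × (E →L[ℝ] ℝ) × (E →L[ℝ] ℝ) =>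
      framedMetric P Q x.1 x.2.1 x.2.2) := by
  have h1 : ContDiff ℝ n (fun x : (E →L[ℝ] ℝ) × (E →L[ℝ] ℝ) × (E →L[ℝ] ℝ) => x.2.1) :=
    contDiff_fst.comp contDiff_snd
  have h2 : ContDiff ℝ n (fun x : (E →L[ℝ] ℝ) × (E →L[ℝ] ℝ) × (E →L[ℝ] ℝ) => x.2.2) :=
    contDiff_snd.comp contDiff_snd
  exact ((contDiff_fst.smulRight contDiff_fst).add
    (((h1.smulRight h1).add (h2.smulRight h2)).const_smul P)).add
    (((h1.smulRight h2).add (h2.smulRight h1)).const_smul Q)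

/-- Completing the square: multiplied by P, the (p, s)-part is (Pp + Qs)² + (P² - Q²)s², and P² - Q²
= 1. -/
lemma framedForm_pos {P Q b p s : ℝ} (hP : 0 < P) (hPQ : P ^ 2 - Q ^ 2 = 1)
    (h : b * b + P * (p * p + s * s) + Q * (p * s + s * p) ≤ 0) : b = 0 ∧ p = 0 ∧ s = 0 := by
  have h1 : P * (P * (p * p + s * s) + Q * (p * s + s * p)) = (P * p + Q * s) ^ 2 + s ^ 2 := by
    linear_combination s ^ 2 * hPQ
  have h2 : 0 ≤ P * (p * p + s * s) + Q * (p * s + s * p) :=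
    nonneg_of_mul_nonneg_right (by rw [h1]; positivity) hP
  have h0 := mul_self_nonneg b
  have hb : b = 0 := mul_self_eq_zero.1 (by linarith)
  have h3 : P * (p * p + s * s) + Q * (p * s + s * p) = 0 := by linarith
  rw [h3, mul_zero] at h1
  have h4 := sq_nonneg (P * p + Q * s)
  have h5 := sq_nonneg s
  have hs : s = 0 := pow_eq_zero_iff (two_ne_zero) |>.1 (by linarith : s ^ 2 = 0)
  subst hs
  have h6 : P * p = 0 := pow_eq_zero_iff (two_ne_zero) |>.1 (by linarith : (P * p) ^ 2 = 0)
  exact ⟨hb, (mul_eq_zero.1 h6).resolve_left hP.ne', rfl⟩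

lemma framedMetric_pos {P Q : ℝ} (hP : 0 < P) (hPQ : P ^ 2 - Q ^ 2 = 1) {b p s : Model 3 →L[ℝ] ℝ}
    (h : IsCoframe b p s) {v : Model 3} (hv : v ≠ 0) : 0 < framedMetric P Q b p s v v := by
  rw [framedMetric_apply]
  by_contra hcon
  obtain ⟨h1, h2, h3⟩ := framedForm_pos hP hPQ (not_lt.1 hcon)
  exact hv (h v h1 h2 h3)

lemma fderiv_framedMetric {E : Type*} [NormedAddCommGroup E] [NormedSpace ℝ E] {P Q : ℝ}
    {b p s : E → E →L[ℝ] ℝ} {u : E} (hb : DifferentiableAt ℝ b u) (hp : DifferentiableAt ℝ p u)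
    (hs : DifferentiableAt ℝ s u) (a v w : E) :
    fderiv ℝ (fun y => framedMetric P Q (b y) (p y) (s y)) u a v w =
      (fderiv ℝ b u a v * b u w + b u v * fderiv ℝ b u a w) +
      P * ((fderiv ℝ p u a v * p u w + p u v * fderiv ℝ p u a w) +
        (fderiv ℝ s u a v * s u w + s u v * fderiv ℝ s u a w)) +
      Q * ((fderiv ℝ p u a v * s u w + p u v * fderiv ℝ s u a w) +
        (fderiv ℝ s u a v * p u w + s u v * fderiv ℝ p u a w)) := by
  have hG : DifferentiableAt ℝ (fun y => framedMetric P Q (b y) (p y) (s y)) u :=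
    DifferentiableAt.comp (g := fun x : (E →L[ℝ] ℝ) × (E →L[ℝ] ℝ) × (E →L[ℝ] ℝ) =>
      framedMetric P Q x.1 x.2.1 x.2.2) (f := fun y => (b y, p y, s y)) u
      (((contDiff_framedMetric P Q (n := 1)).differentiable one_ne_zero) _)
      (hb.prodMk (hp.prodMk hs))
  have h1 : fderiv ℝ (fun y => framedMetric P Q (b y) (p y) (s y)) u a v w =
      fderiv ℝ (fun y => framedMetric P Q (b y) (p y) (s y) v w) u a := by
    rw [fderiv_clm_apply (hG.clm_apply (differentiableAt_const _)) (differentiableAt_const _),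
      fderiv_clm_apply hG (differentiableAt_const _)]
    simp
  rw [h1]
  simp only [framedMetric_apply]
  have hv : ∀ (c : E → E →L[ℝ] ℝ) (_ : DifferentiableAt ℝ c u) (z : E),
      HasFDerivAt (fun y => c y z) ((fderiv ℝ c u).flip z) u := fun c hc z => by
    simpa using hc.hasFDerivAt.clm_apply (hasFDerivAt_const z u)
  have h2 := ((((hv b hb v).mul (hv b hb w)).add ((((hv p hp v).mul (hv p hp w)).add
    ((hv s hs v).mul (hv s hs w))).const_mul P)).add ((((hv p hp v).mul (hv s hs w)).add
    ((hv s hs v).mul (hv p hp w))).const_mul Q)).fderiv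
  refine (congrArg (fun L : E →L[ℝ] ℝ => L a) h2).trans ?_
  simp only [add_apply, smul_apply, smul_eq_mul, ContinuousLinearMap.flip_apply]
  ring

/-- Since b = g(X, ·), the Koszul formula is 2 g(∇_v X, w) = db(v, w) + (L_X g)(v, w). The flow
scales p and s by opposite rates, so ps and b² are invariant and L_X g = 2μP(p² - s²). This is why Q
does not appear on the right. -/
lemma framedMetric_covDeriv {E : Type*} [NormedAddCommGroup E] [NormedSpace ℝ E] {μ P Q : ℝ}
    {b p s : E → E →L[ℝ] ℝ} {u : E} (hb : DifferentiableAt ℝ b u) (hp : DifferentiableAt ℝ p u)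
    (hs : DifferentiableAt ℝ s u) {X : E → E} {Γ : E →L[ℝ] E →L[ℝ] E}
    (hΓ : ∀ v w z, 2 * framedMetric P Q (b u) (p u) (s u) (Γ v w) z =
      fderiv ℝ (fun y => framedMetric P Q (b y) (p y) (s y)) u v w z +
      fderiv ℝ (fun y => framedMetric P Q (b y) (p y) (s y)) u w v z -
      fderiv ℝ (fun y => framedMetric P Q (b y) (p y) (s y)) u z v w)
    (hbX : b u (X u) = 1) (hpX : p u (X u) = 0) (hsX : s u (X u) = 0)
    (hdb : ∀ v w, extD b u v w = 2 * (p u v * s u w - p u w * s u v))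
    (hdp : ∀ w, extD p u (X u) w = μ * p u w) (hds : ∀ w, extD s u (X u) w = -μ * s u w)
    (hLb : ∀ w, fderiv ℝ b u (X u) w + b u (fderiv ℝ X u w) = extD b u (X u) w)
    (hLp : ∀ w, fderiv ℝ p u (X u) w + p u (fderiv ℝ X u w) = extD p u (X u) w)
    (hLs : ∀ w, fderiv ℝ s u (X u) w + s u (fderiv ℝ X u w) = extD s u (X u) w) (v w : E) :
    framedMetric P Q (b u) (p u) (s u) (fderiv ℝ X u v + Γ v (X u)) w =
      (p u v * s u w - s u v * p u w) + μ * P * (p u v * p u w - s u v * s u w) := by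
  have h1 := hΓ v (X u) w
  rw [fderiv_framedMetric hb hp hs, fderiv_framedMetric hb hp hs,
    fderiv_framedMetric hb hp hs] at h1
  have e1 : ∀ a, fderiv ℝ b u a (X u) = - b u (fderiv ℝ X u a) := fun a => by
    have := hLb a; simp only [extD] at this; linarith
  have e2 : ∀ a, fderiv ℝ p u a (X u) = - p u (fderiv ℝ X u a) := fun a => by
    have := hLp a; simp only [extD] at this; linarith
  have e3 : ∀ a, fderiv ℝ s u a (X u) = - s u (fderiv ℝ X u a) := fun a => by
    have := hLs a; simp only [extD] at this; linarith
  have f1 : ∀ a, fderiv ℝ b u (X u) a = - b u (fderiv ℝ X u a) := fun a => by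
    have := hLb a; rw [hdb, hpX, hsX] at this; linarith
  have f2 : ∀ a, fderiv ℝ p u (X u) a = μ * p u a - p u (fderiv ℝ X u a) := fun a => by
    have := hLp a; rw [hdp] at this; linarith
  have f3 : ∀ a, fderiv ℝ s u (X u) a = -μ * s u a - s u (fderiv ℝ X u a) := fun a => by
    have := hLs a; rw [hds] at this; linarith
  have f4 : fderiv ℝ b u v w = fderiv ℝ b u w v + 2 * (p u v * s u w - p u w * s u v) := by
    have := hdb v w; simp only [extD] at this; linarith
  simp only [e1, e2, e3, f1, f2, f3, f4, hbX, hpX, hsX] at h1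
  have h11 : ∀ a c, framedMetric P Q (b u) (p u) (s u) (a + c) w =
    framedMetric P Q (b u) (p u) (s u) a w + framedMetric P Q (b u) (p u) (s u) c w :=
    fun a c => by rw [map_add, add_apply]
  rw [h11, framedMetric_apply P Q _ _ _ (fderiv ℝ X u v)]
  linear_combination (1 / 2) * h1

variable {μ P Q : ℝ} {b p s : Model 3 → Model 3 →L[ℝ] ℝ} {u₀ : Model 3}

/-- The covariant derivative of the Reeb field of an Anosov contact form, for a framed metric. -/
lemma AnosovGerm.covDeriv_eq (h : AnosovGerm μ b p s u₀) (hP : 0 < P) (hPQ : P ^ 2 - Q ^ 2 = 1)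
    {X Y Z : Model 3 → Model 3} (hX : ContDiffAt ℝ ∞ X u₀)
    (hfr : ∀ᶠ u in 𝓝 u₀, IsDualFrame (b u) (p u) (s u) (X u) (Y u) (Z u))
    {Γ : Model 3 → Model 3 →L[ℝ] Model 3 →L[ℝ] Model 3}
    (hΓ : ∀ᶠ u in 𝓝 u₀, ∀ v w z, 2 * framedMetric P Q (b u) (p u) (s u) (Γ u v w) z =
      fderiv ℝ (fun y => framedMetric P Q (b y) (p y) (s y)) u v w z +
      fderiv ℝ (fun y => framedMetric P Q (b y) (p y) (s y)) u w v z -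
      fderiv ℝ (fun y => framedMetric P Q (b y) (p y) (s y)) u z v w) :
    ∀ᶠ u in 𝓝 u₀, covDeriv Γ X u =
      (p u).smulRight ((μ * P ^ 2 - Q) • Y u + (P - μ * P * Q) • Z u) +
      (s u).smulRight ((μ * P * Q - P) • Y u + (Q - μ * P ^ 2) • Z u) := by
  filter_upwards [hfr.eventually_nhds, hΓ, h.db, h.dp, h.ds,
    h.smooth_b.eventually_differentiableAt, h.smooth_p.eventually_differentiableAt,
    h.smooth_s.eventually_differentiableAt, hX.eventually_differentiableAt]
    with u hfr hΓ hdb hdp hds hb hp hs hX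
  have hu := hfr.self_of_nhds
  have hLb := fun w => extD_eq_lie hb hX (hfr.mono fun y hy => hy.bX) w
  have hLp := fun w => extD_eq_lie hp hX (hfr.mono fun y hy => hy.pX) w
  have hLs := fun w => extD_eq_lie hs hX (hfr.mono fun y hy => hy.sX) w
  ext1 v
  set L := (p u).smulRight ((μ * P ^ 2 - Q) • Y u + (P - μ * P * Q) • Z u) +
      (s u).smulRight ((μ * P * Q - P) • Y u + (Q - μ * P ^ 2) • Z u)
  have hL : ∀ w, framedMetric P Q (b u) (p u) (s u) (L v) w =
      (p u v * s u w - s u v * p u w) + μ * P * (p u v * p u w - s u v * s u w) := fun w => by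
    rw [framedMetric_apply]
    simp only [L, add_apply, ContinuousLinearMap.smulRight_apply, map_add,
      map_smul, smul_eq_mul, hu.bY, hu.bZ, hu.pY, hu.pZ, hu.sY, hu.sZ]
    linear_combination (p u v * s u w - s u v * p u w +
      μ * P * p u v * p u w - μ * P * s u v * s u w) * hPQ
  have hB : ∀ w, framedMetric P Q (b u) (p u) (s u) (covDeriv Γ X u v) w =
      (p u v * s u w - s u v * p u w) + μ * P * (p u v * p u w - s u v * s u w) := fun w => by
    exact framedMetric_covDeriv hb hp hs hΓ hu.bX hu.pX hu.sX hdb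
      (fun w => hdp _ _ hu.bX hu.pX hu.sX) (fun w => hds _ _ hu.bX hu.pX hu.sX) hLb hLp hLs v w
  -- L v and ∇_v X have the same pairings with all vectors, and the metric is definite.
  by_contra hne
  have h1 := framedMetric_pos hP hPQ hu.isCoframe (sub_ne_zero.2 hne)
  have h2 : framedMetric P Q (b u) (p u) (s u) (covDeriv Γ X u v - L v)
      (covDeriv Γ X u v - L v) = 0 := by
    have h3 : ∀ a c w, framedMetric P Q (b u) (p u) (s u) (a - c) w =
      framedMetric P Q (b u) (p u) (s u) a w - framedMetric P Q (b u) (p u) (s u) c w :=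
      fun a c w => by
        rw [framedMetric_apply, framedMetric_apply, framedMetric_apply, map_sub, map_sub, map_sub]
        ring
    rw [h3, hB, hL, sub_self]
  exact absurd h2 h1.ne'

end FramedMetric

section GermTrace

variable {μ P Q : ℝ} {b p s : Model 3 → Model 3 →L[ℝ] ℝ} {u₀ : Model 3}

/-- Packages v ↦ R(v, X)X as a continuous linear operator, so that its trace can be taken. -/
lemma exists_curvatureOperator {E : Type*} [NormedAddCommGroup E] [NormedSpace ℝ E]
    (D : E →L[ℝ] E →L[ℝ] E →L[ℝ] E) (Γ : E →L[ℝ] E →L[ℝ] E) (X : E) :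
    ∃ R : E →L[ℝ] E, ∀ v, R v = D v X X - D X v X + (Γ v (Γ X X) - Γ X (Γ v X)) :=
  ⟨((D.flip X).flip X - (D X).flip X) + (Γ.flip (Γ X X) - (Γ X).comp (Γ.flip X)), fun _ => rfl⟩

/-- On the plane spanned by Y and Z the matrix of B is [[a, -c], [c, -a]]: it is traceless and its
square is the scalar a² - c². -/
lemma clmTrace_framed {E : Type*} [NormedAddCommGroup E] [NormedSpace ℝ E] [FiniteDimensional ℝ E]
    {p s : E →L[ℝ] ℝ} {Y Z : E} (pY : p Y = 1) (pZ : p Z = 0) (sY : s Y = 0) (sZ : s Z = 1)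
    (a c : ℝ) {B : E →L[ℝ] E}
    (hB : B = p.smulRight (a • Y + c • Z) + s.smulRight ((-c) • Y + (-a) • Z)) :
    clmTrace B = 0 ∧ clmTrace (B.comp B) = 2 * (a ^ 2 - c ^ 2) := by
  have h1 : B.comp B = p.smulRight (B (a • Y + c • Z)) + s.smulRight (B ((-c) • Y + (-a) • Z)) := by
    conv_lhs => rw [hB]
    ext v
    simp only [ContinuousLinearMap.comp_apply, add_apply, ContinuousLinearMap.smulRight_apply,
      map_add, map_smul, hB]
  have h2 : ∀ v, B v = p v • (a • Y + c • Z) + s v • ((-c) • Y + (-a) • Z) := fun v => by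
    rw [hB]; rfl
  constructor
  · rw [hB, map_add, clmTrace_smulRight, clmTrace_smulRight]
    simp only [map_add, map_smul, pY, pZ, sY, sZ, smul_eq_mul]; ring
  · rw [h1, map_add, clmTrace_smulRight, clmTrace_smulRight, h2, h2]
    simp only [map_add, map_smul, pY, pZ, sY, sZ, smul_eq_mul]; ring

/-- The Ricci curvature of the Reeb field for a framed metric. -/
lemma AnosovGerm.trace_curvature (h : AnosovGerm μ b p s u₀) (hP : 0 < P) (hPQ : P ^ 2 - Q ^ 2 = 1)
    {X Y Z : Model 3 → Model 3} (hX : ContDiffAt ℝ ∞ X u₀)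
    (hfr : ∀ᶠ u in 𝓝 u₀, IsDualFrame (b u) (p u) (s u) (X u) (Y u) (Z u))
    {Γ : Model 3 → Model 3 →L[ℝ] Model 3 →L[ℝ] Model 3} (hd : DifferentiableAt ℝ Γ u₀)
    (hsymm : ∀ v w, Γ u₀ v w = Γ u₀ w v)
    (hΓ : ∀ᶠ u in 𝓝 u₀, ∀ v w z, 2 * framedMetric P Q (b u) (p u) (s u) (Γ u v w) z =
      fderiv ℝ (fun y => framedMetric P Q (b y) (p y) (s y)) u v w z +
      fderiv ℝ (fun y => framedMetric P Q (b y) (p y) (s y)) u w v z -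
      fderiv ℝ (fun y => framedMetric P Q (b y) (p y) (s y)) u z v w) 
    {R : Model 3 →L[ℝ] Model 3} (hR : ∀ v, R v = fderiv ℝ Γ u₀ v (X u₀) (X u₀) -
      fderiv ℝ Γ u₀ (X u₀) v (X u₀) +
      (Γ u₀ v (Γ u₀ (X u₀) (X u₀)) - Γ u₀ (X u₀) (Γ u₀ v (X u₀)))) :
    clmTrace R = 2 - 2 * μ ^ 2 * P ^ 2 := by
  have hB : ∀ᶠ u in 𝓝 u₀, covDeriv Γ X u =
      (p u).smulRight ((μ * P ^ 2 - Q) • Y u + (P - μ * P * Q) • Z u) +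
      (s u).smulRight ((-(P - μ * P * Q)) • Y u + (-(μ * P ^ 2 - Q)) • Z u) := by
    filter_upwards [h.covDeriv_eq hP hPQ hX hfr hΓ] with u hu
    rw [hu, neg_sub, neg_sub]
  rw [trace_riccati hd (hX.of_le (WithTop.coe_le_coe.2 (le_top : (2 : ℕ∞) ≤ ⊤))) hsymm ?_ ?_ hR]
  · have hf := hfr.self_of_nhds
    rw [(clmTrace_framed hf.pY hf.pZ hf.sY hf.sZ _ _ hB.self_of_nhds).2]
    -- With a = μP² - Q and c = P - μPQ one has a² - c² = (μ²P² - 1)(P² - Q²).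
    linear_combination (-2 * μ ^ 2 * P ^ 2 + 2) * hPQ
  · filter_upwards [hB, hfr] with u hu hf
    rw [hu]
    simp only [add_apply, ContinuousLinearMap.smulRight_apply, hf.pX, hf.sX, zero_smul, add_zero]
  · filter_upwards [hB, hfr] with u hu hf
    exact (clmTrace_framed hf.pY hf.pZ hf.sY hf.sZ _ _ hu).1

end GermTrace

/-! ### Germs on a manifold and the construction of the metrics -/

section ManifoldGerm

variable {M : Type*} [TopologicalSpace M] [ChartedSpace (Model 3) M]

/-- Near `x`, the form `α` is an Anosov contact form of rate `μ` whose expanded and contracted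
covectors `p, s` are given, up to a common sign, by `q = (p + i s)²`. -/
def HasGermAt (μ : ℝ) (α : OneForm M) (q : ∀ x : M, TangentSpace (𝓡 3) x → ℂ) (x : M) : Prop :=
  ∃ p s, AnosovGerm μ (formInChart α x) p s (extChartAt (𝓡 3) x x) ∧
    ∀ᶠ u in 𝓝 (extChartAt (𝓡 3) x x), ∀ v,
      funInChart q x u v = ((p u v : ℂ) + s u v * Complex.I) ^ 2

variable [IsManifold (𝓡 3) ∞ M]
variable {N : Type*} [TopologicalSpace N] [ChartedSpace (Model 3) N] [IsManifold (𝓡 3) ∞ N]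
variable {μ : ℝ} {α : OneForm M} {q : ∀ x : M, TangentSpace (𝓡 3) x → ℂ}

lemma chartInvDeriv_surjective {x : M} {u : Model 3} (hu : u ∈ (extChartAt (𝓡 3) x).target) :
    Function.Surjective (chartInvDeriv x u) := by
  have h : ∀ L : Model 3 →L[ℝ] Model 3, Function.Injective L → Function.Surjective L :=
    fun L hL => (LinearMap.injective_iff_surjective (f := (L : Model 3 →ₗ[ℝ] Model 3))).1 hL
  exact h _ (chartInvDeriv_injective hu)

lemma injective_fderiv_chartRep {f : N → M} {z : N} {y : M}
    (hf : ContMDiffAt (𝓡 3) (𝓡 3) ∞ f z) (hy : f z ∈ (extChartAt (𝓡 3) y).source)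
    (hinj : Function.Injective (mfderiv (𝓡 3) (𝓡 3) f z)) :
    Function.Injective (fderiv ℝ (chartRep 3 3 f z y) (extChartAt (𝓡 3) z z)) := by
  have h := (eventually_mfderiv_chartRep hf hy).self_of_nhds
  rw [injective_iff_map_eq_zero]
  intro v hv
  have h1 := h v
  rw [hv] at h1
  have h2 : (mfderiv (𝓡 3) (𝓡 3) f z (show TangentSpace (𝓡 3) z from v) : Model 3) = 0 := by
    have h3 := apply_congr_point (M := N) (R := Model 3)
      (fun x v => (mfderiv (𝓡 3) (𝓡 3) f x v : Model 3)) (chartInv_center (n := 3) z)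
      (chartInvDeriv_center (n := 3) z v)
    refine h3.symm.trans (h1.trans ?_)
    exact map_zero (chartInvDeriv y _)
  exact hinj (h2.trans (map_zero (mfderiv (𝓡 3) (𝓡 3) f z)).symm)

lemma HasGermAt.pullBack {f : N → M} {z : N} (h : HasGermAt μ α q (f z))
    (hf : ContMDiffAt (𝓡 3) (𝓡 3) ∞ f z)
    (hinj : Function.Injective (mfderiv (𝓡 3) (𝓡 3) f z)) :
    HasGermAt μ (pullBack f α) (pullTangentFun f q) z := by
  obtain ⟨p, s, hg, hq⟩ := h
  have hc : chartRep 3 3 f z (f z) (extChartAt (𝓡 3) z z) = extChartAt (𝓡 3) (f z) (f z) := by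
    rw [chartRep, chartInv_center]
  rw [← hc] at hg hq
  have hs := mem_extChartAt_source (I := 𝓡 3) (f z)
  have hτ := contDiffAt_chartRep hf hs
  refine ⟨_, _, (hg.pull hτ (injective_fderiv_chartRep hf hs hinj)).congr
    (formInChart_pullBack α hf hs), ?_⟩
  filter_upwards [funInChart_pullTangentFun q hf hs, hτ.continuousAt.eventually hq] with u h1 h2 v
  rw [h1, h2]; rfl

lemma chartRep_id_center {x : M} {u : Model 3} (hu : u ∈ (extChartAt (𝓡 3) x).target) :
    chartRep 3 3 (id : M → M) (chartInv x u) x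
      (extChartAt (𝓡 3) (chartInv x u) (chartInv (n := 3) x u)) = u := by
  rw [chartRep, chartInv_center]; exact extChartAt_chartInv hu

/-- A tangent space is read in the preferred chart of its own base point. So `chartInvDeriv x u` is
the differential of a coordinate change into the preferred chart at `chartInv x u`, and `chartRep`
of the identity is the change back. -/
lemma fderiv_chartRep_id {x : M} {u : Model 3} (hu : u ∈ (extChartAt (𝓡 3) x).target) (a : Model 3) :
    fderiv ℝ (chartRep 3 3 (id : M → M) (chartInv x u) x)
      (extChartAt (𝓡 3) (chartInv x u) (chartInv (n := 3) x u)) (chartInvDeriv x u a) = a := by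
  have hid : ContMDiffAt (𝓡 3) (𝓡 3) ∞ (id : M → M) (chartInv x u) := contMDiffAt_id
  have hs : id (chartInv x u) ∈ (extChartAt (𝓡 3) x).source := chartInv_mem_source hu
  have h2 := (eventually_mfderiv_chartRep hid hs).self_of_nhds (chartInvDeriv x u a)
  have h3 := apply_congr_point (M := M) (R := Model 3)
    (fun x v => (mfderiv (𝓡 3) (𝓡 3) (id : M → M) x v : Model 3))
    (chartInv_center (n := 3) (chartInv x u))
    (chartInvDeriv_center (n := 3) (chartInv (n := 3) x u) (chartInvDeriv x u a))
  have h4 := h3.symm.trans h2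
  rw [mfderiv_id, chartRep_id_center hu] at h4
  exact (chartInvDeriv_injective hu h4).symm

/-- `dα` is natural under changes of charts. -/
lemma dForm_chartInv {x : M} {u : Model 3} (hu : u ∈ (extChartAt (𝓡 3) x).target)
    (hα : DifferentiableAt ℝ (formInChart α x) u) (v w : Model 3) :
    dForm α (chartInv x u) (chartInvDeriv x u v) (chartInvDeriv x u w) =
      extD (formInChart α x) u v w := by
  have hid : ContMDiffAt (𝓡 3) (𝓡 3) ∞ (id : M → M) (chartInv x u) := contMDiffAt_id
  have hs : id (chartInv x u) ∈ (extChartAt (𝓡 3) x).source := chartInv_mem_source hu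
  have hc : chartRep 3 3 (id : M → M) (chartInv x u) x
      (extChartAt (𝓡 3) (chartInv x u) (chartInv (n := 3) x u)) = u := chartRep_id_center hu
  have h1 := formInChart_pullBack α hid hs
  rw [pullBack_id] at h1
  have hD := fderiv_chartRep_id hu
  refine (extD_congr h1 _ _).trans ?_
  refine (extD_pullForm (by rwa [hc]) ((contDiffAt_chartRep hid hs).of_le
    (WithTop.coe_le_coe.2 (le_top : (2 : ℕ∞) ≤ ⊤))) _ _).trans ?_
  exact (congrArg₂ (extD (formInChart α x) _) (hD v) (hD w)).trans (by rw [hc])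

lemma AnosovGerm.apply_eq_zero_of_dForm {x : M} {p s : Model 3 → Model 3 →L[ℝ] ℝ}
    (h : AnosovGerm μ (formInChart α x) p s (extChartAt (𝓡 3) x x))
    {v : TangentSpace (𝓡 3) x} (h2 : ∀ w, dForm α x v w = 0) :
    p (extChartAt (𝓡 3) x x) v = 0 ∧ s (extChartAt (𝓡 3) x x) v = 0 := by
  obtain ⟨X, Y, Z, hf⟩ := h.coframe.exists_dualFrame
  have h3 : ∀ w : Model 3, 2 * (p (extChartAt (𝓡 3) x x) v * s (extChartAt (𝓡 3) x x) w -
      p (extChartAt (𝓡 3) x x) w * s (extChartAt (𝓡 3) x x) v) = 0 := fun w => by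
    rw [← h2 w]; exact (h.db.self_of_nhds v w).symm
  have hY := h3 Y
  have hZ := h3 Z
  rw [hf.pY, hf.sY] at hY
  rw [hf.pZ, hf.sZ] at hZ
  constructor <;> linarith

/-- `reeb` is an arbitrary choice among the solutions of its defining equations. There is only one:
the difference of two solutions is killed by b, and by p and s because db = 2 p∧s. -/
lemma AnosovGerm.reeb_eq {x : M} {p s : Model 3 → Model 3 →L[ℝ] ℝ}
    (h : AnosovGerm μ (formInChart α x) p s (extChartAt (𝓡 3) x x))
    {v : TangentSpace (𝓡 3) x} (h1 : α x v = 1) (h2 : ∀ w, dForm α x v w = 0) :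
    reeb α x = v := by
  have hr : α x (reeb α x) = 1 ∧ ∀ w, dForm α x (reeb α x) w = 0 :=
    Classical.epsilon_spec (p := fun v => α x v = 1 ∧ ∀ w, dForm α x v w = 0) ⟨v, h1, h2⟩
  have a1 := h.apply_eq_zero_of_dForm h2
  have a2 := h.apply_eq_zero_of_dForm hr.2
  rw [← sub_eq_zero]
  refine h.coframe _ ?_ ?_ ?_
  · refine (formInChart_center α x _).trans ?_
    refine (map_sub (α x) _ _).trans ?_
    rw [hr.1, h1, sub_self]
  · refine (map_sub (p _) _ _).trans ?_
    rw [a1.1, a2.1, sub_self]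
  · refine (map_sub (s _) _ _).trans ?_
    rw [a1.2, a2.2, sub_self]

lemma AnosovGerm.reeb_center {x : M} {p s : Model 3 → Model 3 →L[ℝ] ℝ}
    (h : AnosovGerm μ (formInChart α x) p s (extChartAt (𝓡 3) x x)) {X Y Z : Model 3}
    (hf : IsDualFrame (formInChart α x (extChartAt (𝓡 3) x x)) (p (extChartAt (𝓡 3) x x))
      (s (extChartAt (𝓡 3) x x)) X Y Z) : reeb α x = X := by
  refine h.reeb_eq (v := X) ((formInChart_center α x X).symm.trans hf.bX) fun w => ?_
  refine (h.db.self_of_nhds X w).trans ?_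
  rw [hf.pX, hf.sX]; ring

/-- The Reeb field in a chart. -/
lemma AnosovGerm.eventually_reeb {x : M} {p s : Model 3 → Model 3 →L[ℝ] ℝ}
    (h : AnosovGerm μ (formInChart α x) p s (extChartAt (𝓡 3) x x))
    (hall : ∀ y : M, HasGermAt μ α q y) {X Y Z : Model 3 → Model 3}
    (hf : ∀ᶠ u in 𝓝 (extChartAt (𝓡 3) x x),
      IsDualFrame (formInChart α x u) (p u) (s u) (X u) (Y u) (Z u)) :
    ∀ᶠ u in 𝓝 (extChartAt (𝓡 3) x x), reeb α (chartInv x u) = chartInvDeriv x u (X u) := by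
  filter_upwards [hf, eventually_mem_target x, h.smooth_b.eventually_differentiableAt, h.db]
    with u hu ht hd hdb
  obtain ⟨p', s', hg, -⟩ := hall (chartInv x u)
  refine hg.reeb_eq hu.bX fun w => ?_
  obtain ⟨w', rfl⟩ := chartInvDeriv_surjective ht w
  rw [dForm_chartInv ht hd, hdb, hu.pX, hu.sX]; ring

/-- On the dual frame α∧dα takes the value 2. -/
lemma isContactForm_of_germ (h : ∀ x : M, HasGermAt μ α q x) : IsContactForm α where
  smooth := fun x => by
    obtain ⟨p, s, hg, -⟩ := h x
    exact (contMDiffAt_form_iff α x).2 hg.smooth_b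
  nondegenerate := fun x => by
    obtain ⟨p, s, hg, -⟩ := h x
    obtain ⟨X, Y, Z, hf⟩ := hg.coframe.exists_dualFrame
    refine ⟨X, Y, Z, ?_⟩
    have hb : ∀ v : Model 3, α x (show TangentSpace (𝓡 3) x from v) =
      formInChart α x (extChartAt (𝓡 3) x x) v := fun v => (formInChart_center α x v).symm
    have hd : ∀ v w : Model 3, dForm α x (show TangentSpace (𝓡 3) x from v)
      (show TangentSpace (𝓡 3) x from w) = 2 * (p (extChartAt (𝓡 3) x x) v *
        s (extChartAt (𝓡 3) x x) w - p (extChartAt (𝓡 3) x x) w * s (extChartAt (𝓡 3) x x) v) :=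
      fun v w => hg.db.self_of_nhds v w
    have e := (hb X).trans hf.bX
    have e1 := (hb Y).trans hf.bY
    have e2 := (hb Z).trans hf.bZ
    have e3 := hd Y Z
    rw [hf.pY, hf.sZ, hf.pZ, hf.sY] at e3
    have key : ∀ a b c d e f : ℝ, a = 1 → b = 0 → c = 0 → d = 2 * (1 * 1 - 0 * 0) →
        a * d - b * e + c * f ≠ 0 := by
      rintro _ _ _ _ e f rfl rfl rfl rfl; norm_num
    exact key _ _ _ _ _ _ e e1 e2 e3

end ManifoldGerm

lemma exists_pos_mul_sq_le {E : Type*} [NormedAddCommGroup E] [NormedSpace ℝ E]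
    [FiniteDimensional ℝ E] {T : E →L[ℝ] E →L[ℝ] ℝ} (hT : ∀ v, v ≠ 0 → 0 < T v v) :
    ∃ c > 0, ∀ v, c * ‖v‖ ^ 2 ≤ T v v := by
  rcases subsingleton_or_nontrivial E with hE | hE
  · exact ⟨1, one_pos, fun v => by rw [Subsingleton.elim v 0]; simp⟩
  obtain ⟨v₀, hv₀, hmin⟩ := (isCompact_sphere (0 : E) 1).exists_isMinOn
    (NormedSpace.sphere_nonempty.2 zero_le_one) (f := fun v => T v v)
    (T.continuous.clm_apply continuous_id).continuousOn
  have h0 : v₀ ≠ 0 := fun h => by simp [h] at hv₀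
  refine ⟨T v₀ v₀, hT _ h0, fun v => ?_⟩
  by_cases hv : v = 0
  · simp [hv]
  have hn : ‖v‖ ≠ 0 := norm_ne_zero_iff.2 hv
  have h1 : T v₀ v₀ ≤ T (‖v‖⁻¹ • v) (‖v‖⁻¹ • v) := hmin (by simp [norm_smul, hn])
  simp only [map_smul, smul_apply, smul_eq_mul] at h1
  calc T v₀ v₀ * ‖v‖ ^ 2 ≤ (‖v‖⁻¹ * (‖v‖⁻¹ * T v v)) * ‖v‖ ^ 2 := by gcongr
    _ = T v v := by field_simp

/-- Supplies the boundedness of unit balls that is part of the definition of a Riemannian metric; in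
finite dimension it follows from definiteness. -/
lemma isVonNBounded_of_posDef {E : Type*} [NormedAddCommGroup E] [NormedSpace ℝ E]
    [FiniteDimensional ℝ E] {T : E →L[ℝ] E →L[ℝ] ℝ} (hT : ∀ v, v ≠ 0 → 0 < T v v) :
    Bornology.IsVonNBounded ℝ {v : E | T v v < 1} := by
  obtain ⟨c, hc, h⟩ := exists_pos_mul_sq_le hT
  rw [NormedSpace.isVonNBounded_iff]
  refine (Metric.isBounded_closedBall (x := (0 : E)) (r := Real.sqrt (1 / c))).subset fun v hv => ?_
  rw [mem_closedBall_zero_iff]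
  apply Real.le_sqrt_of_sq_le
  rw [le_div_iff₀ hc]
  have := h v
  have hv' : T v v < 1 := hv
  linarith

lemma clmTrace_eq_sum (R : Model 3 →L[ℝ] Model 3) : clmTrace R = ∑ i, R (stdVec i) i := by
  have h : clmTrace R = LinearMap.trace ℝ (Model 3) (R : Model 3 →ₗ[ℝ] Model 3) := rfl
  rw [h, LinearMap.trace_eq_matrix_trace ℝ (EuclideanSpace.basisFun (Fin 3) ℝ).toBasis,
    Matrix.trace]
  refine Finset.sum_congr rfl fun i _ => ?_
  rw [Matrix.diag_apply, LinearMap.toMatrix_apply, OrthonormalBasis.coe_toBasis,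
    EuclideanSpace.basisFun_apply]
  rfl

section MetricOfGerms

variable {M : Type*} [TopologicalSpace M] [ChartedSpace (Model 3) M] [IsManifold (𝓡 3) ∞ M]
variable {μ : ℝ} {α : OneForm M} {q : ∀ x : M, TangentSpace (𝓡 3) x → ℂ}

/-- Two framings with the same square define the same metrics. -/
lemma framedMetric_eq_of_sq {E : Type*} [NormedAddCommGroup E] [NormedSpace ℝ E] (P Q : ℝ)
    {b p s b' p' s' : E →L[ℝ] ℝ} (hb : ∀ v, b v = b' v)
    (h : ∀ v, ((p v : ℂ) + s v * Complex.I) ^ 2 = ((p' v : ℂ) + s' v * Complex.I) ^ 2) (v w : E) :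
    framedMetric P Q b p s v w = framedMetric P Q b' p' s' v w := by
  rw [framedMetric_apply, framedMetric_apply, hb, hb]
  rcases covector_pair_eq_or_neg (p := p.toLinearMap) (s := s.toLinearMap) (p' := p'.toLinearMap)
    (s' := s'.toLinearMap) h with ⟨h1, h2⟩ | ⟨h1, h2⟩
  · have e1 : ∀ a, p' a = p a := fun a => congrArg (fun L => L a) h1
    have e2 : ∀ a, s' a = s a := fun a => congrArg (fun L => L a) h2
    simp only [e1, e2]
  · have e1 : ∀ a, p' a = -p a := fun a => congrArg (fun L => L a) h1
    have e2 : ∀ a, s' a = -s a := fun a => congrArg (fun L => L a) h2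
    simp only [e1, e2]; ring

lemma framedMetric_symm {E : Type*} [NormedAddCommGroup E] [NormedSpace ℝ E] (P Q : ℝ)
    (b p s : E →L[ℝ] ℝ) (v w : E) : framedMetric P Q b p s v w = framedMetric P Q b p s w v := by
  rw [framedMetric_apply, framedMetric_apply]; ring

/-- The rotation by a right angle, with respect to a framed metric, of the contact planes. -/
lemma framedRotation_sq {E : Type*} [NormedAddCommGroup E] [NormedSpace ℝ E] {P Q : ℝ}
    (hPQ : P ^ 2 - Q ^ 2 = 1) {b p s : E →L[ℝ] ℝ} {X Y Z v : E} (pY : p Y = 1) (pZ : p Z = 0)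
    (sY : s Y = 0) (sZ : s Z = 1) (hv : v = b v • X + (p v • Y + s v • Z)) :
    (p.smulRight (Q • Y - P • Z) + s.smulRight (P • Y - Q • Z))
      ((p.smulRight (Q • Y - P • Z) + s.smulRight (P • Y - Q • Z)) v) = -v + b v • X := by
  have e1 : -v + b v • X = -(p v • Y + s v • Z) := by
    calc -v + b v • X = -(b v • X + (p v • Y + s v • Z)) + b v • X := by rw [← hv]
      _ = _ := by abel
  rw [e1]
  simp only [add_apply, ContinuousLinearMap.smulRight_apply, map_add, map_sub, map_smul,
    pY, pZ, sY, sZ]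
  match_scalars
  · linear_combination (-(p v)) * hPQ
  · linear_combination (-(s v)) * hPQ

lemma framedMetric_rotation {E : Type*} [NormedAddCommGroup E] [NormedSpace ℝ E] {P Q : ℝ}
    (hPQ : P ^ 2 - Q ^ 2 = 1) {b p s : E →L[ℝ] ℝ} {Y Z : E} (bY : b Y = 0) (bZ : b Z = 0)
    (pY : p Y = 1) (pZ : p Z = 0) (sY : s Y = 0) (sZ : s Z = 1) (v w : E) :
    framedMetric P Q b p s v
      ((p.smulRight (Q • Y - P • Z) + s.smulRight (P • Y - Q • Z)) w) = p v * s w - p w * s v := by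
  rw [framedMetric_apply]
  simp only [add_apply, ContinuousLinearMap.smulRight_apply, map_add, map_sub, map_smul,
    smul_eq_mul, bY, bZ, pY, pZ, sY, sZ]
  linear_combination (p v * s w - p w * s v) * hPQ

/-- The field of bilinear forms given by framed metrics on the tangent spaces. -/
def framedField (P Q : ℝ) (α : OneForm M) (p s : M → Model 3 →L[ℝ] ℝ) (x : M) :
    TangentSpace (𝓡 3) x →L[ℝ] TangentSpace (𝓡 3) x →L[ℝ] ℝ :=
  show Model 3 →L[ℝ] Model 3 →L[ℝ] ℝ from
    framedMetric P Q (show Model 3 →L[ℝ] ℝ from α x) (p x) (s x)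

/-- The framing at each point is taken from that point's own chart, with an uncontrolled sign. The
metric depends on p and s only through their square, so near x it agrees with the metric of one
smooth framing. -/
lemma framedField_chart {P Q : ℝ} {p s : M → Model 3 →L[ℝ] ℝ}
    (hps : ∀ (x : M) (v : Model 3), q x (show TangentSpace (𝓡 3) x from v) =
      ((p x v : ℂ) + s x v * Complex.I) ^ 2) {x : M} {p' s' : Model 3 → Model 3 →L[ℝ] ℝ}
    {u : Model 3} (hu : ∀ v, funInChart q x u v = ((p' u v : ℂ) + s' u v * Complex.I) ^ 2) :
    bilinInChart (framedField P Q α p s) x u =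
      framedMetric P Q (formInChart α x u) (p' u) (s' u) := by
  ext v w
  refine Eq.trans ?_ (framedMetric_eq_of_sq P Q (b := formInChart α x u)
    (p := (p (chartInv x u)).comp (show Model 3 →L[ℝ] Model 3 from chartInvDeriv x u))
    (s := (s (chartInv x u)).comp (show Model 3 →L[ℝ] Model 3 from chartInvDeriv x u))
    (fun _ => rfl) (fun v => ?_) v w)
  · rfl
  · exact (hps _ _).symm.trans (hu v)

/-- The framed metrics have Ric(X, X) = 2 - 2μ²P², a value that sweeps the whole half-line up to 2 -
2μ² as the constant P² runs over [1, ∞). -/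
theorem exists_contactMetric_of_germ (hμ : 0 < μ) (h : ∀ x : M, HasGermAt μ α q x) {C : ℝ}
    (hC : C ≤ 2 - 2 * μ ^ 2) : ∃ g : SmoothMetric 3 M, IsContactMetric α g ∧
      ∀ x : M, ricci g x (reeb α x) (reeb α x) = C := by
  have h' := h
  choose p s hg hq using h'
  -- P solves 2 - 2μ²P² = C. The bound on C says exactly that P² ≥ 1, which is what allows Q² = P² -
  -- 1.
  set P := Real.sqrt ((2 - C) / (2 * μ ^ 2)) with hPdef
  have hP1 : 1 ≤ (2 - C) / (2 * μ ^ 2) := by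
    rw [le_div_iff₀ (by positivity)]; linarith
  have hP2 : P ^ 2 = (2 - C) / (2 * μ ^ 2) := Real.sq_sqrt (by linarith)
  have hP : 0 < P := Real.sqrt_pos.2 (by linarith)
  set Q := Real.sqrt (P ^ 2 - 1) with hQdef
  have hP3 : 0 ≤ P ^ 2 - 1 := by rw [hP2]; linarith
  have hPQ : P ^ 2 - Q ^ 2 = 1 := by
    rw [hQdef, Real.sq_sqrt hP3]; ring
  have hPC : 2 - 2 * μ ^ 2 * P ^ 2 = C := by
    rw [hP2]; field_simp; ring
  set c : M → Model 3 := fun x => extChartAt (𝓡 3) x x with hc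
  have hps : ∀ (x : M) (v : Model 3), q x (show TangentSpace (𝓡 3) x from v) =
      ((p x (c x) v : ℂ) + s x (c x) v * Complex.I) ^ 2 := fun x v => by
    rw [← (hq x).self_of_nhds v]; exact (funInChart_center q x v).symm
  set T := framedField P Q α (fun x => p x (c x)) (fun x => s x (c x)) with hT
  have hTc : ∀ x, bilinInChart T x =ᶠ[𝓝 (c x)] fun u =>
      framedMetric P Q (formInChart α x u) (p x u) (s x u) := fun x => by
    filter_upwards [hq x] with u hu
    exact framedField_chart hps hu
  have hTpos : ∀ (x : M) (v : Model 3), v ≠ 0 → 0 < (show Model 3 →L[ℝ] Model 3 →L[ℝ] ℝ from T x) v v := by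
    intro x v hv
    refine framedMetric_pos hP hPQ (fun w h1 h2 h3 => (hg x).coframe w ?_ h2 h3) hv
    rw [formInChart_center]; exact h1
  let g : SmoothMetric 3 M :=
    { inner := T
      symm := fun x v w => framedMetric_symm (E := Model 3) P Q _ _ _ v w
      pos := fun x v hv => hTpos x v hv
      isVonNBounded := fun x => isVonNBounded_of_posDef (E := Model 3) (hTpos x)
      contMDiff := fun x => (contMDiffAt_bilin_iff T x).2
        ((ContDiffAt.comp (g := fun x : (Model 3 →L[ℝ] ℝ) × (Model 3 →L[ℝ] ℝ) × (Model 3 →L[ℝ] ℝ) =>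
          framedMetric P Q x.1 x.2.1 x.2.2) (f := fun y => (formInChart α x y, p x y, s x y)) (c x)
          (contDiff_framedMetric P Q).contDiffAt ((hg x).smooth_b.prodMk
            ((hg x).smooth_p.prodMk (hg x).smooth_s))).congr_of_eventuallyEq (hTc x)) }
  have hgc : ∀ x, chartMetric g x =ᶠ[𝓝 (c x)] fun u =>
      framedMetric P Q (formInChart α x u) (p x u) (s x u) := hTc
  have hgi : ∀ (x : M) (v w : Model 3), g.inner x (show TangentSpace (𝓡 3) x from v)
      (show TangentSpace (𝓡 3) x from w) = framedMetric P Q (formInChart α x (c x)) (p x (c x))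
        (s x (c x)) v w := fun x v w => by
    refine (framedMetric_apply (E := Model 3) P Q _ _ _ v w).trans
      (Eq.trans ?_ (framedMetric_apply (E := Model 3) P Q _ _ _ v w).symm)
    rw [formInChart_center, formInChart_center]
    rfl
  have hfr : ∀ x, ∃ X Y Z : Model 3 → Model 3, ContDiffAt ℝ ∞ X (c x) ∧ ContDiffAt ℝ ∞ Y (c x) ∧
      ContDiffAt ℝ ∞ Z (c x) ∧
      ∀ᶠ u in 𝓝 (c x), IsDualFrame (formInChart α x u) (p x u) (s x u) (X u) (Y u) (Z u) :=
    fun x => (hg x).exists_frame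
  choose X Y Z hX hY hZ hF using hfr
  have hF0 := fun x => (hF x).self_of_nhds
  have hreeb : ∀ x, reeb α x = X x (c x) := fun x => (hg x).reeb_center (hF0 x)
  -- The tensor φ sends Y to QY - PZ and Z to PY - QZ and kills X; on the contact plane φ² = Q² - P²
  -- = -1.
  refine ⟨g, ⟨fun x v => ?_, fun x => show Model 3 →L[ℝ] Model 3 from
    (p x (c x)).smulRight (Q • Y x (c x) - P • Z x (c x)) +
      (s x (c x)).smulRight (P • Y x (c x) - Q • Z x (c x)), fun x v w => ?_, fun x v => ?_⟩,
    fun x => ?_⟩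
  · rw [hreeb]
    refine (hgi x _ v).trans ((framedMetric_apply (E := Model 3) P Q _ _ _ _ _).trans ?_)
    rw [(hF0 x).bX, (hF0 x).pX, (hF0 x).sX, formInChart_center α x v]
    ring
  · have hf := hF0 x
    refine (hgi x v _).trans ((framedMetric_rotation hPQ hf.bY hf.bZ hf.pY hf.pZ hf.sY hf.sZ
      v w).trans ?_)
    have hd : dForm α x v w = _ := (hg x).db.self_of_nhds v w
    rw [hd]; ring
  · have hf := hF0 x
    rw [hreeb]
    refine (framedRotation_sq hPQ hf.pY hf.pZ hf.sY hf.sZ ((hf.decomp v).trans (add_assoc _ _ _))).trans ?_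
    rw [formInChart_center α x v]
    rfl
  · rw [hreeb]
    set Γ := christoffelMap g x
    obtain ⟨R, hR⟩ := exists_curvatureOperator (fderiv ℝ Γ (c x)) (Γ (c x)) (X x (c x))
    have h1 := (hg x).trace_curvature hP hPQ (hX x) (hF x)
      (contDiffAt_christoffelMap g x).differentiableAt_infty (christoffelMap_symm g x _) ?_ hR
    · rw [← hPC, ← h1, clmTrace_eq_sum]
      refine Finset.sum_congr rfl fun i _ => ?_
      rw [hR]
      exact congrArg (fun v : Model 3 => v i)
        (riemann_eq g x (stdVec i) (X x (c x)) (X x (c x)))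
    · filter_upwards [eventually_mem_target x,
        (contDiffAt_chartMetric g x).eventually_differentiableAt, (hgc x).eventuallyEq_nhds]
        with u hu hd he v w z
      have := two_mul_chartMetric_christoffelMap g x hu hd v w z
      rw [he.fderiv_eq, he.self_of_nhds] at this
      exact this

end MetricOfGerms

/-! ### Cartan's structure equations along a map -/

section Pairing

variable {E F : Type*} [NormedAddCommGroup E] [NormedSpace ℝ E] [NormedAddCommGroup F]
  [NormedSpace ℝ F] {G : F → F →L[ℝ] F →L[ℝ] ℝ} {Γ : F → F →L[ℝ] F →L[ℝ] F} {x ζ ζ' ξ ν : E → F}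
  {u : E}

/-- The covariant derivative of a vector field along a map. -/
def covAlong (Γ : F → F →L[ℝ] F →L[ℝ] F) (x ζ : E → F) (u : E) : E →L[ℝ] F :=
  fderiv ℝ ζ u + ((Γ (x u)).flip (ζ u)).comp (fderiv ℝ x u)

lemma covAlong_apply (Γ : F → F →L[ℝ] F →L[ℝ] F) (x ζ : E → F) (u v : E) :
    covAlong Γ x ζ u v = fderiv ℝ ζ u v + Γ (x u) (fderiv ℝ x u v) (ζ u) := rfl

/-- The covector field obtained by pairing `ζ` with an `F`-valued 1-form. -/
def pairForm (G : F → F →L[ℝ] F →L[ℝ] ℝ) (x ζ : E → F) (A : E → E →L[ℝ] F) (u : E) : E →L[ℝ] ℝ :=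
  (G (x u) (ζ u)).comp (A u)

lemma pairForm_apply (G : F → F →L[ℝ] F →L[ℝ] ℝ) (x ζ : E → F) (A : E → E →L[ℝ] F) (u w : E) :
    pairForm G x ζ A u w = G (x u) (ζ u) (A u w) := rfl

lemma hasFDerivAt_comp_clm (hG : DifferentiableAt ℝ G (x u)) (hx : DifferentiableAt ℝ x u) :
    HasFDerivAt (fun y => G (x y)) ((fderiv ℝ G (x u)).comp (fderiv ℝ x u)) u :=
  HasFDerivAt.comp (g := G) (f := x) u hG.hasFDerivAt hx.hasFDerivAt

lemma fderiv_pairForm (hG : DifferentiableAt ℝ G (x u)) (hx : DifferentiableAt ℝ x u)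
    (hζ : DifferentiableAt ℝ ζ u) {A : E → E →L[ℝ] F} (hA : DifferentiableAt ℝ A u) (v w : E) :
    fderiv ℝ (pairForm G x ζ A) u v w = fderiv ℝ G (x u) (fderiv ℝ x u v) (ζ u) (A u w) +
      G (x u) (fderiv ℝ ζ u v) (A u w) + G (x u) (ζ u) (fderiv ℝ A u v w) := by
  have h1 := ((hasFDerivAt_comp_clm hG hx).clm_apply hζ.hasFDerivAt).clm_comp hA.hasFDerivAt
  have h2 : fderiv ℝ (pairForm G x ζ A) u = _ := h1.fderiv
  rw [h2]
  simp
  ring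

lemma fderiv_inner_fields (hG : DifferentiableAt ℝ G (x u)) (hx : DifferentiableAt ℝ x u)
    (hζ : DifferentiableAt ℝ ζ u) (hζ' : DifferentiableAt ℝ ζ' u) (v : E) :
    fderiv ℝ (fun y => G (x y) (ζ y) (ζ' y)) u v =
      fderiv ℝ G (x u) (fderiv ℝ x u v) (ζ u) (ζ' u) + G (x u) (fderiv ℝ ζ u v) (ζ' u) +
        G (x u) (ζ u) (fderiv ℝ ζ' u v) := by
  have h1 := ((hasFDerivAt_comp_clm hG hx).clm_apply hζ.hasFDerivAt).clm_apply hζ'.hasFDerivAt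
  rw [h1.fderiv]
  simp
  ring

/-- A connection is metric if the derivative of the metric is as follows. -/
def IsMetricConnection (G : F → F →L[ℝ] F →L[ℝ] ℝ) (Γ : F → F →L[ℝ] F →L[ℝ] F) (y : F) : Prop :=
  ∀ a c d, fderiv ℝ G y a c d = G y (Γ y a c) d + G y c (Γ y a d)

/-- Add the Koszul identities for (a, c, d) and (a, d, c): by symmetry of the metric everything
cancels except twice the derivative along a. -/
lemma isMetricConnection_of_koszul {y : F} (hG : DifferentiableAt ℝ G y)
    (hs : ∀ᶠ z in 𝓝 y, ∀ c d, G z c d = G z d c)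
    (hK : ∀ v w z, 2 * G y (Γ y v w) z =
      fderiv ℝ G y v w z + fderiv ℝ G y w v z - fderiv ℝ G y z v w) :
    IsMetricConnection G Γ y := by
  intro a c d
  have hsd : ∀ a c d, fderiv ℝ G y a c d = fderiv ℝ G y a d c := fun a c d => by
    have h1 : (fun z => G z c d) =ᶠ[𝓝 y] fun z => G z d c := hs.mono fun z hz => hz c d
    have h2 : ∀ c d, fderiv ℝ (fun z => G z c d) y a = fderiv ℝ G y a c d := fun c d => by
      have := (hG.hasFDerivAt.clm_apply (hasFDerivAt_const c y)).clm_apply (hasFDerivAt_const d y)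
      rw [this.fderiv]; simp
    rw [← h2, ← h2, h1.fderiv_eq]
  have h1 := hK a c d
  have h2 := hK a d c
  rw [hs.self_of_nhds c]
  rw [hsd d a c] at h1
  rw [hsd c a d, hsd a d c] at h2
  rw [hsd d c a] at h1
  rw [hsd c d a] at h2
  linarith [hsd c a d, hsd d a c]

lemma fderiv_inner_covAlong (hm : IsMetricConnection G Γ (x u)) (hG : DifferentiableAt ℝ G (x u))
    (hx : DifferentiableAt ℝ x u) (hζ : DifferentiableAt ℝ ζ u) (hζ' : DifferentiableAt ℝ ζ' u)
    (v : E) : fderiv ℝ (fun y => G (x y) (ζ y) (ζ' y)) u v =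
      G (x u) (covAlong Γ x ζ u v) (ζ' u) + G (x u) (ζ u) (covAlong Γ x ζ' u v) := by
  rw [fderiv_inner_fields hG hx hζ hζ', hm, covAlong_apply, covAlong_apply, map_add, map_add,
    add_apply]
  ring

/-- First structure equation. -/
lemma extD_pairForm_fderiv (hm : IsMetricConnection G Γ (x u)) (hΓ : ∀ v w, Γ (x u) v w = Γ (x u) w v)
    (hG : DifferentiableAt ℝ G (x u)) (hx : ContDiffAt ℝ 2 x u) (hζ : DifferentiableAt ℝ ζ u)
    (v w : E) : extD (pairForm G x ζ (fderiv ℝ x)) u v w =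
      G (x u) (covAlong Γ x ζ u v) (fderiv ℝ x u w) -
        G (x u) (covAlong Γ x ζ u w) (fderiv ℝ x u v) := by
  have hx1 : DifferentiableAt ℝ x u := hx.differentiableAt (by norm_num)
  have hx2 : DifferentiableAt ℝ (fderiv ℝ x) u :=
    (hx.fderiv_right (m := 1) (by norm_num)).differentiableAt (by norm_num)
  have hsec : fderiv ℝ (fderiv ℝ x) u v w = fderiv ℝ (fderiv ℝ x) u w v :=
    (hx.isSymmSndFDerivAt (by simp)).eq v w
  rw [extD, fderiv_pairForm hG hx1 hζ hx2, fderiv_pairForm hG hx1 hζ hx2, hsec, hm, hm,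
    covAlong_apply, covAlong_apply, map_add, map_add, add_apply, add_apply,
    hΓ (fderiv ℝ x u w) (fderiv ℝ x u v)]
  ring

lemma covAlong_differentiableAt (hΓ : DifferentiableAt ℝ Γ (x u)) (hx : ContDiffAt ℝ 2 x u)
    (hζ : ContDiffAt ℝ 2 ζ u) : DifferentiableAt ℝ (covAlong Γ x ζ) u := by
  have hx1 : DifferentiableAt ℝ x u := hx.differentiableAt (by norm_num)
  have hx2 : DifferentiableAt ℝ (fderiv ℝ x) u :=
    (hx.fderiv_right (m := 1) (by norm_num)).differentiableAt (by norm_num)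
  have hζ1 : DifferentiableAt ℝ ζ u := hζ.differentiableAt (by norm_num)
  have hζ2 : DifferentiableAt ℝ (fderiv ℝ ζ) u :=
    (hζ.fderiv_right (m := 1) (by norm_num)).differentiableAt (by norm_num)
  exact hζ2.add ((((ContinuousLinearMap.flipₗᵢ ℝ F F F).toContinuousLinearEquiv.differentiableAt.comp
    u (hΓ.comp u hx1)).clm_apply hζ1).clm_comp hx2)

lemma fderiv_covAlong_apply (hΓ : DifferentiableAt ℝ Γ (x u)) (hx : ContDiffAt ℝ 2 x u)
    (hζ : ContDiffAt ℝ 2 ζ u) (v w : E) : fderiv ℝ (covAlong Γ x ζ) u v w =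
      fderiv ℝ (fderiv ℝ ζ) u v w + (fderiv ℝ Γ (x u) (fderiv ℝ x u v) (fderiv ℝ x u w) (ζ u) +
        Γ (x u) (fderiv ℝ (fderiv ℝ x) u v w) (ζ u) + Γ (x u) (fderiv ℝ x u w) (fderiv ℝ ζ u v)) := by
  have hx1 : DifferentiableAt ℝ x u := hx.differentiableAt (by norm_num)
  have hx2 : DifferentiableAt ℝ (fderiv ℝ x) u :=
    (hx.fderiv_right (m := 1) (by norm_num)).differentiableAt (by norm_num)
  have hζ1 : DifferentiableAt ℝ ζ u := hζ.differentiableAt (by norm_num)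
  have hζ2 : DifferentiableAt ℝ (fderiv ℝ ζ) u :=
    (hζ.fderiv_right (m := 1) (by norm_num)).differentiableAt (by norm_num)
  have h1 := (((ContinuousLinearMap.flipₗᵢ ℝ F F F).toContinuousLinearEquiv.hasFDerivAt.comp
    u (HasFDerivAt.comp (g := Γ) (f := x) u hΓ.hasFDerivAt hx1.hasFDerivAt)).clm_apply
      hζ1.hasFDerivAt).clm_comp hx2.hasFDerivAt
  have h2 : fderiv ℝ (covAlong Γ x ζ) u = _ := (hζ2.hasFDerivAt.add h1).fderiv
  rw [h2]
  simp
  abel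

/-- Second structure equation. -/
lemma extD_pairForm_covAlong (hm : IsMetricConnection G Γ (x u))
    (hG : DifferentiableAt ℝ G (x u))
    (hΓd : DifferentiableAt ℝ Γ (x u)) (hx : ContDiffAt ℝ 2 x u) (hξ : ContDiffAt ℝ 2 ξ u)
    (hν : DifferentiableAt ℝ ν u) (v w : E) :
    extD (pairForm G x ν (covAlong Γ x ξ)) u v w =
      G (x u) (covAlong Γ x ν u v) (covAlong Γ x ξ u w) -
        G (x u) (covAlong Γ x ν u w) (covAlong Γ x ξ u v) +
      G (x u) (ν u) (fderiv ℝ Γ (x u) (fderiv ℝ x u v) (fderiv ℝ x u w) (ξ u) -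
        fderiv ℝ Γ (x u) (fderiv ℝ x u w) (fderiv ℝ x u v) (ξ u) +
        (Γ (x u) (fderiv ℝ x u v) (Γ (x u) (fderiv ℝ x u w) (ξ u)) -
          Γ (x u) (fderiv ℝ x u w) (Γ (x u) (fderiv ℝ x u v) (ξ u)))) := by
  have hx1 : DifferentiableAt ℝ x u := hx.differentiableAt (by norm_num)
  have hsec : fderiv ℝ (fderiv ℝ x) u v w = fderiv ℝ (fderiv ℝ x) u w v :=
    (hx.isSymmSndFDerivAt (by simp)).eq v w
  have hsec' : fderiv ℝ (fderiv ℝ ξ) u v w = fderiv ℝ (fderiv ℝ ξ) u w v :=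
    (hξ.isSymmSndFDerivAt (by simp)).eq v w
  have hc := covAlong_differentiableAt hΓd hx hξ
  rw [extD, fderiv_pairForm hG hx1 hν hc, fderiv_pairForm hG hx1 hν hc, hm, hm,
    fderiv_covAlong_apply hΓd hx hξ, fderiv_covAlong_apply hΓd hx hξ, hsec, hsec',
    covAlong_apply Γ x ν, covAlong_apply Γ x ν, covAlong_apply Γ x ξ, covAlong_apply Γ x ξ]
  simp only [map_add, map_sub, add_apply]
  ring

end Pairing

section Plane

variable {F : Type*} [NormedAddCommGroup F] [NormedSpace ℝ F] [FiniteDimensional ℝ F]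

lemma orthonormal_decomposition (hF : Module.finrank ℝ F = 2) {T : F →L[ℝ] F →L[ℝ] ℝ}
    (hs : ∀ a c, T a c = T c a) {ξ ν : F} (hξ : T ξ ξ = 1) (hν : T ν ν = 1) (h0 : T ξ ν = 0) (a : F) :
    a = T ξ a • ξ + T ν a • ν := by
  set L : F →ₗ[ℝ] ℝ × ℝ := (T ξ).toLinearMap.prod (T ν).toLinearMap with hL
  have hsurj : Function.Surjective L := fun c => ⟨c.1 • ξ + c.2 • ν, by
    ext <;> simp [hL, hξ, hν, h0, hs ν ξ]⟩
  have hinj : Function.Injective L :=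
    (LinearMap.injective_iff_surjective_of_finrank_eq_finrank (by simp [hF])).2 hsurj
  apply hinj
  ext <;> simp [hL, hξ, hν, h0, hs ν ξ]

lemma exists_orthogonal_ne_zero (hF : Module.finrank ℝ F = 2) (L : F →L[ℝ] ℝ) :
    ∃ e, e ≠ 0 ∧ L e = 0 := by
  have h := LinearMap.ker_ne_bot_of_finrank_lt (f := L.toLinearMap) (by simp [hF])
  obtain ⟨e, he, hne⟩ := (Submodule.ne_bot_iff _).1 h
  exact ⟨e, hne, he⟩

/-- Gram–Schmidt applied to a fixed vector that is orthogonal to ξ at the base point. The result is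
only local, so the surface need not be orientable. -/
lemma exists_unit_normal {E : Type*} [NormedAddCommGroup E] [NormedSpace ℝ E]
    (hF : Module.finrank ℝ F = 2) {T : E → F →L[ℝ] F →L[ℝ] ℝ}
    {ξ : E → F} {u₀ : E} (hT : ContDiffAt ℝ ∞ T u₀) (hξs : ContDiffAt ℝ ∞ ξ u₀)
    (hs : ∀ᶠ u in 𝓝 u₀, ∀ a c, T u a c = T u c a)
    (hpos : ∀ a, a ≠ 0 → 0 < T u₀ a a) (hξ : ∀ᶠ u in 𝓝 u₀, T u (ξ u) (ξ u) = 1) :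
    ∃ ν : E → F, ContDiffAt ℝ ∞ ν u₀ ∧
      ∀ᶠ u in 𝓝 u₀, T u (ν u) (ν u) = 1 ∧ T u (ξ u) (ν u) = 0 := by
  obtain ⟨e, he, he0⟩ := exists_orthogonal_ne_zero hF (T u₀ (ξ u₀))
  set e' : E → F := fun u => e - T u (ξ u) e • ξ u with he'
  have h1 : ContDiffAt ℝ ∞ e' u₀ :=
    contDiffAt_const.sub (((hT.clm_apply hξs).clm_apply contDiffAt_const).smul hξs)
  have h2 : ContDiffAt ℝ ∞ (fun u => T u (e' u) (e' u)) u₀ := (hT.clm_apply h1).clm_apply h1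
  have h3 : 0 < T u₀ (e' u₀) (e' u₀) := by
    have : e' u₀ = e := by simp [he', he0]
    rw [this]; exact hpos e he
  refine ⟨fun u => (Real.sqrt (T u (e' u) (e' u)))⁻¹ • e' u,
    ((h2.sqrt h3.ne').inv (Real.sqrt_ne_zero'.2 h3)).smul h1, ?_⟩
  filter_upwards [h2.continuousAt.eventually (lt_mem_nhds h3), hs, hξ] with u hu hsu hξu
  have h4 : Real.sqrt (T u (e' u) (e' u)) ≠ 0 := Real.sqrt_ne_zero'.2 hu
  have h5 : Real.sqrt (T u (e' u) (e' u)) ^ 2 = T u (e' u) (e' u) := Real.sq_sqrt hu.le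
  constructor
  · simp only [map_smul, smul_apply, smul_eq_mul]
    nth_rewrite 3 [← h5]; field_simp
  · have h6 : T u (ξ u) (e' u) = 0 := by
      simp only [he', map_sub, map_smul, smul_eq_mul, hξu]; ring
    simp only [map_smul, smul_eq_mul, h6, mul_zero]

end Plane

section Structure

variable {E F : Type*} [NormedAddCommGroup E] [NormedSpace ℝ E] [NormedAddCommGroup F]
  [NormedSpace ℝ F] {G : F → F →L[ℝ] F →L[ℝ] ℝ} {Γ : F → F →L[ℝ] F →L[ℝ] F} {x ξ ν : E → F}
  {u : E}

lemma fderiv_eq_zero_of_eventually {f : E → ℝ} {k : ℝ} (h : ∀ᶠ y in 𝓝 u, f y = k) :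
    fderiv ℝ f u = 0 := by
  have : f =ᶠ[𝓝 u] fun _ => k := h
  rw [this.fderiv_eq]; simp

/-- The structure equations of the unit tangent bundle. -/
lemma unitTangent_structure (hm : IsMetricConnection G Γ (x u))
    (hΓ : ∀ v w, Γ (x u) v w = Γ (x u) w v)
    (hG : DifferentiableAt ℝ G (x u)) (hΓd : DifferentiableAt ℝ Γ (x u)) (hx : ContDiffAt ℝ 2 x u)
    (hξ : ContDiffAt ℝ 2 ξ u) (hν : ContDiffAt ℝ 2 ν u) (hs : ∀ a c, G (x u) a c = G (x u) c a)
    (hξξ : ∀ᶠ y in 𝓝 u, G (x y) (ξ y) (ξ y) = 1) (hνν : ∀ᶠ y in 𝓝 u, G (x y) (ν y) (ν y) = 1)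
    (hξν : ∀ᶠ y in 𝓝 u, G (x y) (ξ y) (ν y) = 0)
    (hdec : ∀ a, a = G (x u) (ξ u) a • ξ u + G (x u) (ν u) a • ν u) {b θ η : E → E →L[ℝ] ℝ}
    (hb : b = pairForm G x ξ (fderiv ℝ x)) (hθ : θ = pairForm G x ν (fderiv ℝ x))
    (hη : η = pairForm G x ν (covAlong Γ x ξ)) (v w : E) :
    extD b u v w = η u v * θ u w - η u w * θ u v ∧
    extD θ u v w = η u w * b u v - η u v * b u w ∧
    extD η u v w = G (x u) (ν u) (fderiv ℝ Γ (x u) (fderiv ℝ x u v) (fderiv ℝ x u w) (ξ u) -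
        fderiv ℝ Γ (x u) (fderiv ℝ x u w) (fderiv ℝ x u v) (ξ u) +
        (Γ (x u) (fderiv ℝ x u v) (Γ (x u) (fderiv ℝ x u w) (ξ u)) -
          Γ (x u) (fderiv ℝ x u w) (Γ (x u) (fderiv ℝ x u v) (ξ u)))) := by
  have hx1 : DifferentiableAt ℝ x u := hx.differentiableAt (by norm_num)
  have hξ1 : DifferentiableAt ℝ ξ u := hξ.differentiableAt (by norm_num)
  have hν1 : DifferentiableAt ℝ ν u := hν.differentiableAt (by norm_num)
  -- Differentiating the orthonormality relations of ξ and ν leaves a single connection form: ⟨Dξ,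
  -- ν⟩ = η = -⟨Dν, ξ⟩, and the diagonal terms vanish.
  have e1 : ∀ v, G (x u) (covAlong Γ x ξ u v) (ξ u) = 0 := fun v => by
    have := fderiv_inner_covAlong hm hG hx1 hξ1 hξ1 v
    rw [fderiv_eq_zero_of_eventually hξξ, hs (ξ u), zero_apply] at this
    linarith
  have e2 : ∀ v, G (x u) (covAlong Γ x ν u v) (ν u) = 0 := fun v => by
    have := fderiv_inner_covAlong hm hG hx1 hν1 hν1 v
    rw [fderiv_eq_zero_of_eventually hνν, hs (ν u), zero_apply] at this
    linarith
  have e3 : ∀ v, G (x u) (covAlong Γ x ν u v) (ξ u) = - η u v := fun v => by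
    have := fderiv_inner_covAlong hm hG hx1 hξ1 hν1 v
    rw [fderiv_eq_zero_of_eventually hξν, zero_apply, hs _ (ν u), hs (ξ u)] at this
    rw [hη, pairForm_apply]
    linarith
  have e4 : ∀ v, G (x u) (covAlong Γ x ξ u v) (ν u) = η u v := fun v => by
    rw [hη, pairForm_apply, hs]
  have d1 : ∀ a c, G (x u) a c = G (x u) (ξ u) c * G (x u) a (ξ u) +
      G (x u) (ν u) c * G (x u) a (ν u) := fun a c => by
    conv_lhs => rw [hdec c]
    simp only [map_add, map_smul, smul_eq_mul]
  have f1 : ∀ w, G (x u) (ξ u) (fderiv ℝ x u w) = b u w := fun w => by rw [hb, pairForm_apply]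
  have f2 : ∀ w, G (x u) (ν u) (fderiv ℝ x u w) = θ u w := fun w => by rw [hθ, pairForm_apply]
  have f3 : ∀ w, G (x u) (ν u) (covAlong Γ x ξ u w) = η u w := fun w => by rw [hη, pairForm_apply]
  have f4 : ∀ w, G (x u) (ξ u) (covAlong Γ x ξ u w) = 0 := fun w => by rw [hs, e1]
  refine ⟨?_, ?_, ?_⟩
  · conv_lhs => rw [hb]
    rw [extD_pairForm_fderiv hm hΓ hG hx hξ1, d1, d1 (covAlong Γ x ξ u w), e1, e1, e4, e4, f1, f1,
      f2, f2]
    ring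
  · conv_lhs => rw [hθ]
    rw [extD_pairForm_fderiv hm hΓ hG hx hν1, d1, d1 (covAlong Γ x ν u w), e2, e2, e3, e3, f1, f1,
      f2, f2]
    ring
  · conv_lhs => rw [hη]
    rw [extD_pairForm_covAlong hm hG hΓd hx hξ hν1, d1, d1 (covAlong Γ x ν u w), e2, e2, f4, f4]
    ring

end Structure

/-! ### Sasaki coframes and the Anosov germ in negative curvature -/

section SasakiGerm

/-- The structure equations of the geodesic flow of a surface, for its contact form `b` and covector
fields `θ` and `η`, without the one that involves the curvature. -/
structure SasakiGerm (k : WithTop ℕ∞) (b θ η : Model 3 → Model 3 →L[ℝ] ℝ) (u₀ : Model 3) : Prop where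
  smooth_b : ContDiffAt ℝ k b u₀
  smooth_θ : ContDiffAt ℝ k θ u₀
  smooth_η : ContDiffAt ℝ k η u₀
  coframe : IsCoframe (b u₀) (θ u₀) (η u₀)
  db : ∀ᶠ u in 𝓝 u₀, ∀ v w, extD b u v w = η u v * θ u w - η u w * θ u v
  dθ : ∀ᶠ u in 𝓝 u₀, ∀ X w, b u X = 1 → θ u X = 0 → η u X = 0 → extD θ u X w = η u w

variable {b θ η b' θ' η' : Model 3 → Model 3 →L[ℝ] ℝ} {u₀ : Model 3}
  {k : WithTop ℕ∞}

lemma SasakiGerm.congr (h : SasakiGerm k b θ η u₀) (hb : b' =ᶠ[𝓝 u₀] b) : SasakiGerm k b' θ η u₀ where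
  smooth_b := h.smooth_b.congr_of_eventuallyEq hb
  smooth_θ := h.smooth_θ
  smooth_η := h.smooth_η
  coframe := by rw [hb.eq_of_nhds]; exact h.coframe
  db := by
    filter_upwards [h.db, eventually_extD_congr hb] with u hu hu' v w
    rw [hu', hu]
  dθ := by
    filter_upwards [h.dθ, hb] with u hu hu' X w
    rw [hu']; exact hu X w

lemma two_add_one_le_infty : (2 : WithTop ℕ∞) + 1 ≤ ((⊤ : ℕ∞) : WithTop ℕ∞) := by
  norm_num; exact WithTop.coe_le_coe.2 (le_top : (3 : ℕ∞) ≤ ⊤)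

/-- Finite smoothness, unlike C^∞ at a point, persists at nearby points, and C² is enough for
comparing charts. -/
lemma SasakiGerm.toTwo (h : SasakiGerm (⊤ : ℕ∞) b θ η u₀) : SasakiGerm 2 b θ η u₀ where
  smooth_b := h.smooth_b.of_le (WithTop.coe_le_coe.2 (le_top : (2 : ℕ∞) ≤ ⊤))
  smooth_θ := h.smooth_θ.of_le (WithTop.coe_le_coe.2 (le_top : (2 : ℕ∞) ≤ ⊤))
  smooth_η := h.smooth_η.of_le (WithTop.coe_le_coe.2 (le_top : (2 : ℕ∞) ≤ ⊤))
  coframe := h.coframe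
  db := h.db
  dθ := h.dθ

lemma SasakiGerm.diff_b (h : SasakiGerm 2 b θ η u₀) : ∀ᶠ u in 𝓝 u₀, DifferentiableAt ℝ b u :=
  (h.smooth_b.eventually (by simp)).mono fun _ hu => hu.differentiableAt (by simp)

lemma SasakiGerm.diff_θ (h : SasakiGerm 2 b θ η u₀) : ∀ᶠ u in 𝓝 u₀, DifferentiableAt ℝ θ u :=
  (h.smooth_θ.eventually (by simp)).mono fun _ hu => hu.differentiableAt (by simp)

lemma SasakiGerm.pull {τ : Model 3 → Model 3} {u₁ : Model 3} (h : SasakiGerm 2 b θ η (τ u₁))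
    (hτ : ContDiffAt ℝ ∞ τ u₁) (hinj : Function.Injective (fderiv ℝ τ u₁)) :
    SasakiGerm 2 (pullForm τ b) (pullForm τ θ) (pullForm τ η) u₁ where
  smooth_b := h.smooth_b.pullForm hτ two_add_one_le_infty
  smooth_θ := h.smooth_θ.pullForm hτ two_add_one_le_infty
  smooth_η := h.smooth_η.pullForm hτ two_add_one_le_infty
  coframe := by
    intro v h1 h2 h3
    have := h.coframe _ h1 h2 h3
    exact hinj (by simpa using this)
  db := by
    filter_upwards [hτ.continuousAt.eventually h.db,
      hτ.continuousAt.eventually h.diff_b, hτ.eventually_two]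
      with u hu hd h2 v w
    rw [extD_pullForm hd h2, hu]; rfl
  dθ := by
    filter_upwards [hτ.continuousAt.eventually h.dθ,
      hτ.continuousAt.eventually h.diff_θ, hτ.eventually_two]
      with u hu hd h2 v w h3 h4 h5
    rw [extD_pullForm hd h2]
    exact hu _ _ h3 h4 h5

lemma SasakiGerm.eventually_frame (h : SasakiGerm k b θ η u₀) :
    ∀ᶠ u in 𝓝 u₀, ∃ X Y Z, IsDualFrame (b u) (θ u) (η u) X Y Z := by
  obtain ⟨X, Y, Z, -, -, -, hF⟩ := h.coframe.exists_smooth_dualFrame h.smooth_b h.smooth_θ h.smooth_η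
  exact hF.mono fun u hu => ⟨_, _, _, hu⟩

/-- The structure equations persist at the nearby points. -/
lemma SasakiGerm.eventually_germ (h : SasakiGerm 2 b θ η u₀) :
    ∀ᶠ u in 𝓝 u₀, SasakiGerm 2 b θ η u := by
  filter_upwards [h.smooth_b.eventually (by simp), h.smooth_θ.eventually (by simp),
    h.smooth_η.eventually (by simp), h.eventually_frame, h.db.eventually_nhds,
    h.dθ.eventually_nhds] with u h1 h2 h3 ⟨X, Y, Z, hf⟩ h5 h6
  exact ⟨h1, h2, h3, hf.isCoframe, h5, h6⟩

/-- A continuous covector field is locally determined up to a sign by its square. -/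
lemma eventually_eq_or_neg_of_sq {E : Type*} [NormedAddCommGroup E] [NormedSpace ℝ E]
    {θ θ' : E → E →L[ℝ] ℝ} {u₀ : E} (hc : ContinuousAt θ u₀) (hc' : ContinuousAt θ' u₀) {Y : E}
    (hY : θ u₀ Y = 1) (h : ∀ᶠ u in 𝓝 u₀, ∀ w, θ u w ^ 2 = θ' u w ^ 2) :
    ∃ ε : ℝ, (ε = 1 ∨ ε = -1) ∧ ∀ᶠ u in 𝓝 u₀, ∀ w, θ' u w = ε * θ u w := by
  have h1 : ∀ᶠ u in 𝓝 u₀, (∀ w, θ' u w = θ u w) ∨ (∀ w, θ' u w = - θ u w) := by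
    filter_upwards [h] with u hu
    rcases covector_pair_eq_or_neg (p := (θ u).toLinearMap) (s := 0) (p' := (θ' u).toLinearMap)
      (s' := 0) (fun v => by
        have := congrArg (fun r : ℝ => (r : ℂ)) (hu v)
        simpa using this) with h | h
    · exact Or.inl fun w => congrArg (fun L => L w) h.1
    · exact Or.inr fun w => congrArg (fun L => L w) h.1
  have hcY : ContinuousAt (fun u => θ u Y) u₀ := hc.clm_apply continuousAt_const
  have hcY' : ContinuousAt (fun u => θ' u Y) u₀ := hc'.clm_apply continuousAt_const
  -- Near the base point neither θ(Y) nor θ'(Y) changes sign, so the sign relating the two covectors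
  -- is locally constant.
  have hp : ∀ᶠ u in 𝓝 u₀, 0 < θ u Y := hcY.eventually (lt_mem_nhds (by simp only [hY]; norm_num))
  rcases h1.self_of_nhds with h0 | h0
  · refine ⟨1, Or.inl rfl, ?_⟩
    have hp' : ∀ᶠ u in 𝓝 u₀, 0 < θ' u Y :=
      hcY'.eventually (lt_mem_nhds (by simp only [h0, hY]; norm_num))
    filter_upwards [h1, hp, hp'] with u hu a1 a2 w
    rcases hu with hu | hu
    · rw [hu, one_mul]
    · linarith [hu Y]
  · refine ⟨-1, Or.inr rfl, ?_⟩
    have hp' : ∀ᶠ u in 𝓝 u₀, θ' u Y < 0 :=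
      hcY'.eventually (gt_mem_nhds (by simp only [h0, hY]; norm_num))
    filter_upwards [h1, hp, hp'] with u hu a1 a2 w
    rcases hu with hu | hu
    · linarith [hu Y]
    · rw [hu]; ring

/-- The square determines θ up to a locally constant sign, and η = ι_X dθ is then determined with
the same sign. -/
lemma SasakiGerm.unique (h : SasakiGerm 2 b θ η u₀) (h' : SasakiGerm 2 b' θ' η' u₀)
    (hb : b =ᶠ[𝓝 u₀] b') (hθ : ∀ᶠ u in 𝓝 u₀, ∀ w, θ u w ^ 2 = θ' u w ^ 2) :
    ∃ ε : ℝ, (ε = 1 ∨ ε = -1) ∧ ∀ᶠ u in 𝓝 u₀, θ' u = ε • θ u ∧ η' u = ε • η u := by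
  obtain ⟨X, Y, Z, hf⟩ := h.coframe.exists_dualFrame
  obtain ⟨ε, hε, he⟩ := eventually_eq_or_neg_of_sq h.smooth_θ.continuousAt h'.smooth_θ.continuousAt
    hf.pY hθ
  have heq : θ' =ᶠ[𝓝 u₀] fun u => ε • θ u := he.mono fun u hu => by ext w; exact hu w
  refine ⟨ε, hε, ?_⟩
  filter_upwards [heq, h.db, h'.db, eventually_extD_congr hb, hb, h.eventually_frame, h.dθ, h'.dθ,
    eventually_extD_congr heq, h.diff_θ, h'.eventually_frame] with
    u h1 h2 h3 h4 h5 ⟨X, Y, Z, hF⟩ h6 h7 h8 h9 ⟨X', Y', Z', hF'⟩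
  refine ⟨h1, ?_⟩
  ext w
  -- The Reeb vector of the first frame is also killed by θ' and η', because ι_X db = 0 and db =
  -- η'∧θ'.
  have k : ∀ w, η' u X * θ' u w - η' u w * θ' u X = 0 := fun w => by
    rw [← h3, ← h4, h2, hF.sX, hF.pX]; ring
  have k1 := k Y'
  have k2 := k Z'
  rw [hF'.pY, hF'.sY] at k1
  rw [hF'.pZ, hF'.sZ] at k2
  have hX1 := h6 X w hF.bX hF.pX hF.sX
  have hX2 := h7 X w (by rw [← h5]; exact hF.bX) (by linarith) (by linarith)
  rw [h8, extD_const_smul h9, hX1] at hX2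
  rw [smul_apply, smul_eq_mul, hX2]

/-- In curvature `K = - μ²`, the weak stable and unstable covector fields. -/
lemma SasakiGerm.anosovGerm (h : SasakiGerm (⊤ : ℕ∞) b θ η u₀) {μ : ℝ} (hμ : μ ≠ 0)
    (hη : ∀ᶠ u in 𝓝 u₀, ∀ X w, b u X = 1 → θ u X = 0 → η u X = 0 →
      extD η u X w = μ ^ 2 * θ u w) :
    AnosovGerm μ b (fun u => η u + μ • θ u) (fun u => (-1 / (4 * μ)) • (η u + (-μ) • θ u)) u₀ where
  smooth_b := h.smooth_b
  smooth_p := h.smooth_η.add (h.smooth_θ.const_smul μ)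
  smooth_s := (h.smooth_η.add (h.smooth_θ.const_smul (-μ))).const_smul _
  coframe := by
    intro v h1 h2 h3
    simp only [add_apply, smul_apply, smul_eq_mul, mul_eq_zero] at h2 h3
    have h4 := h3.resolve_left (by simp [hμ])
    have h5 : μ * θ u₀ v = 0 := by linarith
    exact h.coframe v h1 ((mul_eq_zero.1 h5).resolve_left hμ) (by linarith)
  -- Here the constant -1/(4μ) is forced: (η + μθ)∧(η - μθ) = -2μ η∧θ, while η∧θ has to equal 2 p∧s.
  db := by
    filter_upwards [h.db] with u hu v w
    rw [hu]; simp only [add_apply, smul_apply, smul_eq_mul]; field_simp; ring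
  -- ι_X d(η + μθ) = μ²θ + μη = μ(η + μθ); for s the sign of μ is reversed.
  dp := by
    filter_upwards [hη, h.dθ, h.smooth_θ.eventually_differentiableAt,
      h.smooth_η.eventually_differentiableAt] with u h1 h2 d1 d2 X w k1 k2 k3
    simp only [add_apply, smul_apply, smul_eq_mul, mul_eq_zero] at k2 k3 ⊢
    have h4 := k3.resolve_left (by simp [hμ])
    have h5 : μ * θ u X = 0 := by linarith
    have h6 := (mul_eq_zero.1 h5).resolve_left hμ
    rw [extD_add (b := η) (c := fun u => μ • θ u) d2 (d1.const_smul μ), extD_const_smul d1, h1 X w k1 h6 (by linarith),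
      h2 X w k1 h6 (by linarith)]
    ring
  ds := by
    filter_upwards [hη, h.dθ, h.smooth_θ.eventually_differentiableAt,
      h.smooth_η.eventually_differentiableAt] with u h1 h2 d1 d2 X w k1 k2 k3
    simp only [add_apply, smul_apply, smul_eq_mul, mul_eq_zero] at k2 k3 ⊢
    have h4 := k3.resolve_left (by simp [hμ])
    have h5 : μ * θ u X = 0 := by linarith
    have h6 := (mul_eq_zero.1 h5).resolve_left hμ
    rw [extD_const_smul (b := fun u => η u + (-μ) • θ u) (d2.add (d1.const_smul (-μ))),
      extD_add (b := η) (c := fun u => (-μ) • θ u) d2 (d1.const_smul (-μ)), extD_const_smul d1, h1 X w k1 h6 (by linarith),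
      h2 X w k1 h6 (by linarith)]
    ring

end SasakiGerm

/-! ### The unit tangent bundle of a surface of constant curvature -/

section UnitTangentGerm

variable {S : Type*} [TopologicalSpace S] [ChartedSpace (Model 2) S] [IsManifold (𝓡 2) ∞ S]
  {g : SmoothMetric 2 S} [ChartedSpace (Model 3) (UnitTangent g)]
  [IsManifold (𝓡 3) ∞ (UnitTangent g)]

lemma IsSubmanifoldStructure.contMDiff_proj (h : IsSubmanifoldStructure g) :
    ContMDiff (𝓡 3) (𝓡 2) ∞ (fun v : UnitTangent g => v.1.proj) := by
  have : IsManifold (𝓡 2) 1 S := IsManifold.of_le (n := ∞) (by simp)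
  exact (Bundle.contMDiff_proj (TangentSpace (𝓡 2) : S → Type _)).comp h.1

/-- The fibre coordinate of a unit tangent vector, in the preferred charts. -/
def fibreCoord (v₀ : UnitTangent g) (u : Model 3) : Model 2 :=
  (trivializationAt (Model 2) (TangentSpace (𝓡 2)) v₀.1.proj (chartInv v₀ u).1).2

lemma contDiffAt_fibreCoord (h : IsSubmanifoldStructure g) (v₀ : UnitTangent g) :
    ContDiffAt ℝ ∞ (fibreCoord v₀) (extChartAt (𝓡 3) v₀ v₀) := by
  have : IsManifold (𝓡 2) 1 S := IsManifold.of_le (n := ∞) (by simp)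
  rw [← contMDiffAt_iff_contDiffAt]
  have h1 := contMDiffAt_chartInv (mem_extChartAt_target (I := 𝓡 3) v₀)
  have h2 : ContMDiffAt (𝓡 3) (𝓡 2).tangent ∞ (fun v : UnitTangent g => v.1)
    (chartInv v₀ (extChartAt (𝓡 3) v₀ v₀)) := h.1 _
  have h3 := h2.comp _ h1
  have h4 := (Bundle.contMDiffAt_totalSpace.1 h3).2
  have hc : (chartInv v₀ (extChartAt (𝓡 3) v₀ v₀)) = v₀ := chartInv_center v₀
  simp only [Function.comp_apply, hc] at h4
  exact h4

lemma eventually_fibreCoord (h : IsSubmanifoldStructure g) (v₀ : UnitTangent g) :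
    ∀ᶠ u in 𝓝 (extChartAt (𝓡 3) v₀ v₀),
      (chartInvDeriv v₀.1.proj (chartRep 3 2 (fun v : UnitTangent g => v.1.proj) v₀ v₀.1.proj u)
        (fibreCoord v₀ u) : Model 2) = ((chartInv (n := 3) v₀ u).1.snd : Model 2) := by
  filter_upwards [eventually_chartRep (h.contMDiff_proj v₀) (mem_extChartAt_source v₀.1.proj)]
    with u hu
  have hs : (chartInv (n := 3) v₀ u).1.proj ∈ (chartAt (Model 2) v₀.1.proj).source := by
    have := chartInv_mem_source hu.2.1
    rw [← hu.2.2, extChartAt_source] at this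
    exact this
  have h1 := chartInvDeriv_eq_symmL hs (fibreCoord v₀ u)
  refine Eq.trans ?_ (h1.trans ?_)
  · rfl
  · have := Trivialization.symm_apply_apply_mk
      (trivializationAt (Model 2) (TangentSpace (𝓡 2)) v₀.1.proj)
      (b := (chartInv (n := 3) v₀ u).1.proj) (by simpa using hs) (chartInv (n := 3) v₀ u).1.snd
    exact this

/-- In the chart of the tangent bundle the inclusion is u ↦ (x(u), ξ(u)), and the inclusion is an
immersion. -/
lemma injective_unitTangent_coord (h : IsSubmanifoldStructure g) (v₀ : UnitTangent g) {w : Model 3}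
    (h1 : fderiv ℝ (chartRep 3 2 (fun v : UnitTangent g => v.1.proj) v₀ v₀.1.proj)
      (extChartAt (𝓡 3) v₀ v₀) w = 0)
    (h2 : fderiv ℝ (fibreCoord v₀) (extChartAt (𝓡 3) v₀ v₀) w = 0) : w = 0 := by
  have : IsManifold (𝓡 2) 1 S := IsManifold.of_le (n := ∞) (by simp)
  have : IsManifold (𝓡 2) (1 + 1) S := IsManifold.of_le (n := ∞) (by
    norm_num; exact WithTop.coe_le_coe.2 (le_top : (2 : ℕ∞) ≤ ⊤))
  have hM : IsManifold (𝓡 2).tangent 1 (TangentBundle (𝓡 2) S) := inferInstance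
  set c := extChartAt (𝓡 3) v₀ v₀ with hc
  set x := chartRep 3 2 (fun v : UnitTangent g => v.1.proj) v₀ v₀.1.proj
  set Φ : Model 3 → Model 2 × Model 2 :=
    fun u => extChartAt (𝓡 2).tangent v₀.1 (chartInv (n := 3) v₀ u).1 with hΦ
  have hcen : chartInv (n := 3) v₀ c = v₀ := chartInv_center v₀
  have hx := (contDiffAt_chartRep (h.contMDiff_proj v₀)
    (mem_extChartAt_source (I := 𝓡 2) v₀.1.proj)).differentiableAt_infty
  have hξ := (contDiffAt_fibreCoord h v₀).differentiableAt_infty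
  have e1 : Φ =ᶠ[𝓝 c] fun u => (x u, fibreCoord v₀ u) := by
    filter_upwards [eventually_chartRep (h.contMDiff_proj v₀) (mem_extChartAt_source v₀.1.proj)]
      with u hu
    have hs : (chartInv (n := 3) v₀ u).1.proj ∈ (chartAt (Model 2) v₀.1.proj).source := by
      have := chartInv_mem_source hu.2.1
      rw [← hu.2.2, extChartAt_source] at this
      exact this
    have he := FiberBundle.extChartAt (IB := 𝓡 2) (F := Model 2)
      (E := (TangentSpace (𝓡 2) : S → Type _)) v₀.1
    exact congrArg (fun e => e (chartInv (n := 3) v₀ u).1) he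
  have e2 : fderiv ℝ Φ c w = 0 := by
    rw [e1.fderiv_eq, (hx.hasFDerivAt.prodMk hξ.hasFDerivAt).fderiv]
    exact Prod.ext h1 h2
  have d1 : MDifferentiableAt 𝓘(ℝ, Model 3) (𝓡 3) (chartInv (n := 3) v₀) c :=
    mdifferentiableAt_chartInv (mem_extChartAt_target v₀)
  have d2 : MDifferentiableAt (𝓡 3) (𝓡 2).tangent (fun v : UnitTangent g => v.1) v₀ :=
    (h.1 v₀).mdifferentiableAt (by simp)
  have hp : (chartInv (n := 3) v₀ c).1 ∈ (extChartAt (𝓡 2).tangent v₀.1).source := by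
    rw [hcen]; exact mem_extChartAt_source _
  have d3 : MDifferentiableAt (𝓡 2).tangent 𝓘(ℝ, Model 2 × Model 2)
    (extChartAt (𝓡 2).tangent v₀.1) (chartInv (n := 3) v₀ c).1 :=
    mdifferentiableAt_extChartAt (by rwa [extChartAt_source] at hp)
  have d12 := mfderiv_comp c (I' := 𝓡 3) (f := chartInv (n := 3) v₀)
    (g := fun v : UnitTangent g => v.1) (by rw [hcen]; exact d2) d1
  have d123 := mfderiv_comp c (I' := (𝓡 2).tangent)
    (f := (fun v : UnitTangent g => v.1) ∘ chartInv (n := 3) v₀)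
    (g := extChartAt (𝓡 2).tangent v₀.1) d3
    (MDifferentiableAt.comp c (by rw [hcen]; exact d2) d1)
  have i1 : Function.Injective (mfderiv (𝓡 2).tangent 𝓘(ℝ, Model 2 × Model 2)
    (extChartAt (𝓡 2).tangent v₀.1) (chartInv (n := 3) v₀ c).1) :=
    (isInvertible_mfderiv_extChartAt hp).injective
  have i2 := h.2 (chartInv (n := 3) v₀ c)
  have i3 := chartInvDeriv_injective (mem_extChartAt_target (I := 𝓡 3) v₀)
  have e3 : (mfderiv (𝓡 2).tangent 𝓘(ℝ, Model 2 × Model 2)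
    (extChartAt (𝓡 2).tangent v₀.1) (chartInv (n := 3) v₀ c).1)
      (mfderiv (𝓡 3) (𝓡 2).tangent (fun v : UnitTangent g => v.1) (chartInv (n := 3) v₀ c)
        (chartInvDeriv v₀ c w)) = 0 := by
    rw [d12] at d123
    refine (congrArg (fun L : Model 3 →L[ℝ] Model 2 × Model 2 => L w) d123).symm.trans ?_
    refine Eq.trans ?_ e2
    rw [← mfderiv_eq_fderiv]
    rfl
  have e4 := i1 (e3.trans (map_zero _).symm)
  have e5 := i2 (e4.trans (map_zero _).symm)
  exact i3 (e5.trans (map_zero _).symm)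

end UnitTangentGerm

lemma contDiffAt_covAlong {E F : Type*} [NormedAddCommGroup E] [NormedSpace ℝ E]
    [NormedAddCommGroup F] [NormedSpace ℝ F] {Γ : F → F →L[ℝ] F →L[ℝ] F} {x ζ : E → F} {u : E}
    (hΓ : ContDiffAt ℝ ∞ (fun u => Γ (x u)) u) (hx : ContDiffAt ℝ ∞ x u) (hζ : ContDiffAt ℝ ∞ ζ u) :
    ContDiffAt ℝ ∞ (covAlong Γ x ζ) u := by
  have h1 : ContDiffAt ℝ ∞ (fun u => (Γ (x u)).flip) u :=
    (ContinuousLinearMap.flipₗᵢ ℝ F F F).toContinuousLinearEquiv.contDiff.contDiffAt.comp u hΓ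
  exact (hζ.fderiv_right (m := ∞) (by simp)).add
    ((h1.clm_apply hζ).clm_comp (hx.fderiv_right (m := ∞) (by simp)))

section UnitTangentSasaki

variable {S : Type*} [TopologicalSpace S] [ChartedSpace (Model 2) S] [IsManifold (𝓡 2) ∞ S]
  {g : SmoothMetric 2 S} [ChartedSpace (Model 3) (UnitTangent g)]
  [IsManifold (𝓡 3) ∞ (UnitTangent g)]

lemma inner_congr_point (g : SmoothMetric 2 S) {a b : S} (h : a = b) {v v' w w' : Model 2}
    (hv : v = v') (hw : w = w') :
    g.inner a (show TangentSpace (𝓡 2) a from v) (show TangentSpace (𝓡 2) a from w) =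
      g.inner b (show TangentSpace (𝓡 2) b from v') (show TangentSpace (𝓡 2) b from w') := by
  subst h; subst hv; subst hw; rfl

/-- The square of the component of the projection of `w` that is normal to `v`. -/
def normalSq (g : SmoothMetric 2 S) [ChartedSpace (Model 3) (UnitTangent g)] (v : UnitTangent g)
    (w : TangentSpace (𝓡 3) v) : ℝ :=
  g.inner v.1.proj (mfderiv (𝓡 3) (𝓡 2) (fun v : UnitTangent g => v.1.proj) v w)
    (mfderiv (𝓡 3) (𝓡 2) (fun v : UnitTangent g => v.1.proj) v w) - canonicalForm g v w ^ 2

/-- The metric, and the coordinates of the base point and of the vector. -/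
lemma eventually_unitTangent_coord (h : IsSubmanifoldStructure g) (v₀ : UnitTangent g) :
    ∀ᶠ u in 𝓝 (extChartAt (𝓡 3) v₀ v₀), ∀ w,
      let x := chartRep 3 2 (fun v : UnitTangent g => v.1.proj) v₀ v₀.1.proj
      let G := chartMetric g v₀.1.proj
      G (x u) (fibreCoord v₀ u) (fibreCoord v₀ u) = 1 ∧
      formInChart (canonicalForm g) v₀ u w = G (x u) (fibreCoord v₀ u) (fderiv ℝ x u w) ∧
      funInChart (normalSq g) v₀ u w = G (x u) (fderiv ℝ x u w) (fderiv ℝ x u w) -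
        G (x u) (fibreCoord v₀ u) (fderiv ℝ x u w) ^ 2 := by
  filter_upwards [eventually_chartRep (h.contMDiff_proj v₀) (mem_extChartAt_source v₀.1.proj),
    eventually_mfderiv_chartRep (h.contMDiff_proj v₀) (mem_extChartAt_source v₀.1.proj),
    eventually_fibreCoord h v₀] with u h1 h2 h3 w
  intro x G
  have e1 : G (x u) (fibreCoord v₀ u) (fibreCoord v₀ u) = 1 :=
    (inner_congr_point g h1.2.2.symm h3 h3).trans (chartInv (n := 3) v₀ u).2
  have e2 : formInChart (canonicalForm g) v₀ u w = G (x u) (fibreCoord v₀ u) (fderiv ℝ x u w) :=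
    inner_congr_point g h1.2.2 h3.symm (h2 w)
  have e3 : g.inner _ (mfderiv (𝓡 3) (𝓡 2) (fun v : UnitTangent g => v.1.proj) (chartInv v₀ u)
      (chartInvDeriv v₀ u w)) (mfderiv (𝓡 3) (𝓡 2) (fun v : UnitTangent g => v.1.proj)
      (chartInv v₀ u) (chartInvDeriv v₀ u w)) = G (x u) (fderiv ℝ x u w) (fderiv ℝ x u w) :=
    inner_congr_point g h1.2.2 (h2 w) (h2 w)
  refine ⟨e1, e2, ?_⟩
  rw [← e2, ← e3]
  rfl

/-- Takes θ = ⟨ν, dx⟩ and η = ⟨ν, Dξ⟩ for a local unit normal ν. The sign of ν is arbitrary, so only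
θ² = |dπ(w)|² - α(w)² is intrinsic. The curvature equation is obtained only at the chart centre,
where `riemann` is defined through the preferred chart; it is spread to nearby points afterwards. -/
lemma exists_sasakiGerm (h : IsSubmanifoldStructure g) {K : ℝ} (hK : HasConstantCurvature g K)
    (v₀ : UnitTangent g) : ∃ θ η : Model 3 → Model 3 →L[ℝ] ℝ,
      SasakiGerm (⊤ : ℕ∞) (formInChart (canonicalForm g) v₀) θ η (extChartAt (𝓡 3) v₀ v₀) ∧
      (∀ᶠ u in 𝓝 (extChartAt (𝓡 3) v₀ v₀), ∀ w, θ u w ^ 2 = funInChart (normalSq g) v₀ u w) ∧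
      ∀ X w, formInChart (canonicalForm g) v₀ (extChartAt (𝓡 3) v₀ v₀) X = 1 →
        θ (extChartAt (𝓡 3) v₀ v₀) X = 0 → η (extChartAt (𝓡 3) v₀ v₀) X = 0 →
        extD η (extChartAt (𝓡 3) v₀ v₀) X w = - K * θ (extChartAt (𝓡 3) v₀ v₀) w := by
  set y₀ := v₀.1.proj
  set c := extChartAt (𝓡 3) v₀ v₀ with hc
  set x := chartRep 3 2 (fun v : UnitTangent g => v.1.proj) v₀ y₀ with hx
  set ξ := fibreCoord v₀ with hξ
  set G := chartMetric g y₀ with hG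
  set Γ := christoffelMap g y₀ with hΓ
  have hev := eventually_unitTangent_coord h v₀
  have hxs : ContDiffAt ℝ ∞ x c :=
    contDiffAt_chartRep (h.contMDiff_proj v₀) (mem_extChartAt_source y₀)
  have hξs : ContDiffAt ℝ ∞ ξ c := contDiffAt_fibreCoord h v₀
  have hxc : x c = extChartAt (𝓡 2) y₀ y₀ := by
    have : chartInv (n := 3) v₀ c = v₀ := chartInv_center v₀
    rw [hx, chartRep, this]
  have hGs : ContDiffAt ℝ ∞ G (x c) := by rw [hxc]; exact contDiffAt_chartMetric g y₀
  have hΓs : ContDiffAt ℝ ∞ Γ (x c) := by rw [hxc]; exact contDiffAt_christoffelMap g y₀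
  have hGx : ContDiffAt ℝ ∞ (fun u => G (x u)) c := ContDiffAt.comp (g := G) (f := x) c hGs hxs
  have hΓx : ContDiffAt ℝ ∞ (fun u => Γ (x u)) c := ContDiffAt.comp (g := Γ) (f := x) c hΓs hxs
  have hsym : ∀ u a b, G u a b = G u b a := fun u => chartMetric_symm g y₀ u
  have hξξ : ∀ᶠ u in 𝓝 c, G (x u) (ξ u) (ξ u) = 1 := hev.mono fun u hu => (hu 0).1
  have hF : Module.finrank ℝ (Model 2) = 2 := by simp
  obtain ⟨ν, hνs, hν⟩ := exists_unit_normal hF hGx hξs (Eventually.of_forall fun u a b => hsym _ a b)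
    (fun a ha => by rw [hxc]; exact chartMetric_pos g y₀ (mem_extChartAt_target y₀) ha) hξξ
  have hdec : ∀ᶠ u in 𝓝 c, ∀ a, a = G (x u) (ξ u) a • ξ u + G (x u) (ν u) a • ν u := by
    filter_upwards [hξξ, hν] with u h1 h2 a
    exact orthonormal_decomposition hF (fun a c => hsym _ a c) h1 h2.1 h2.2 a
  have hm : ∀ᶠ u in 𝓝 c, IsMetricConnection G Γ (x u) := by
    have h1 : ∀ᶠ y in 𝓝 (x c), y ∈ (extChartAt (𝓡 2) y₀).target := by
      rw [hxc]; exact eventually_mem_target y₀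
    filter_upwards [hxs.continuousAt.eventually h1,
      hxs.continuousAt.eventually hGs.eventually_differentiableAt] with u h1 h2
    exact isMetricConnection_of_koszul h2 (Eventually.of_forall fun z a b => hsym z a b)
      fun v w z => two_mul_chartMetric_christoffelMap g y₀ h1 h2 v w z
  set θ := pairForm G x ν (fderiv ℝ x) with hθ
  set η := pairForm G x ν (covAlong Γ x ξ) with hη
  set b := pairForm G x ξ (fderiv ℝ x) with hb
  have hst : ∀ᶠ u in 𝓝 c, ∀ v w,
      extD b u v w = η u v * θ u w - η u w * θ u v ∧
      extD θ u v w = η u w * b u v - η u v * b u w ∧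
      extD η u v w = G (x u) (ν u) (fderiv ℝ Γ (x u) (fderiv ℝ x u v) (fderiv ℝ x u w) (ξ u) -
        fderiv ℝ Γ (x u) (fderiv ℝ x u w) (fderiv ℝ x u v) (ξ u) +
        (Γ (x u) (fderiv ℝ x u v) (Γ (x u) (fderiv ℝ x u w) (ξ u)) -
          Γ (x u) (fderiv ℝ x u w) (Γ (x u) (fderiv ℝ x u v) (ξ u)))) := by
    filter_upwards [hm, hxs.continuousAt.eventually hGs.eventually_differentiableAt,
      hxs.continuousAt.eventually hΓs.eventually_differentiableAt, hxs.eventually_two,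
      hξs.eventually_two, hνs.eventually_two, hξξ.eventually_nhds, hν.eventually_nhds, hdec]
      with u h1 h2 h3 h4 h5 h6 h7 h8 h9 v w
    exact unitTangent_structure h1 (christoffelMap_symm g y₀ _) h2 h3 h4 h5 h6
      (fun a c => hsym _ a c) h7 (h8.mono fun _ h => h.1) (h8.mono fun _ h => h.2) h9 hb hθ hη v w
  have hbb : formInChart (canonicalForm g) v₀ =ᶠ[𝓝 c] b := by
    filter_upwards [hev] with u hu
    ext w
    exact (hu w).2.1
  have hDx : ContDiffAt ℝ ∞ (fderiv ℝ x) c := hxs.fderiv_right (m := ∞) (by simp)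
  have hcov : ContDiffAt ℝ ∞ (covAlong Γ x ξ) c :=
    contDiffAt_covAlong hΓx hxs hξs
  have hsas : SasakiGerm (⊤ : ℕ∞) b θ η c := by
    refine ⟨(hGx.clm_apply hξs).clm_comp hDx, (hGx.clm_apply hνs).clm_comp hDx,
      (hGx.clm_apply hνs).clm_comp hcov, ?_, hst.mono fun u hu v w => (hu v w).1, ?_⟩
    · intro w h1 h2 h3
      have e1 : fderiv ℝ x c w = 0 := by
        rw [hdec.self_of_nhds (fderiv ℝ x c w)]
        have h1' : G (x c) (ξ c) (fderiv ℝ x c w) = 0 := h1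
        have h2' : G (x c) (ν c) (fderiv ℝ x c w) = 0 := h2
        rw [h1', h2', zero_smul, zero_smul, add_zero]
      -- The ν-component of Dξ is η(w) = 0, and the ξ-component vanishes because ξ has unit length.
      -- As dx(w) = 0, this forces dξ(w) = 0.
      have e2 : covAlong Γ x ξ c w = 0 := by
        have hz := fderiv_inner_covAlong hm.self_of_nhds hGs.differentiableAt_infty
          hxs.differentiableAt_infty hξs.differentiableAt_infty hξs.differentiableAt_infty w
        rw [fderiv_eq_zero_of_eventually hξξ, hsym _ (covAlong Γ x ξ c w), zero_apply] at hz
        rw [hdec.self_of_nhds (covAlong Γ x ξ c w)]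
        have h2' : G (x c) (ν c) (covAlong Γ x ξ c w) = 0 := h3
        have h1' : G (x c) (ξ c) (covAlong Γ x ξ c w) = 0 := by linarith
        rw [h1', h2', zero_smul, zero_smul, add_zero]
      rw [covAlong_apply, e1, map_zero, zero_apply, add_zero] at e2
      exact injective_unitTangent_coord h v₀ e1 e2
    · filter_upwards [hst] with u hu X w h1 h2 h3
      rw [(hu X w).2.1, h1, h3]; ring
  refine ⟨θ, η, hsas.congr hbb, ?_, fun X w h1 h2 h3 => ?_⟩
  · filter_upwards [hev, hdec, hν, hξξ] with u hu hd hn hxx w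
    refine Eq.trans ?_ (hu w).2.2.symm
    have e : G (x u) (fderiv ℝ x u w) (fderiv ℝ x u w) = G (x u) (ξ u) (fderiv ℝ x u w) ^ 2 +
        G (x u) (ν u) (fderiv ℝ x u w) ^ 2 := by
      conv_lhs => rw [hd (fderiv ℝ x u w)]
      generalize G (x u) (ξ u) (fderiv ℝ x u w) = r
      generalize G (x u) (ν u) (fderiv ℝ x u w) = t
      simp only [map_add, map_smul, add_apply, smul_apply, smul_eq_mul, hn.1, hn.2, hxx,
        hsym _ (ν u) (ξ u)]
      ring
    have e' : (θ u w) = G (x u) (ν u) (fderiv ℝ x u w) := rfl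
    rw [e']
    linarith
  · rw [hbb.self_of_nhds] at h1
    have hX : fderiv ℝ x c X = ξ c := by
      rw [hdec.self_of_nhds (fderiv ℝ x c X)]
      have h1' : G (x c) (ξ c) (fderiv ℝ x c X) = 1 := h1
      have h2' : G (x c) (ν c) (fderiv ℝ x c X) = 0 := h2
      rw [h1', h2', zero_smul, one_smul, add_zero]
    have hw : fderiv ℝ x c w = b c w • ξ c + θ c w • ν c := hdec.self_of_nhds _
    -- The sectional curvature of the orthonormal pair ν, ξ. Below, dx(X) = ξ and dx(w) = b(w)ξ +
    -- θ(w)ν, so only this curvature component enters dη(X, w).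
    have hR : G (x c) (fderiv ℝ Γ (x c) (ν c) (ξ c) (ξ c) - fderiv ℝ Γ (x c) (ξ c) (ν c) (ξ c) +
        (Γ (x c) (ν c) (Γ (x c) (ξ c) (ξ c)) - Γ (x c) (ξ c) (Γ (x c) (ν c) (ξ c)))) (ν c) = K := by
      have h1 := hK y₀ (show TangentSpace (𝓡 2) y₀ from ν c) (show TangentSpace (𝓡 2) y₀ from ξ c)
      have hcy : ∀ a a' : Model 2, g.inner y₀ (show TangentSpace (𝓡 2) y₀ from a)
          (show TangentSpace (𝓡 2) y₀ from a') = G (x c) a a' := fun a a' => by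
        rw [hxc]
        exact inner_congr_point g (chartInv_center y₀).symm (chartInvDeriv_center y₀ a).symm
          (chartInvDeriv_center y₀ a').symm
      have h2 := riemann_eq g y₀ (ν c) (ξ c) (ξ c)
      have h4 : G (x c) (ν c) (ξ c) = 0 := (hsym _ _ _).trans hν.self_of_nhds.2
      have h5 : K * (G (x c) (ν c) (ν c) * G (x c) (ξ c) (ξ c) - G (x c) (ν c) (ξ c) ^ 2) = K := by
        rw [h4, hν.self_of_nhds.1, hξξ.self_of_nhds]; ring
      have h6 := h1.trans ((by rw [hcy (ν c) (ν c), hcy (ξ c) (ξ c), hcy (ν c) (ξ c)] : _ = _).trans h5)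
      have h3 := (hcy _ _).symm.trans (Eq.trans (inner_congr_point g rfl h2.symm rfl) h6)
      rw [hxc] at h3 ⊢
      exact h3
    rw [(hst.self_of_nhds X w).2.2, hX, hw, ← hR, hsym _ _ (ν c)]
    simp only [map_add, map_sub, map_smul, add_apply, smul_apply, smul_eq_mul]
    ring

end UnitTangentSasaki

section SasakiStructure

variable {M : Type*} [TopologicalSpace M] [ChartedSpace (Model 3) M] [IsManifold (𝓡 3) ∞ M]

/-- Comparison of the structure equations in two charts, for intrinsic `θ²`. -/
lemma SasakiGerm.compare {α : OneForm M} {A : ∀ x : M, TangentSpace (𝓡 3) x → ℝ} {x : M}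
    {u : Model 3} (hu : u ∈ (extChartAt (𝓡 3) x).target) {θ η θ' η' : Model 3 → Model 3 →L[ℝ] ℝ}
    (h : SasakiGerm 2 (formInChart α x) θ η u)
    (hθ : ∀ᶠ y in 𝓝 u, ∀ w, θ y w ^ 2 = funInChart A x y w)
    (h' : SasakiGerm 2 (formInChart α (chartInv x u)) θ' η'
      (extChartAt (𝓡 3) (chartInv x u) (chartInv (n := 3) x u)))
    (hθ' : ∀ᶠ y in 𝓝 (extChartAt (𝓡 3) (chartInv x u) (chartInv (n := 3) x u)), ∀ w,
      θ' y w ^ 2 = funInChart A (chartInv x u) y w) {κ : ℝ}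
    (hη' : ∀ X w, formInChart α (chartInv x u)
        (extChartAt (𝓡 3) (chartInv x u) (chartInv (n := 3) x u)) X = 1 →
      θ' (extChartAt (𝓡 3) (chartInv x u) (chartInv (n := 3) x u)) X = 0 →
      η' (extChartAt (𝓡 3) (chartInv x u) (chartInv (n := 3) x u)) X = 0 →
      extD η' (extChartAt (𝓡 3) (chartInv x u) (chartInv (n := 3) x u)) X w =
        κ * θ' (extChartAt (𝓡 3) (chartInv x u) (chartInv (n := 3) x u)) w) :
    (∀ X w, formInChart α x u X = 1 → θ u X = 0 → η u X = 0 → extD η u X w = κ * θ u w) ∧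
    ∃ ε : ℝ, (ε = 1 ∨ ε = -1) ∧ ∀ w : Model 3,
      θ u w = ε * θ' (extChartAt (𝓡 3) (chartInv x u) (chartInv (n := 3) x u))
        (chartInvDeriv x u w) ∧
      η u w = ε * η' (extChartAt (𝓡 3) (chartInv x u) (chartInv (n := 3) x u))
        (chartInvDeriv x u w) := by
  set c := extChartAt (𝓡 3) (chartInv x u) (chartInv (n := 3) x u) with hc
  set τ := chartRep 3 3 (id : M → M) (chartInv x u) x with hτdef
  have hid : ContMDiffAt (𝓡 3) (𝓡 3) ∞ (id : M → M) (chartInv x u) := contMDiffAt_id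
  have hs : id (chartInv x u) ∈ (extChartAt (𝓡 3) x).source := chartInv_mem_source hu
  have hτc : τ c = u := chartRep_id_center hu
  have hτ : ContDiffAt ℝ ∞ τ c := contDiffAt_chartRep hid hs
  have hinj : Function.Injective (fderiv ℝ τ c) := injective_fderiv_chartRep hid hs (by
    rw [mfderiv_id]; exact Function.injective_id)
  have hD : ∀ a : Model 3, fderiv ℝ τ c (chartInvDeriv x u a) = a := fderiv_chartRep_id hu
  have hform := formInChart_pullBack α hid hs
  rw [pullBack_id] at hform
  have hA := funInChart_pullTangentFun A hid hs
  rw [pullTangentFun_id] at hA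
  rw [← hτc] at h hθ
  have hp := h.pull hτ hinj
  -- The coframe pulled back to the preferred chart at `chartInv x u` agrees up to sign with the one
  -- constructed there, at whose centre the equation for dη is known.
  obtain ⟨ε, hε, he⟩ := h'.unique hp hform (by
    filter_upwards [hA, hθ', hτ.continuousAt.eventually hθ] with y h1 h2 h3 w
    rw [h2, h1]; exact (h3 _).symm)
  have hε2 : ε * ε = 1 := by rcases hε with rfl | rfl <;> norm_num
  have hε0 : ε ≠ 0 := fun h => by rw [h] at hε2; norm_num at hε2
  have e1 : ∀ w, θ u (fderiv ℝ τ c w) = ε * θ' c w := fun w => by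
    rw [← hτc]; exact congrArg (fun L : Model 3 →L[ℝ] ℝ => L w) he.self_of_nhds.1
  have e2 : ∀ w, η u (fderiv ℝ τ c w) = ε * η' c w := fun w => by
    rw [← hτc]; exact congrArg (fun L : Model 3 →L[ℝ] ℝ => L w) he.self_of_nhds.2
  refine ⟨fun X w h1 h2 h3 => ?_, ε, hε, fun w => ?_⟩
  · have e3 : extD (pullForm τ η) c (chartInvDeriv x u X) (chartInvDeriv x u w) =
        extD η u X w := by
      refine (extD_pullForm (h.smooth_η.differentiableAt (by simp)) (hτ.of_le
        (WithTop.coe_le_coe.2 (le_top : (2 : ℕ∞) ≤ ⊤))) _ _).trans ?_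
      exact (congrArg₂ (extD η _) (hD X) (hD w)).trans (by rw [hτc])
    have e4 : extD (pullForm τ η) c (chartInvDeriv x u X) (chartInvDeriv x u w) =
        ε * extD η' c (chartInvDeriv x u X) (chartInvDeriv x u w) := by
      refine (extD_congr (b' := fun y => ε • η' y) (he.mono fun y hy => hy.2) _ _).trans ?_
      exact extD_const_smul (h'.smooth_η.differentiableAt (by simp)) ε _ _
    have hb : formInChart α (chartInv x u) c (chartInvDeriv x u X) = 1 := by
      rw [hform.self_of_nhds, ← h1, ← hτdef]
      refine (pullForm_apply τ _ c _).trans ?_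
      rw [hτc]
      exact congrArg (formInChart α x u) (hD X)
    have k1 : ε * θ' c (chartInvDeriv x u X) = 0 := by
      rw [← h2]; exact (e1 _).symm.trans (congrArg (θ u) (hD X))
    have k2 : ε * η' c (chartInvDeriv x u X) = 0 := by
      rw [← h3]; exact (e2 _).symm.trans (congrArg (η u) (hD X))
    have k3 : θ u w = ε * θ' c (chartInvDeriv x u w) :=
      (congrArg (θ u) (hD w)).symm.trans (e1 _)
    have e5 := hη' _ (chartInvDeriv x u w) hb ((mul_eq_zero.1 k1).resolve_left hε0)
      ((mul_eq_zero.1 k2).resolve_left hε0)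
    refine e3.symm.trans (e4.trans ((congrArg (ε * ·) e5).trans ?_))
    rw [k3]; ring
  · exact ⟨(congrArg (θ u) (hD w)).symm.trans (e1 _), (congrArg (η u) (hD w)).symm.trans (e2 _)⟩

/-- The curvature equation at the centre of every chart becomes, by comparison of charts, an
equation on a neighbourhood in each single chart. The sign ambiguity of (θ, η) is common to both and
disappears in q. -/
theorem exists_germ_of_sasakiGerm {α : OneForm M} {A : ∀ x : M, TangentSpace (𝓡 3) x → ℝ} {μ : ℝ}
    (hμ : μ ≠ 0) (h : ∀ x : M, ∃ θ η : Model 3 → Model 3 →L[ℝ] ℝ,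
      SasakiGerm (⊤ : ℕ∞) (formInChart α x) θ η (extChartAt (𝓡 3) x x) ∧
      (∀ᶠ u in 𝓝 (extChartAt (𝓡 3) x x), ∀ w, θ u w ^ 2 = funInChart A x u w) ∧
      ∀ X w, formInChart α x (extChartAt (𝓡 3) x x) X = 1 →
        θ (extChartAt (𝓡 3) x x) X = 0 → η (extChartAt (𝓡 3) x x) X = 0 →
        extD η (extChartAt (𝓡 3) x x) X w = μ ^ 2 * θ (extChartAt (𝓡 3) x x) w) :
    ∃ q : ∀ x : M, TangentSpace (𝓡 3) x → ℂ, ∀ x, HasGermAt μ α q x := by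
  choose θ η hg hsq hcurv using h
  refine ⟨fun x w => (((η x (extChartAt (𝓡 3) x x) w + μ * θ x (extChartAt (𝓡 3) x x) w : ℝ) : ℂ) +
    ((-1 / (4 * μ) * (η x (extChartAt (𝓡 3) x x) w + -μ * θ x (extChartAt (𝓡 3) x x) w) : ℝ) : ℂ) *
      Complex.I) ^ 2, fun x => ?_⟩
  have hcmp : ∀ᶠ u in 𝓝 (extChartAt (𝓡 3) x x),
      (∀ X w, formInChart α x u X = 1 → θ x u X = 0 → η x u X = 0 →
        extD (η x) u X w = μ ^ 2 * θ x u w) ∧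
      ∃ ε : ℝ, (ε = 1 ∨ ε = -1) ∧ ∀ w : Model 3,
        θ x u w = ε * θ (chartInv x u) (extChartAt (𝓡 3) (chartInv x u) (chartInv (n := 3) x u))
          (chartInvDeriv x u w) ∧
        η x u w = ε * η (chartInv x u) (extChartAt (𝓡 3) (chartInv x u) (chartInv (n := 3) x u))
          (chartInvDeriv x u w) := by
    filter_upwards [eventually_mem_target x, (hg x).toTwo.eventually_germ,
      (hsq x).eventually_nhds] with u h1 h2 h3
    exact h2.compare h1 h3 (hg _).toTwo (hsq _) (hcurv _)
  refine ⟨_, _, (hg x).anosovGerm hμ (hcmp.mono fun u hu => hu.1), ?_⟩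
  filter_upwards [hcmp] with u ⟨_, ε, hε, hu⟩ w
  obtain ⟨h1, h2⟩ := hu w
  simp only [add_apply, smul_apply, smul_eq_mul, h1, h2, funInChart]
  rcases hε with rfl | rfl
  · simp only [one_mul]
  · push_cast; ring

end SasakiStructure

theorem exists_germ_canonicalForm {S : Type*} [TopologicalSpace S] [ChartedSpace (Model 2) S]
    [IsManifold (𝓡 2) ∞ S] {g : SmoothMetric 2 S} [ChartedSpace (Model 3) (UnitTangent g)]
    [IsManifold (𝓡 3) ∞ (UnitTangent g)] (h : IsSubmanifoldStructure g) {K : ℝ} (hK0 : K < 0)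
    (hK : HasConstantCurvature g K) :
    ∃ q, ∀ v, HasGermAt (Real.sqrt (-K)) (canonicalForm g) q v := by
  refine exists_germ_of_sasakiGerm (A := normalSq g) (Real.sqrt_ne_zero'.2 (by linarith)) fun v => ?_
  rw [Real.sq_sqrt (by linarith)]
  exact exists_sasakiGerm h hK v

/-! ### Maximum principle and rigidity of the contact form -/

section MaximumPrinciple

variable {M : Type*} [TopologicalSpace M] [ChartedSpace (Model 3) M] [IsManifold (𝓡 3) ∞ M]

/-- A nonnegative function which grows exponentially along a vector field vanishes. -/
lemma eq_zero_of_growth [CompactSpace M] {G : M → ℝ} (h0 : ∀ y, 0 ≤ G y) {k : ℝ} (hk : k ≠ 0)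
    (h : ∀ y, ∃ (F : Model 3 → ℝ) (X : Model 3), DifferentiableAt ℝ F (extChartAt (𝓡 3) y y) ∧
      (∀ᶠ u in 𝓝 (extChartAt (𝓡 3) y y), G (chartInv y u) = F u) ∧
      fderiv ℝ F (extChartAt (𝓡 3) y y) X = k * F (extChartAt (𝓡 3) y y)) (y : M) : G y = 0 := by
  have hcont : Continuous G := by
    rw [continuous_iff_continuousAt]
    intro y
    obtain ⟨F, X, hF, hGF, -⟩ := h y
    have h1 : ContinuousAt (fun z => F (extChartAt (𝓡 3) y z)) y :=
      ContinuousAt.comp (f := extChartAt (𝓡 3) y) (g := F) hF.continuousAt (continuousAt_extChartAt y)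
    refine h1.congr ?_
    filter_upwards [(continuousAt_extChartAt (I := 𝓡 3) y).eventually hGF,
      extChartAt_source_mem_nhds (I := 𝓡 3) y] with z h2 h3
    rw [← h2, chartInv_extChartAt h3]
  obtain ⟨y₀, -, hmax⟩ := isCompact_univ.exists_isMaxOn ⟨y, mem_univ y⟩ hcont.continuousOn
  obtain ⟨F, X, hF, hGF, hX⟩ := h y₀
  -- At a maximum point the derivative along the field is zero, and it is also k times the maximal
  -- value; hence the maximum is 0.
  have h1 : IsLocalMax F (extChartAt (𝓡 3) y₀ y₀) := by
    filter_upwards [hGF] with u hu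
    rw [← hu, ← hGF.self_of_nhds, chartInv_center]
    exact hmax (mem_univ _)
  rw [h1.fderiv_eq_zero, zero_apply] at hX
  have h2 : F (extChartAt (𝓡 3) y₀ y₀) = 0 := (mul_eq_zero.1 hX.symm).resolve_left hk
  rw [← hGF.self_of_nhds, chartInv_center] at h2
  exact le_antisymm (h2 ▸ hmax (mem_univ y)) (h0 y)

end MaximumPrinciple

section Squares

open Complex

/-- The squared real part of a square root. -/
def sqRe (q : ℂ) : ℝ := (‖q‖ + q.re) / 2

/-- The squared imaginary part of a square root. -/
def sqIm (q : ℂ) : ℝ := (‖q‖ - q.re) / 2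

lemma norm_sq_add_mul_I (p s : ℝ) : ‖((p : ℂ) + s * I) ^ 2‖ = p ^ 2 + s ^ 2 := by
  rw [norm_pow, ← Complex.normSq_eq_norm_sq, Complex.normSq_add_mul_I]

lemma re_sq_add_mul_I (p s : ℝ) : (((p : ℂ) + s * I) ^ 2).re = p ^ 2 - s ^ 2 := by
  simp [pow_two]

lemma im_sq_add_mul_I (p s : ℝ) : (((p : ℂ) + s * I) ^ 2).im = 2 * (p * s) := by
  simp [pow_two]; ring

lemma sqRe_sq (p s : ℝ) : sqRe (((p : ℂ) + s * I) ^ 2) = p ^ 2 := by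
  rw [sqRe, norm_sq_add_mul_I, re_sq_add_mul_I]; ring

lemma sqIm_sq (p s : ℝ) : sqIm (((p : ℂ) + s * I) ^ 2) = s ^ 2 := by
  rw [sqIm, norm_sq_add_mul_I, re_sq_add_mul_I]; ring

lemma eq_one_of_sq {p s : ℝ} (h : ((p : ℂ) + s * I) ^ 2 = 1) : (p = 1 ∨ p = -1) ∧ s = 0 := by
  have h1 : p ^ 2 = 1 := by rw [← sqRe_sq p s, h]; norm_num [sqRe]
  have h2 : s ^ 2 = 0 := by rw [← sqIm_sq p s, h]; norm_num [sqIm]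
  exact ⟨mul_self_eq_one_iff.1 (by linarith [sq p]), by simpa using h2⟩

end Squares

section Comparison

variable {M : Type*} [TopologicalSpace M] [ChartedSpace (Model 3) M] [IsManifold (𝓡 3) ∞ M]
variable {μ : ℝ} {α : OneForm M} {q : ∀ x : M, TangentSpace (𝓡 3) x → ℂ}

lemma neg_sq_add_mul_I (p s : ℝ) :
    -((p : ℂ) + s * Complex.I) ^ 2 = ((s : ℂ) + (-p : ℝ) * Complex.I) ^ 2 := by
  push_cast
  linear_combination (-(p : ℂ) ^ 2 - (s : ℂ) ^ 2) * Complex.I_sq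

lemma HasGermAt.swap {x : M} (h : HasGermAt μ α q x) : HasGermAt (-μ) α (fun y v => -q y v) x := by
  obtain ⟨p, s, hg, hq⟩ := h
  refine ⟨_, _, hg.swap, ?_⟩
  filter_upwards [hq] with u hu v
  have : funInChart (fun y v => -q y v) x u v = - funInChart q x u v := rfl
  rw [this, hu, neg_sq_add_mul_I]
  simp only [neg_apply]

/-- The function `r` is the square of `p + i s`, where `p` and `s` complete `b` to a coframe. -/
def IsSqCoframe (b : Model 3 →L[ℝ] ℝ) (r : Model 3 → ℂ) : Prop :=
  ∃ p s, IsCoframe b p s ∧ ∀ v, r v = ((p v : ℂ) + s v * Complex.I) ^ 2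

section Pointwise

variable {b : Model 3 →L[ℝ] ℝ} {r : Model 3 → ℂ}

lemma IsSqCoframe.swap (h : IsSqCoframe b r) : IsSqCoframe b (fun v => -r v) := by
  obtain ⟨p, s, hc, hr⟩ := h
  refine ⟨s, -p, fun v h1 h2 h3 => hc v h1 (by simpa using h3) h2, fun v => ?_⟩
  simp only [hr, neg_sq_add_mul_I, neg_apply]

lemma IsSqCoframe.even (h : IsSqCoframe b r) (v : Model 3) : r (-v) = r v := by
  obtain ⟨p, s, hc, hr⟩ := h
  rw [hr, hr, map_neg, map_neg]; push_cast; ring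

/-- There is a vector in the kernel of `b` on which `r` is equal to `1`. -/
lemma IsSqCoframe.exists_unit (h : IsSqCoframe b r) : ∃ v, b v = 0 ∧ r v = 1 := by
  obtain ⟨p, s, hc, hr⟩ := h
  obtain ⟨X, Y, Z, hf⟩ := hc.exists_dualFrame
  exact ⟨Y, hf.bY, by rw [hr, hf.pY, hf.sY]; norm_num⟩

/-- This vector is unique up to sign. -/
lemma IsSqCoframe.unit_unique (h : IsSqCoframe b r) {v w : Model 3}
    (h1 : b v = 0) (h2 : r v = 1) (h3 : b w = 0) (h4 : r w = 1) : w = v ∨ w = -v := by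
  obtain ⟨p, s, hc, hr⟩ := h
  rw [hr] at h2 h4
  obtain ⟨e1, e2⟩ := eq_one_of_sq h2
  obtain ⟨e3, e4⟩ := eq_one_of_sq h4
  have key : ∀ ε : ℝ, p w = ε * p v → w = ε • v := fun ε hε => by
    rw [← sub_eq_zero]
    refine hc _ ?_ ?_ ?_
    · rw [map_sub, map_smul, h1, h3]; simp
    · rw [map_sub, map_smul, hε, smul_eq_mul, sub_self]
    · rw [map_sub, map_smul, e2, e4]; simp
  rcases e1 with e1 | e1 <;> rcases e3 with e3 | e3
  · left; simpa using key 1 (by rw [e1, e3]; norm_num)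
  · right; simpa using key (-1) (by rw [e1, e3]; norm_num)
  · right; simpa using key (-1) (by rw [e1, e3]; norm_num)
  · left; simpa using key 1 (by rw [e1, e3]; norm_num)

end Pointwise

lemma formInChart_center_eq (α : OneForm M) (x : M) :
    formInChart α x (extChartAt (𝓡 3) x x) = (show Model 3 →L[ℝ] ℝ from α x) := by
  ext v; exact formInChart_center α x v

lemma HasGermAt.isSqCoframe {x : M} (h : HasGermAt μ α q x) :
    IsSqCoframe (show Model 3 →L[ℝ] ℝ from α x) (q x) := by
  obtain ⟨p, s, hg, hq⟩ := h
  have hc := hg.coframe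
  rw [formInChart_center_eq] at hc
  exact ⟨_, _, hc, fun v => (funInChart_center q x v).symm.trans (hq.self_of_nhds v)⟩

/-- A form `a` with the same Reeb field as `α` agrees with `α` on the expanded direction. -/
lemma eq_zero_of_unit [CompactSpace M] (hμ : μ ≠ 0) (h : ∀ x, HasGermAt μ α q x) {a : OneForm M}
    (ha : ∀ x, ContDiffAt ℝ ∞ (formInChart a x) (extChartAt (𝓡 3) x x))
    (ha1 : ∀ x, a x (reeb α x) = 1) (ha2 : ∀ x w, dForm a x (reeb α x) w = 0) {x : M}
    {v : TangentSpace (𝓡 3) x} (h1 : α x v = 0) (h2 : q x v = 1) : a x v = 0 := by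
  choose E hE1 hE2 using fun x => (h x).isSqCoframe.exists_unit
  have key : ∀ x, (a x (show TangentSpace (𝓡 3) x from E x)) ^ 2 = 0 := by
    -- The vector E is unique up to sign, so a(E)² is a well-defined function, locally a(Y)². Since
    -- ι_X da = 0, the derivative of a(Y) along X is -μ a(Y), whence the rate -2μ.
    refine eq_zero_of_growth (fun x => sq_nonneg _) (k := -(2 * μ)) (by simpa using hμ) fun x => ?_
    obtain ⟨p, s, hg, hq⟩ := h x
    obtain ⟨X, Y, Z, hX, hY, hZ, hf⟩ := hg.exists_frame
    set c := extChartAt (𝓡 3) x x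
    have hr := hg.eventually_reeb h hf
    have hk : ∀ᶠ u in 𝓝 c, formInChart a x u (X u) = 1 := by
      filter_upwards [hr] with u hu
      rw [formInChart_apply, ← hu, ha1]
    have hd : ∀ᶠ u in 𝓝 c, ∀ w, extD (formInChart a x) u (X u) w = 0 := by
      filter_upwards [hr, eventually_mem_target x, (ha x).eventually_differentiableAt]
        with u hu ht hd w
      rw [← dForm_chartInv ht hd, ← hu, ha2]
    have hco := hg.coeff_deriv hY hZ hf (ha x) hk
    have hs : DifferentiableAt ℝ (fun u => formInChart a x u (Y u)) c :=
      ((ha x).clm_apply hY).differentiableAt_infty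
    refine ⟨fun u => (formInChart a x u (Y u)) ^ 2, X c, hs.pow 2, ?_, ?_⟩
    · filter_upwards [hf, hq] with u hu hqu
      have hY1 : q (chartInv x u) (chartInvDeriv x u (Y u)) = 1 := by
        have := hqu (Y u)
        rw [hu.pY, hu.sY] at this
        exact this.trans (by norm_num)
      rcases (h (chartInv x u)).isSqCoframe.unit_unique (v := chartInvDeriv x u (Y u)) hu.bY hY1
        (hE1 _) (hE2 _) with he | he
      · exact congrArg (fun w => (a (chartInv x u) w) ^ 2) he
      · refine (congrArg (fun w => (a (chartInv x u) w) ^ 2) he).trans ?_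
        exact (congrArg (· ^ 2) (map_neg (a (chartInv x u)) _)).trans (neg_sq _)
    · rw [(hs.hasFDerivAt.pow 2).fderiv, smul_apply, hco.self_of_nhds.1, hd.self_of_nhds]
      simp; ring
  have h3 := pow_eq_zero_iff (two_ne_zero) |>.1 (key x)
  rcases (h x).isSqCoframe.unit_unique (hE1 x) (hE2 x) h1 h2 with he | he
  · exact (congrArg (a x) he).trans h3
  · exact (congrArg (a x) he).trans ((map_neg (a x) _).trans (by rw [h3, neg_zero]))

/-- An Anosov contact form is determined by its Reeb field. -/
theorem form_eq_of_reeb [CompactSpace M] (hμ : μ ≠ 0) (h : ∀ x, HasGermAt μ α q x) {a : OneForm M}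
    (ha : ∀ x, ContDiffAt ℝ ∞ (formInChart a x) (extChartAt (𝓡 3) x x))
    (ha1 : ∀ x, a x (reeb α x) = 1) (ha2 : ∀ x w, dForm a x (reeb α x) w = 0) : a = α := by
  funext x
  obtain ⟨p, s, hg, hq⟩ := h x
  obtain ⟨X, Y, Z, hf⟩ := hg.coframe.exists_dualFrame
  have hqc : ∀ v : Model 3, q x (show TangentSpace (𝓡 3) x from v) = _ := fun v =>
    (funInChart_center q x v).symm.trans (hq.self_of_nhds v)
  have hY : a x (show TangentSpace (𝓡 3) x from Y) = 0 := by
    refine eq_zero_of_unit hμ h ha ha1 ha2 ((formInChart_center α x Y).symm.trans hf.bY) ?_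
    rw [hqc, hf.pY, hf.sY]; norm_num
  have hZ : a x (show TangentSpace (𝓡 3) x from Z) = 0 := by
    -- Time reversal turns the contracted direction into the expanded one.
    refine eq_zero_of_unit (neg_ne_zero.2 hμ) (fun x => (h x).swap) ha ha1 ha2
      ((formInChart_center α x Z).symm.trans hf.bZ) ?_
    rw [hqc, hf.pZ, hf.sZ]; norm_num
  have hX : a x (show TangentSpace (𝓡 3) x from X) = 1 := by
    rw [← ha1 x, hg.reeb_center hf]
  have key : ∀ a b p s : Model 3 →L[ℝ] ℝ, IsDualFrame b p s X Y Z → a X = 1 → a Y = 0 → a Z = 0 →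
      a = b := by
    intro a b p s hf h1 h2 h3
    ext v
    conv_lhs => rw [hf.decomp v]
    simp [h1, h2, h3]
  have hf' := hf
  rw [formInChart_center_eq] at hf'
  exact key _ _ _ _ hf' hX hY hZ

end Comparison

/-! ### Averaging finitely many framings -/

section GermFamily

variable {M : Type*} [TopologicalSpace M] [ChartedSpace (Model 3) M] [IsManifold (𝓡 3) ∞ M]
variable {μ : ℝ} {α : OneForm M} {ι : M → Type*} [∀ y, Fintype (ι y)]
  {r : ∀ y, ι y → TangentSpace (𝓡 3) y → ℂ}

/-- Locally, the functions `r y i` are the squares of finitely many framings of `α`. -/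
def IsGermFamily (μ : ℝ) (α : OneForm M) (r : ∀ y, ι y → TangentSpace (𝓡 3) y → ℂ) : Prop :=
  ∀ y₀, ∃ p s : ι y₀ → Model 3 → Model 3 →L[ℝ] ℝ,
    (∀ i, AnosovGerm μ (formInChart α y₀) (p i) (s i) (extChartAt (𝓡 3) y₀ y₀)) ∧
    ∀ᶠ u in 𝓝 (extChartAt (𝓡 3) y₀ y₀), ∃ e : ι y₀ ≃ ι (chartInv y₀ u), ∀ i v,
      r (chartInv y₀ u) (e i) (chartInvDeriv y₀ u v) =
        ((p i u v : ℂ) + s i u v * Complex.I) ^ 2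

lemma IsGermFamily.swap (h : IsGermFamily μ α r) :
    IsGermFamily (-μ) α (fun y i v => -r y i v) := by
  intro y₀
  obtain ⟨p, s, hg, hr⟩ := h y₀
  refine ⟨s, fun i u => -p i u, fun i => (hg i).swap, ?_⟩
  filter_upwards [hr] with u ⟨e, he⟩
  refine ⟨e, fun i v => ?_⟩
  rw [he, neg_sq_add_mul_I, neg_apply]

lemma IsGermFamily.isSqCoframe (h : IsGermFamily μ α r) (y : M) (i : ι y) :
    IsSqCoframe (show Model 3 →L[ℝ] ℝ from α y) (r y i) := by
  obtain ⟨p, s, hg, hr⟩ := h y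
  set c := extChartAt (𝓡 3) y y
  obtain ⟨e, he⟩ := hr.self_of_nhds
  have key : ∀ z (hz : z = y) (D : Model 3 → TangentSpace (𝓡 3) z) (_ : ∀ v, (D v : Model 3) = v)
      (e : ι y ≃ ι z) (_ : ∀ i v, r z (e i) (D v) = ((p i c v : ℂ) + s i c v * Complex.I) ^ 2),
      ∃ j, ∀ v, r y i v = ((p j c v : ℂ) + s j c v * Complex.I) ^ 2 := by
    rintro z rfl D hD e he
    refine ⟨e.symm i, fun v => Eq.trans ?_ (he (e.symm i) v)⟩
    rw [e.apply_symm_apply]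
    exact congrArg (r z i) (hD v).symm
  obtain ⟨j, hj⟩ := key _ (chartInv_center y) _ (chartInvDeriv_center y) e he
  have hc := (hg j).coframe
  rw [formInChart_center_eq] at hc
  exact ⟨_, _, hc, hj⟩

/-- Two framings of the same form have the same Reeb vector. -/
lemma IsDualFrame.reeb_of_eq {b p s p' s' : Model 3 →L[ℝ] ℝ} {X Y Z X' Y' Z' : Model 3}
    (h : IsDualFrame b p s X Y Z) (h' : IsDualFrame b p' s' X' Y' Z')
    (hd : ∀ v w, p v * s w - p w * s v = p' v * s' w - p' w * s' v) : p X' = 0 ∧ s X' = 0 := by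
  have h1 := hd X' Y
  have h2 := hd X' Z
  rw [h'.pX, h'.sX, h.pY, h.sY] at h1
  rw [h'.pX, h'.sX, h.pZ, h.sZ] at h2
  constructor <;> linarith

/-- The expanded covector of one framing kills the contracted direction of every other. Indeed
p_i(Z_j) satisfies X(p_i(Z_j)) = 2μ p_i(Z_j), and the sum of its squares over all i and j is
insensitive to the labelling and the signs, so the maximum principle applies. -/
lemma IsGermFamily.sqRe_eq_zero [CompactSpace M] (hμ : μ ≠ 0) (h : IsGermFamily μ α r) {y : M}
    (i j : ι y) {v : Model 3} (hv : α y (show TangentSpace (𝓡 3) y from v) = 0)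
    (hv' : r y j v = -1) : sqRe (r y i v) = 0 := by
  choose Z hZ1 hZ2 using fun y i => (h.isSqCoframe y i).swap.exists_unit
  have huniq : ∀ (y : M) (k j : ι y) (v : Model 3), α y (show TangentSpace (𝓡 3) y from v) = 0 →
      r y j v = -1 → r y k v = r y k (Z y j) := fun y k j v h1 h2 => by
    rcases (h.isSqCoframe y j).swap.unit_unique (hZ1 y j) (hZ2 y j) h1 (by
      show -r y j v = 1
      rw [h2, neg_neg]) with he | he
    · rw [he]
    · exact (congrArg (r y k) he).trans ((h.isSqCoframe y k).even _)
  have hnn : ∀ q : ℂ, 0 ≤ sqRe q := fun q => by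
    have := Complex.abs_re_le_norm q
    have := neg_abs_le q.re
    unfold sqRe; linarith
  have hG : ∀ y, ∑ i, ∑ j, sqRe (r y i (Z y j)) = 0 := by
    -- Squaring doubles the rate 2μ of p_i(Z_j).
    refine eq_zero_of_growth (fun y => Finset.sum_nonneg fun i _ => Finset.sum_nonneg fun j _ =>
      hnn _) (k := 4 * μ) (by simpa using hμ) fun y => ?_
    obtain ⟨p, s, hg, hr⟩ := h y
    choose X Y Z' hX hY hZ hf using fun i => (hg i).exists_frame
    set c := extChartAt (𝓡 3) y y
    have hf' := eventually_all.2 hf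
    have hdb := eventually_all.2 fun i => (hg i).db
    have hXp : ∀ᶠ u in 𝓝 c, ∀ i j, p i u (X j u) = 0 ∧ s i u (X j u) = 0 := by
      filter_upwards [hf', hdb] with u hu hd i j
      exact (hu i).reeb_of_eq (hu j) fun v w => by linarith [hd i v w, hd j v w]
    have hXe : ∀ i j, X i c = X j c := fun i j => by
      have h1 := hf'.self_of_nhds i
      have h2 := hf'.self_of_nhds j
      have h3 := hXp.self_of_nhds i j
      rw [h1.decomp (X j c), h2.bX, h3.1, h3.2]; simp
    have hterm : ∀ i j, DifferentiableAt ℝ (fun u => p i u (Z' j u)) c ∧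
        fderiv ℝ (fun u => p i u (Z' j u)) c (X j c) = 2 * μ * p i c (Z' j c) := fun i j => by
      refine ⟨((hg i).smooth_p.clm_apply (hZ j)).differentiableAt_infty, ?_⟩
      have h1 := ((hg j).coeff_deriv (hY j) (hZ j) (hf j) (hg i).smooth_p (k := 0)
        (hXp.mono fun u hu => (hu i j).1)).self_of_nhds.2
      rw [h1, (hg i).dp.self_of_nhds _ _ (hf j).self_of_nhds.bX (hXp.self_of_nhds i j).1
        (hXp.self_of_nhds i j).2]
      ring
    by_cases hne : Nonempty (ι y)
    swap
    · have hem : IsEmpty (ι y) := not_nonempty_iff.1 hne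
      refine ⟨fun _ => 0, 0, differentiableAt_const _, ?_, by simp⟩
      filter_upwards [hr] with u ⟨e, he⟩
      have : IsEmpty (ι (chartInv y u)) := e.symm.isEmpty
      simp
    obtain ⟨k⟩ := hne
    have hder : HasFDerivAt (fun u => ∑ i, ∑ j, (p i u (Z' j u)) ^ 2) _ c :=
      HasFDerivAt.fun_sum fun i _ => HasFDerivAt.fun_sum fun j _ =>
        ((hterm i j).1.hasFDerivAt.pow 2)
    refine ⟨fun u => ∑ i, ∑ j, (p i u (Z' j u)) ^ 2, X k c, hder.differentiableAt, ?_, ?_⟩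
    · filter_upwards [hf', hr] with u hu ⟨e, he⟩
      rw [← e.sum_comp]
      refine Finset.sum_congr rfl fun i _ => ?_
      rw [← e.sum_comp]
      refine Finset.sum_congr rfl fun j _ => ?_
      rw [← huniq _ (e i) (e j) (chartInvDeriv y u (Z' j u)) (hu j).bZ (by
        refine (he j (Z' j u)).trans ?_
        rw [(hu j).pZ, (hu j).sZ]; norm_num)]
      exact (congrArg sqRe (he i (Z' j u))).trans (sqRe_sq _ _)
    · rw [hder.fderiv]
      simp only [sum_apply, smul_apply, Finset.mul_sum]
      refine Finset.sum_congr rfl fun i _ => Finset.sum_congr rfl fun j _ => ?_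
      rw [hXe k j, (hterm i j).2]
      simp; ring
  rw [huniq y i j v hv hv']
  have h1 := (Finset.sum_eq_zero_iff_of_nonneg fun i _ => Finset.sum_nonneg fun j _ => hnn _).1
    (hG y) i (Finset.mem_univ _)
  exact (Finset.sum_eq_zero_iff_of_nonneg fun j _ => hnn _).1 h1 j (Finset.mem_univ _)

/-- A family of framings, indexed locally by a finite set, can be averaged to a global one. -/
theorem IsGermFamily.exists_germ [CompactSpace M] [∀ y, Nonempty (ι y)] (hμ : μ ≠ 0)
    (h : IsGermFamily μ α r) : ∃ q, ∀ y, HasGermAt μ α q y := by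
  choose E hE1 hE2 using fun y i => (h.isSqCoframe y i).exists_unit
  have huniq : ∀ (y : M) (k j : ι y) (v : Model 3), α y (show TangentSpace (𝓡 3) y from v) = 0 →
      r y j v = 1 → r y k v = r y k (E y j) := fun y k j v h1 h2 => by
    rcases (h.isSqCoframe y j).unit_unique (hE1 y j) (hE2 y j) h1 h2 with he | he
    · rw [he]
    · exact (congrArg (r y k) he).trans ((h.isSqCoframe y k).even _)
  -- With E_j the vector on which p_j = ±1 and s_j = 0, this is ρ_j = Σ_i p_i(E_j)². Once the p_i
  -- are known to be proportional, ρ_j p_j² = Σ_i p_i² does not depend on j.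
  set ρ : ∀ y, ι y → ℝ := fun y j => ∑ i, sqRe (r y i (E y j)) with hρ
  set i₀ : ∀ y, ι y := fun y => Classical.arbitrary _
  -- The square of the averaged framing (√ρ p, s/√ρ): real part ρp² - s²/ρ, imaginary part 2ps,
  -- which is unchanged. The index `i₀ y` is arbitrary and may jump with y without affecting the
  -- value.
  refine ⟨fun y v => ((ρ y (i₀ y) * sqRe (r y (i₀ y) v) - sqIm (r y (i₀ y) v) / ρ y (i₀ y) : ℝ) : ℂ) +
    ((r y (i₀ y) v).im : ℂ) * Complex.I, fun y => ?_⟩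
  obtain ⟨p, s, hg, hr⟩ := h y
  choose X Y Z hX hY hZ hf using fun i => (hg i).exists_frame
  set c := extChartAt (𝓡 3) y y
  have hf' := eventually_all.2 hf
  have hdb := eventually_all.2 fun i => (hg i).db
  have hXp : ∀ᶠ u in 𝓝 c, ∀ i j, p i u (X j u) = 0 ∧ s i u (X j u) = 0 := by
    filter_upwards [hf', hdb] with u hu hd i j
    exact (hu i).reeb_of_eq (hu j) fun v w => by linarith [hd i v w, hd j v w]
  have hpZ : ∀ᶠ u in 𝓝 c, ∀ i j, p i u (Z j u) = 0 ∧ s i u (Y j u) = 0 := by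
    filter_upwards [hf', hr] with u hu ⟨e, he⟩ i j
    constructor
    · have h1 := h.sqRe_eq_zero hμ (e i) (e j) (v := chartInvDeriv y u (Z j u)) (hu j).bZ (by
        refine (he j (Z j u)).trans ?_
        rw [(hu j).pZ, (hu j).sZ]; norm_num)
      have h2 := ((congrArg sqRe (he i (Z j u))).trans (sqRe_sq _ _)).symm.trans h1
      simpa using h2
    · have h1 := h.swap.sqRe_eq_zero (neg_ne_zero.2 hμ) (e i) (e j)
        (v := chartInvDeriv y u (Y j u)) (hu j).bY (by
        refine (congrArg Neg.neg (he j (Y j u))).trans ?_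
        rw [(hu j).pY, (hu j).sY]; norm_num)
      have h3 := (congrArg Neg.neg (he i (Y j u))).trans (neg_sq_add_mul_I _ _)
      have h2 := ((congrArg sqRe h3).trans (sqRe_sq _ _)).symm.trans h1
      simpa using h2
  set k : ι y := i₀ y
  -- The expansion of p_i and the contraction of Y_k cancel, so the scaling factor is constant along
  -- the flow, as `AnosovGerm.rescale` requires.
  have hterm : ∀ᶠ u in 𝓝 c, ∀ i, fderiv ℝ (fun u => p i u (Y k u)) u (X k u) = 0 := by
    refine eventually_all.2 fun i => ?_
    filter_upwards [(hg k).coeff_deriv (hY k) (hZ k) (hf k) (hg i).smooth_p (k := 0)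
      (hXp.mono fun u hu => (hu i k).1), (hg i).dp, hf k, hXp] with u h1 h2 h3 h4
    rw [h1.1, h2 _ _ h3.bX (h4 i k).1 (h4 i k).2]
    ring
  have hsm : ∀ i, ContDiffAt ℝ ∞ (fun u => p i u (Y k u)) c := fun i =>
    (hg i).smooth_p.clm_apply (hY k)
  set σ : Model 3 → ℝ := fun u => ∑ i, (p i u (Y k u)) ^ 2 with hσ
  have hσs : ContDiffAt ℝ ∞ σ c := ContDiffAt.sum fun i _ => (hsm i).pow 2
  have hσ1 : ∀ᶠ u in 𝓝 c, 1 ≤ σ u := by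
    filter_upwards [hf k] with u hu
    have := Finset.single_le_sum (f := fun i => (p i u (Y k u)) ^ 2) (fun i _ => sq_nonneg _)
      (Finset.mem_univ k)
    rw [hu.pY, one_pow] at this
    exact this
  have hσX : ∀ᶠ u in 𝓝 c, fderiv ℝ σ u (X k u) = 0 := by
    filter_upwards [hterm, eventually_all.2 fun i => (hsm i).eventually_differentiableAt]
      with u hu hd
    have hder : HasFDerivAt σ _ u := HasFDerivAt.fun_sum fun i _ => (hd i).hasFDerivAt.pow 2
    rw [hder.fderiv, sum_apply]
    exact Finset.sum_eq_zero fun i _ => by rw [smul_apply, hu i, smul_zero]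
  have hsq : ContDiffAt ℝ ∞ (fun u => Real.sqrt (σ u)) c :=
    hσs.sqrt (by have := hσ1.self_of_nhds; linarith)
  refine ⟨_, _, (hg k).rescale hsq (Real.sqrt_ne_zero'.2 (by
    have := hσ1.self_of_nhds; linarith)) ?_, ?_⟩
  · filter_upwards [hσX, hσ1, hf k, hσs.eventually_differentiableAt] with u h1 h2 h3 h4 V h5 h6 h7
    have hV : V = X k u := by rw [h3.decomp V, h5, h6, h7]; simp
    rw [hV, (h4.hasFDerivAt.sqrt (by linarith)).fderiv, smul_apply, h1, smul_zero]
  · filter_upwards [hf', hr, hpZ, hdb, hXp, hσ1] with u hu ⟨e, he⟩ hz hd hx hs1 v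
    obtain ⟨j, hj⟩ := e.surjective (i₀ (chartInv y u))
    have hρj : ρ (chartInv y u) (i₀ (chartInv y u)) = ∑ i, (p i u (Y j u)) ^ 2 := by
      rw [hρ, ← hj]
      simp only
      rw [← e.sum_comp]
      refine Finset.sum_congr rfl fun i _ => ?_
      rw [← huniq _ (e i) (e j) (chartInvDeriv y u (Y j u)) (hu j).bY (by
        refine (he j (Y j u)).trans ?_
        rw [(hu j).pY, (hu j).sY]; norm_num)]
      exact (congrArg sqRe (he i (Y j u))).trans (sqRe_sq _ _)
    have hp : ∀ i w, p i u w = p i u (Y k u) * p k u w := fun i w => by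
      conv_lhs => rw [(hu k).decomp w]
      simp only [map_add, map_smul, smul_eq_mul, (hx i k).1, (hz i k).1]; ring
    have hs : s j u v = s j u (Z k u) * s k u v := by
      conv_lhs => rw [(hu k).decomp v]
      simp only [map_add, map_smul, smul_eq_mul, (hx j k).2, (hz j k).2]; ring
    set f := p j u (Y k u)
    set g := s j u (Z k u)
    set t := p k u (Y j u)
    have hfg : f * g = 1 := by
      have h1 := (hd j (Y k u) (Z k u)).symm.trans (hd k (Y k u) (Z k u))
      rw [(hu k).pY, (hu k).sZ, (hz j k).1, (hu k).pZ] at h1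
      linarith
    have hft : f * t = 1 := by rw [← (hu j).pY]; exact (hp j _).symm
    have hρσ : ∑ i, (p i u (Y j u)) ^ 2 = σ u * t ^ 2 := by
      rw [hσ, Finset.sum_mul]
      exact Finset.sum_congr rfl fun i _ => by rw [hp i (Y j u)]; ring
    have hr' : r (chartInv y u) (i₀ (chartInv y u)) (chartInvDeriv y u v) =
        ((p j u v : ℂ) + s j u v * Complex.I) ^ 2 := by
      rw [← hj]; exact he j v
    have hf0 : f ≠ 0 := left_ne_zero_of_mul_eq_one hft
    have hg' : g = f⁻¹ := eq_inv_of_mul_eq_one_right hfg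
    have ht' : t = f⁻¹ := eq_inv_of_mul_eq_one_right hft
    have hσ0 : σ u ≠ 0 := by linarith
    have hsq2 : Real.sqrt (σ u) ^ 2 = σ u := Real.sq_sqrt (by linarith)
    have hsq0 : Real.sqrt (σ u) ≠ 0 := Real.sqrt_ne_zero'.2 (by linarith)
    simp only [funInChart]
    rw [hr', sqRe_sq, sqIm_sq, im_sq_add_mul_I, hρj, hρσ, hp j v, hs, hg', ht']
    simp only [smul_apply, smul_eq_mul]
    apply Complex.ext
    · rw [re_sq_add_mul_I]
      simp only [Complex.add_re, Complex.ofReal_re, Complex.mul_re, Complex.I_re, Complex.I_im,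
        Complex.ofReal_im, mul_pow, inv_pow, hsq2]
      field_simp
      ring
    · rw [im_sq_add_mul_I]
      simp only [Complex.add_im, Complex.ofReal_im, Complex.mul_im, Complex.I_re, Complex.I_im,
        Complex.ofReal_re]
      field_simp
      ring

end GermFamily

/-! ### Reeb vectors, pullbacks and descent along coverings -/

section ReebSpec

/-- A nondegenerate pair of a covector and an alternating form on `ℝ³` has a Reeb vector. -/
lemma exists_reeb_vector {a : Model 3 →L[ℝ] ℝ} {d : Model 3 → Model 3 → ℝ}
    (hsw : ∀ v w, d w v = -d v w) (hadd : ∀ v v' w, d (v + v') w = d v w + d v' w)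
    (hsmul : ∀ (c : ℝ) v w, d (c • v) w = c * d v w) {u v w : Model 3}
    (h : a u * d v w - a v * d u w + a w * d u v ≠ 0) : ∃ r, a r = 1 ∧ ∀ z, d r z = 0 := by
  have hself : ∀ v, d v v = 0 := fun v => by linarith [hsw v v]
  have hadd' : ∀ w v v', d w (v + v') = d w v + d w v' := fun w v v' => by
    rw [hsw, hadd, hsw w v, hsw w v']; ring
  have hsmul' : ∀ w (c : ℝ) v, d w (c • v) = c * d w v := fun w c v => by
    rw [hsw, hsmul, hsw w v]; ring
  have hli : LinearIndependent ℝ ![u, v, w] := by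
    rw [Fintype.linearIndependent_iff]
    intro c hc
    have hc' : c 0 • u + c 1 • v + c 2 • w = 0 := by simpa [Fin.sum_univ_three] using hc
    have ha0 : c 0 * a u + c 1 * a v + c 2 * a w = 0 := by
      have := congrArg a hc'
      simpa using this
    have hd0 : ∀ z, c 0 * d u z + c 1 * d v z + c 2 * d w z = 0 := fun z => by
      rw [← hsmul, ← hsmul, ← hsmul, ← hadd, ← hadd, hc', ← zero_smul ℝ (0 : Model 3), hsmul,
        zero_mul]
    have e1 := hd0 u
    have e2 := hd0 v
    have e3 := hd0 w
    rw [hself] at e1 e2 e3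
    rw [hsw u v, hsw u w] at e1
    rw [hsw v w] at e2
    have k : ∀ i, c i = 0 := by
      intro i
      fin_cases i
      · exact (mul_eq_zero.1 (show c 0 * (a u * d v w - a v * d u w + a w * d u v) = 0 by
          linear_combination d v w * ha0 + a w * e2 - a v * e3)).resolve_right h
      · exact (mul_eq_zero.1 (show c 1 * (a u * d v w - a v * d u w + a w * d u v) = 0 by
          linear_combination (-d u w) * ha0 - a w * e1 + a u * e3)).resolve_right h
      · exact (mul_eq_zero.1 (show c 2 * (a u * d v w - a v * d u w + a w * d u v) = 0 by
          linear_combination (d u v) * ha0 + a v * e1 - a u * e2)).resolve_right h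
    exact k
  set D := a u * d v w - a v * d u w + a w * d u v
  -- The kernel vector of an alternating form on a 3-space. Evaluating a on it gives the nonzero
  -- number D.
  set r := d v w • u + (-d u w) • v + d u v • w with hr
  have hdr : ∀ z, d r z = 0 := fun z => by
    have hspan : z ∈ Submodule.span ℝ (range ![u, v, w]) := by
      rw [hli.span_eq_top_of_card_eq_finrank (by simp)]; trivial
    induction hspan using Submodule.span_induction with
    | mem z hz =>
      obtain ⟨i, rfl⟩ := hz
      rw [hr, hadd, hadd, hsmul, hsmul, hsmul]
      fin_cases i
      · simp [hself, hsw u v, hsw u w]; ring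
      · simp [hself, hsw v w]; ring
      · simp [hself]; ring
    | zero => rw [← zero_smul ℝ (0 : Model 3), hsmul', zero_mul]
    | add z z' _ _ h1 h2 => rw [hadd', h1, h2, add_zero]
    | smul c z _ h1 => rw [hsmul', h1, mul_zero]
  have har : a r = D := by
    simp only [hr, map_add, map_smul, smul_eq_mul]
    ring
  refine ⟨D⁻¹ • r, ?_, fun z => ?_⟩
  · rw [map_smul, har, smul_eq_mul, inv_mul_cancel₀ h]
  · rw [hsmul, hdr, mul_zero]

variable {M : Type*} [TopologicalSpace M] [ChartedSpace (Model 3) M] [IsManifold (𝓡 3) ∞ M]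
variable {N : Type*} [TopologicalSpace N] [ChartedSpace (Model 3) N] [IsManifold (𝓡 3) ∞ N]
variable {α : OneForm M}

lemma IsContactForm.contDiffAt (h : IsContactForm α) (x : M) :
    ContDiffAt ℝ ∞ (formInChart α x) (extChartAt (𝓡 3) x x) :=
  (contMDiffAt_form_iff α x).1 (h.smooth x)

lemma IsContactForm.reeb_spec (h : IsContactForm α) (x : M) :
    α x (reeb α x) = 1 ∧ ∀ w, dForm α x (reeb α x) w = 0 := by
  obtain ⟨u, v, w, hn⟩ := h.nondegenerate x
  obtain ⟨r, h1, h2⟩ := exists_reeb_vector (a := (show Model 3 →L[ℝ] ℝ from α x))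
    (d := extD (formInChart α x) (extChartAt (𝓡 3) x x)) (fun v w => extD_swap _ _ _ _)
    (fun _ _ _ => extD_add_left _ _ _ _ _) (fun _ _ _ => extD_smul_left _ _ _ _ _) hn
  exact Classical.epsilon_spec (p := fun v => α x v = 1 ∧ ∀ w, dForm α x v w = 0) ⟨r, h1, h2⟩

lemma contDiffAt_pullBack {f : N → M} {z : N}
    (hα : ContDiffAt ℝ ∞ (formInChart α (f z)) (extChartAt (𝓡 3) (f z) (f z)))
    (hf : ContMDiffAt (𝓡 3) (𝓡 3) ∞ f z) :
    ContDiffAt ℝ ∞ (formInChart (pullBack f α) z) (extChartAt (𝓡 3) z z) := by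
  have hs := mem_extChartAt_source (I := 𝓡 3) (f z)
  have hc : chartRep 3 3 f z (f z) (extChartAt (𝓡 3) z z) = extChartAt (𝓡 3) (f z) (f z) := by
    rw [chartRep, chartInv_center]
  exact (ContDiffAt.pullForm (by rwa [hc]) (contDiffAt_chartRep hf hs)
    (by simp)).congr_of_eventuallyEq (formInChart_pullBack α hf hs)

lemma dForm_pullBack {f : N → M} {z : N}
    (hα : ContDiffAt ℝ ∞ (formInChart α (f z)) (extChartAt (𝓡 3) (f z) (f z)))
    (hf : ContMDiffAt (𝓡 3) (𝓡 3) ∞ f z) (v w : TangentSpace (𝓡 3) z) :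
    dForm (pullBack f α) z v w =
      dForm α (f z) (mfderiv (𝓡 3) (𝓡 3) f z v) (mfderiv (𝓡 3) (𝓡 3) f z w) := by
  have hs := mem_extChartAt_source (I := 𝓡 3) (f z)
  have hc : chartRep 3 3 f z (f z) (extChartAt (𝓡 3) z z) = extChartAt (𝓡 3) (f z) (f z) := by
    rw [chartRep, chartInv_center]
  refine (extD_congr (formInChart_pullBack α hf hs) _ _).trans ?_
  refine (extD_pullForm (by rw [hc]; exact hα.differentiableAt_infty)
    ((contDiffAt_chartRep hf hs).of_le
    (WithTop.coe_le_coe.2 (le_top : (2 : ℕ∞) ≤ ⊤))) _ _).trans ?_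
  refine (congrArg₂ (extD (formInChart α (f z)) _) (fderiv_chartRep_center hf v)
    (fderiv_chartRep_center hf w)).trans ?_
  rw [hc]; rfl

end ReebSpec

section Covering

variable {M : Type*} [TopologicalSpace M] [ChartedSpace (Model 3) M] [IsManifold (𝓡 3) ∞ M]
variable {N : Type*} [TopologicalSpace N] [ChartedSpace (Model 3) N] [IsManifold (𝓡 3) ∞ N]

lemma IsLocalDiffeomorph.injective_mfderiv {p : N → M}
    (hp : IsLocalDiffeomorph (𝓡 3) (𝓡 3) ∞ p) (z : N) :
    Function.Injective (mfderiv (𝓡 3) (𝓡 3) p z) := by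
  have h := (hp.mfderivToContinuousLinearEquiv (by simp) z).injective
  exact h

/-- Local sections of a smooth covering. -/
lemma IsFiniteSmoothCovering.exists_sections {p : N → M} (hp : IsFiniteSmoothCovering p) (y₀ : M) :
    ∃ σ : p ⁻¹' {y₀} → M → N, (∀ i, ContMDiffAt (𝓡 3) (𝓡 3) ∞ (σ i) y₀) ∧
      ∀ᶠ y in 𝓝 y₀, (∀ i, p (σ i y) = y) ∧ Function.Injective (fun i => σ i y) ∧
        ∀ z, p z = y → ∃ i, σ i y = z := by
  classical
  obtain ⟨-, U, hyU, hU, -, H, hH⟩ := hp.covering y₀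
  set σ : p ⁻¹' {y₀} → M → N := fun i y => if hy : y ∈ U then H.symm (⟨y, hy⟩, i) else
    H.symm (⟨y₀, hyU⟩, i)
  have hσ : ∀ i y (hy : y ∈ U), σ i y = H.symm (⟨y, hy⟩, i) := fun i y hy => dif_pos hy
  have hp' : ∀ y ∈ U, ∀ i, p (σ i y) = y := fun y hy i => by
    rw [hσ i y hy, ← hH]; simp
  refine ⟨σ, fun i => ?_, ?_⟩
  · have hcont : ContinuousAt (σ i) y₀ := by
      have h1 : ContinuousOn (σ i) U := by
        rw [continuousOn_iff_continuous_domRestrict]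
        have : U.domRestrict (σ i) = fun y : U => ((H.symm (y, i) : p ⁻¹' U) : N) := by
          funext y; exact hσ i y y.2
        rw [this]
        fun_prop
      exact h1.continuousAt (hU.mem_nhds hyU)
    -- A continuous section of a local diffeomorphism coincides locally with its inverse, hence is
    -- smooth.
    have hd := hp.localDiffeo (σ i y₀)
    have hy₀ : p (σ i y₀) = y₀ := hp' y₀ hyU i
    have h2 := hd.localInverse_contMDiffAt
    rw [hy₀] at h2
    refine h2.congr_of_eventuallyEq ?_
    filter_upwards [hcont.eventually (hd.localInverse.open_target.mem_nhds
      hd.localInverse_mem_target), hU.mem_nhds hyU] with y h3 h4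
    have := hd.localInverse_left_inv h3
    rw [hp' y h4 i] at this
    exact this.symm
  · filter_upwards [hU.mem_nhds hyU] with y hy
    refine ⟨hp' y hy, fun i j hij => ?_, fun z hz => ?_⟩
    · have h1 : H.symm (⟨y, hy⟩, i) = H.symm (⟨y, hy⟩, j) :=
        Subtype.ext (by rw [← hσ i y hy, ← hσ j y hy]; exact hij)
      exact congrArg Prod.snd (H.symm.injective h1)
    · have hzU : z ∈ p ⁻¹' U := by rw [mem_preimage, hz]; exact hy
      refine ⟨(H ⟨z, hzU⟩).2, ?_⟩
      rw [hσ _ y hy]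
      have : H.symm (⟨y, hy⟩, (H ⟨z, hzU⟩).2) = ⟨z, hzU⟩ := by
        rw [H.symm_apply_eq]
        exact Prod.ext (Subtype.ext (by rw [hH]; exact hz.symm)) rfl
      rw [this]

variable {μ : ℝ} {α : OneForm M}

lemma formInChart_congr {a b : OneForm M} {x : M} (h : ∀ᶠ y in 𝓝 x, a y = b y) :
    formInChart a x =ᶠ[𝓝 (extChartAt (𝓡 3) x x)] formInChart b x := by
  have hc := continuousAt_chartInv (n := 3) (mem_extChartAt_target (I := 𝓡 3) x)
  have h' : ∀ᶠ y in 𝓝 (chartInv (n := 3) x (extChartAt (𝓡 3) x x)), a y = b y := by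
    rwa [chartInv_center]
  filter_upwards [hc.eventually h'] with u hu
  simp only [formInChart, hu]

lemma mfderiv_section {p : N → M} {σ : M → N} {y : M} (hp : ContMDiffAt (𝓡 3) (𝓡 3) ∞ p (σ y))
    (hσ : MDifferentiableAt (𝓡 3) (𝓡 3) σ y) (h : ∀ᶠ y in 𝓝 y, p (σ y) = y)
    (v : TangentSpace (𝓡 3) y) :
    (mfderiv (𝓡 3) (𝓡 3) p (σ y) (mfderiv (𝓡 3) (𝓡 3) σ y v) : Model 3) = v := by
  have h1 := mfderiv_comp (I := 𝓡 3) (I' := 𝓡 3) (I'' := 𝓡 3) (g := p) y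
    (hp.mdifferentiableAt (by simp)) hσ
  have h2 : mfderiv (𝓡 3) (𝓡 3) (p ∘ σ) y = mfderiv (𝓡 3) (𝓡 3) id y :=
    Filter.EventuallyEq.mfderiv_eq (h : p ∘ σ =ᶠ[𝓝 y] id)
  have h3 : ∀ v : Model 3, (mfderiv (𝓡 3) (𝓡 3) (p ∘ σ) y v : Model 3) = v := fun v => by
    rw [h2, mfderiv_id]; rfl
  have h4 := h3 v
  rw [h1] at h4
  exact h4

/-- Pulling back by the local sections gives one framing of α per sheet. These need not agree, since
q is not assumed invariant under deck transformations, and so they are averaged. -/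
theorem IsFiniteSmoothCovering.exists_germ [CompactSpace M] {p : N → M}
    (hp : IsFiniteSmoothCovering p) (hμ : μ ≠ 0) {Q : ∀ z : N, TangentSpace (𝓡 3) z → ℂ}
    (h : ∀ z, HasGermAt μ (pullBack p α) Q z) : ∃ q, ∀ y, HasGermAt μ α q y := by
  let ι : M → Type _ := fun y => (p ⁻¹' {y} : Set N)
  have : ∀ y, Fintype (ι y) := fun y => (hp.finite_fibers y).fintype
  have : ∀ y, Nonempty (ι y) := fun y => let ⟨z, hz⟩ := hp.surjective y; ⟨⟨z, hz⟩⟩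
  -- A tangent vector at y is lifted to z by inverting the differential of p; `Function.invFun` is a
  -- left inverse of it by injectivity.
  let r : ∀ y, ι y → TangentSpace (𝓡 3) y → ℂ := fun y z v => Q z.1
    (Function.invFun (fun w : Model 3 => (mfderiv (𝓡 3) (𝓡 3) p z.1
      (show TangentSpace (𝓡 3) z.1 from w) : Model 3)) (show Model 3 from v))
  have hr : ∀ y (z : ι y) (v : Model 3) (w : Model 3),
      (mfderiv (𝓡 3) (𝓡 3) p z.1 (show TangentSpace (𝓡 3) z.1 from w) : Model 3) = v →
      r y z v = Q z.1 w := fun y z v w hv => by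
    have hinv : Function.invFun (fun w : Model 3 => (mfderiv (𝓡 3) (𝓡 3) p z.1
      (show TangentSpace (𝓡 3) z.1 from w) : Model 3)) v = w := by
      rw [← hv]
      exact Function.leftInverse_invFun (hp.localDiffeo.injective_mfderiv z.1) w
    exact congrArg (Q z.1) hinv
  have hsm : ∀ z, ContMDiffAt (𝓡 3) (𝓡 3) ∞ p z := fun z => (hp.localDiffeo z).contMDiffAt
  refine IsGermFamily.exists_germ (ι := ι) (r := r) hμ fun y₀ => ?_
  obtain ⟨σ, hσ, hσ'⟩ := hp.exists_sections y₀
  have hmd : ∀ᶠ y in 𝓝 y₀, ∀ i : ι y₀, MDifferentiableAt (𝓡 3) (𝓡 3) (σ i) y :=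
    eventually_all.2 fun i => by
      have h1 : ContMDiffAt (𝓡 3) (𝓡 3) 1 (σ i) y₀ := (hσ i).of_le (by simp)
      filter_upwards [(contMDiffAt_iff_contMDiffAt_nhds (by simp)).1 h1] with y hy
      exact hy.mdifferentiableAt (by simp)
  have hsec : ∀ᶠ y in 𝓝 y₀, ∀ (i : ι y₀) (v : Model 3),
      (mfderiv (𝓡 3) (𝓡 3) p (σ i y) (mfderiv (𝓡 3) (𝓡 3) (σ i) y
        (show TangentSpace (𝓡 3) y from v)) : Model 3) = v := by
    filter_upwards [hmd, hσ'.eventually_nhds] with y h1 h2 i v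
    exact mfderiv_section (hsm _) (h1 i) (h2.mono fun y hy => hy.1 i) v
  have hgerm : ∀ i : ι y₀, HasGermAt μ (pullBack (σ i) (pullBack p α)) (pullTangentFun (σ i) Q) y₀ :=
    fun i => (h (σ i y₀)).pullBack (hσ i) fun v w hvw => by
      have h1 := hsec.self_of_nhds i v
      have h2 := hsec.self_of_nhds i w
      rw [← show (v : Model 3) = w from h1.symm.trans ((congrArg (fun t => (mfderiv (𝓡 3) (𝓡 3) p
        (σ i y₀) t : Model 3)) hvw).trans h2)]
  have hform : ∀ i : ι y₀, ∀ᶠ y in 𝓝 y₀, α y = pullBack (σ i) (pullBack p α) y := fun i => by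
    filter_upwards [hsec, hσ'] with y h1 h2
    ext v
    exact (apply_congr_point (fun x v => α x v) (h2.1 i) (h1 i v)).symm
  choose P S hPS hq using hgerm
  refine ⟨P, S, fun i => (hPS i).congr (formInChart_congr (hform i)), ?_⟩
  have hc := continuousAt_chartInv (n := 3) (mem_extChartAt_target (I := 𝓡 3) y₀)
  have hcen := chartInv_center (n := 3) y₀
  rw [ContinuousAt, hcen] at hc
  filter_upwards [hc.eventually hsec, hc.eventually hσ', eventually_all.2 hq] with u h1 h2 h3
  refine ⟨Equiv.ofBijective (fun i => (⟨σ i (chartInv y₀ u), h2.1 i⟩ : ι (chartInv y₀ u)))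
    ⟨fun i j hij => h2.2.1 (congrArg Subtype.val hij), fun z => ?_⟩, fun i v => ?_⟩
  · obtain ⟨i, hi⟩ := h2.2.2 z.1 z.2
    exact ⟨i, Subtype.ext hi⟩
  · refine (hr _ _ _ _ (h1 i (chartInvDeriv y₀ u v))).trans ?_
    exact h3 i v

end Covering

/-! ### Anosov germs on algebraic Anosov manifolds -/

section Algebraic

universe u

variable {M : Type u} [TopologicalSpace M] [ChartedSpace (Model 3) M] [IsManifold (𝓡 3) ∞ M]
  [CompactSpace M] {α : OneForm M}

/-- The conjugacy concerns only the flows. On the common covering the two contact forms have the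
same Reeb field and are therefore equal by rigidity, so the germs of the unit tangent bundle are
germs of α. -/
theorem IsAlgebraicAnosov.exists_germ (hα : IsContactForm α) (h : IsAlgebraicAnosov α) :
    ∃ μ, 0 < μ ∧ ∃ q, ∀ y, HasGermAt μ α q y := by
  obtain ⟨S, _, _, _, _, _, _, g, K, _, _, hK, hcurv, hsub, N, _, _, _, _, _, _, p, f, Y, hp, hf,
    hpY, hfY⟩ := h
  obtain ⟨qU, hqU⟩ := exists_germ_canonicalForm hsub hK hcurv
  have hμ : 0 < Real.sqrt (-K) := Real.sqrt_pos.2 (by linarith)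
  refine ⟨_, hμ, ?_⟩
  have hβ := isContactForm_of_germ hqU
  have hb : ∀ z, HasGermAt (Real.sqrt (-K)) (pullBack f (canonicalForm g)) (pullTangentFun f qU) z :=
    fun z => (hqU (f z)).pullBack (hf.localDiffeo z).contMDiffAt (hf.localDiffeo.injective_mfderiv z)
  have hbY : ∀ z, reeb (pullBack f (canonicalForm g)) z = Y z := fun z => by
    obtain ⟨P, S, hg, -⟩ := hb z
    refine hg.reeb_eq ?_ fun w => ?_
    · exact (congrArg (canonicalForm g (f z)) (hfY z)).trans (hβ.reeb_spec (f z)).1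
    · rw [dForm_pullBack (hβ.contDiffAt _) (hf.localDiffeo z).contMDiffAt, hfY]
      exact (hβ.reeb_spec (f z)).2 _
  have heq : pullBack p α = pullBack f (canonicalForm g) := by
    refine form_eq_of_reeb hμ.ne' hb (fun z => contDiffAt_pullBack (hα.contDiffAt _)
      (hp.localDiffeo z).contMDiffAt) (fun z => ?_) fun z w => ?_
    · rw [hbY]
      exact (congrArg (α (p z)) (hpY z)).trans (hα.reeb_spec (p z)).1
    · rw [hbY, dForm_pullBack (hα.contDiffAt _) (hp.localDiffeo z).contMDiffAt, hpY]
      exact (hα.reeb_spec (p z)).2 _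
  exact hp.exists_germ hμ.ne' (Q := pullTangentFun f qU) fun z => heq ▸ hb z

end Algebraic

/-! ### Quadratic forms of differences near the diagonal -/

section Asymptotics

variable {E G : Type*} [NormedAddCommGroup E] [NormedSpace ℝ E] [NormedAddCommGroup G]
  [NormedSpace ℝ G]

lemma isBigO_bilin {ι : Type*} {l : Filter ι} (β : ι → G →L[ℝ] G →L[ℝ] ℝ) (a b : ι → G) :
    (fun i => β i (a i) (b i)) =O[l] fun i => ‖β i‖ * (‖a i‖ * ‖b i‖) := by
  refine Asymptotics.IsBigO.of_bound 1 (Eventually.of_forall fun i => ?_)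
  have h := (β i).le_opNorm₂ (a i) (b i)
  have h2 : ‖β i‖ * (‖a i‖ * ‖b i‖) ≤ ‖‖β i‖ * (‖a i‖ * ‖b i‖)‖ := Real.le_norm_self _
  linarith

/-- Telescoping: replace the form and then each argument in turn. Each replacement costs o(‖h‖²),
because the vectors are O(‖h‖) and their errors are o(‖h‖). -/
lemma isLittleO_bilin_sub {ι : Type*} {l : Filter ι} {h : ι → E} {β : ι → G →L[ℝ] G →L[ℝ] ℝ}
    {β₀ : G →L[ℝ] G →L[ℝ] ℝ} (hβ : Tendsto β l (𝓝 β₀)) {a a' b b' : ι → G}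
    (ha : (fun i => a i - a' i) =o[l] h) (ha' : a' =O[l] h)
    (hb : (fun i => b i - b' i) =o[l] h) (hb' : b' =O[l] h) :
    (fun i => β i (a i) (b i) - β₀ (a' i) (b' i)) =o[l] fun i => ‖h i‖ ^ 2 := by
  have hA : a =O[l] h := (ha.isBigO.add ha').congr_left fun i => sub_add_cancel _ _
  have hB : b =O[l] h := (hb.isBigO.add hb').congr_left fun i => sub_add_cancel _ _
  have h0 : (fun i => ‖β i - β₀‖) =o[l] (fun _ => (1 : ℝ)) := by
    have e : (fun i => ‖β i - β₀‖) = fun i => dist (β i) β₀ := funext fun i =>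
      (dist_eq_norm (β i) β₀).symm
    rw [e]
    exact (Asymptotics.isLittleO_one_iff ℝ).2 (tendsto_iff_dist_tendsto_zero.1 hβ)
  have hc : (fun _ : ι => ‖β₀‖) =O[l] (fun _ => (1 : ℝ)) := Asymptotics.isBigO_const_const _ one_ne_zero _
  have e1 := (isBigO_bilin (l := l) (fun i => β i - β₀) a b).trans_isLittleO
    (h0.mul_isBigO (hA.norm_norm.mul hB.norm_norm))
  have e2 := (isBigO_bilin (l := l) (fun _ => β₀) (fun i => a i - a' i) b).trans_isLittleO
    (hc.mul_isLittleO (ha.norm_norm.mul_isBigO hB.norm_norm))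
  have e3 := (isBigO_bilin (l := l) (fun _ => β₀) a' (fun i => b i - b' i)).trans_isLittleO
    (hc.mul_isLittleO (ha'.norm_norm.mul_isLittleO hb.norm_norm))
  have e6 : (fun i => ‖h i‖ ^ 2) = fun i => 1 * (‖h i‖ * ‖h i‖) := funext fun i => by ring
  have e7 : (fun i => β i (a i) (b i) - β₀ (a' i) (b' i)) = fun i => (β i - β₀) (a i) (b i) +
      (β₀ (a i - a' i) (b i) + β₀ (a' i) (b i - b' i)) := funext fun i => by
    rw [map_sub β₀ (a i) (a' i), map_sub (β₀ (a' i)) (b i) (b' i), sub_apply, sub_apply, sub_apply]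
    ring
  rw [e6, e7]
  exact e1.add (e2.add e3)

variable {f V : E → G} {c : E} {B Bd : E → G →L[ℝ] G →L[ℝ] ℝ}

/-- Both points move, so strict differentiability is what is needed. -/
lemma HasStrictFDerivAt.isLittleO_diag {f' : E →L[ℝ] G} (hf : HasStrictFDerivAt f f' c) :
    (fun p : E × E => (f p.1 - f p.2) - f' (p.1 - p.2)) =o[𝓝 (c, c)] fun p => p.1 - p.2 :=
  hf.isLittleO

/-- A quadratic form of differences grows along a flow if it does so infinitesimally. -/
lemma eventually_growth_of_pos {f' V' : E →L[ℝ] G} (hf : HasStrictFDerivAt f f' c)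
    (hV : HasStrictFDerivAt V V' c) (hB : ContinuousAt B c) (hBd : ContinuousAt Bd c) {lam κ : ℝ}
    (hκ : 0 < κ) (h : ∀ v, κ * ‖v‖ ^ 2 ≤ Bd c (f' v) (f' v) + B c (V' v) (f' v) +
      B c (f' v) (V' v) - lam * B c (f' v) (f' v)) :
    ∀ᶠ p : E × E in 𝓝 (c, c), lam * B p.1 (f p.1 - f p.2) (f p.1 - f p.2) ≤
      Bd p.1 (f p.1 - f p.2) (f p.1 - f p.2) + B p.1 (V p.1 - V p.2) (f p.1 - f p.2) +
        B p.1 (f p.1 - f p.2) (V p.1 - V p.2) := by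
  have ht : ∀ {B : E → G →L[ℝ] G →L[ℝ] ℝ}, ContinuousAt B c →
      Tendsto (fun p : E × E => B p.1) (𝓝 (c, c)) (𝓝 (B c)) := fun hB =>
    hB.tendsto.comp (continuous_fst.tendsto (c, c))
  have hO : ∀ L : E →L[ℝ] G, (fun p : E × E => L (p.1 - p.2)) =O[𝓝 (c, c)] fun p => p.1 - p.2 :=
    fun L => L.isBigO_comp _ _
  have e1 := isLittleO_bilin_sub (ht hBd) hf.isLittleO_diag (hO f') hf.isLittleO_diag (hO f')
  have e2 := isLittleO_bilin_sub (ht hB) hV.isLittleO_diag (hO V') hf.isLittleO_diag (hO f')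
  have e3 := isLittleO_bilin_sub (ht hB) hf.isLittleO_diag (hO f') hV.isLittleO_diag (hO V')
  have e4 := isLittleO_bilin_sub (ht hB) hf.isLittleO_diag (hO f') hf.isLittleO_diag (hO f')
  -- The infinitesimal inequality has the margin κ‖p.1 - p.2‖², which absorbs the total error o(‖p.1
  -- - p.2‖²).
  filter_upwards [(((e1.add e2).add e3).sub (e4.const_mul_left lam)).bound hκ] with p hp
  have h1 := h (p.1 - p.2)
  rw [Real.norm_eq_abs, Real.norm_eq_abs, abs_of_nonneg (sq_nonneg ‖p.1 - p.2‖)] at hp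
  have h2 := neg_le_of_abs_le hp
  linarith

/-- To second order the quadratic form on a difference tY is at least t²; half of this is given up
to absorb the error. -/
lemma eventually_cone_of_pos {f' : E →L[ℝ] G} (hf : HasStrictFDerivAt f f' c)
    (hB : ContinuousAt B c) {Y : E} (h : 1 ≤ B c (f' Y) (f' Y)) :
    ∀ᶠ p : E × E in 𝓝 (c, c), ∀ t : ℝ, p.1 - p.2 = t • Y →
      t ^ 2 / 2 ≤ B p.1 (f p.1 - f p.2) (f p.1 - f p.2) := by
  have ht : Tendsto (fun p : E × E => B p.1) (𝓝 (c, c)) (𝓝 (B c)) :=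
    hB.tendsto.comp (continuous_fst.tendsto (c, c))
  have hO : (fun p : E × E => f' (p.1 - p.2)) =O[𝓝 (c, c)] fun p => p.1 - p.2 := f'.isBigO_comp _ _
  have e4 := isLittleO_bilin_sub ht hf.isLittleO_diag hO hf.isLittleO_diag hO
  have hk : 0 < 1 / (2 * (‖Y‖ ^ 2 + 1)) := by positivity
  filter_upwards [e4.bound hk] with p hp t hpt
  rw [Real.norm_eq_abs, Real.norm_eq_abs, abs_of_nonneg (sq_nonneg ‖p.1 - p.2‖)] at hp
  have h2 := neg_le_of_abs_le hp
  have h3 : B c (f' (p.1 - p.2)) (f' (p.1 - p.2)) = t ^ 2 * B c (f' Y) (f' Y) := by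
    rw [hpt]; simp; ring
  have h4 : ‖p.1 - p.2‖ ^ 2 = t ^ 2 * ‖Y‖ ^ 2 := by
    rw [hpt, norm_smul, mul_pow, Real.norm_eq_abs, sq_abs]
  have h5 : 1 / (2 * (‖Y‖ ^ 2 + 1)) * ‖p.1 - p.2‖ ^ 2 ≤ t ^ 2 / 2 := by
    rw [h4, div_mul_eq_mul_div, div_le_div_iff₀ (by positivity) (by norm_num)]
    nlinarith [sq_nonneg t, sq_nonneg ‖Y‖]
  have h6 : t ^ 2 ≤ t ^ 2 * B c (f' Y) (f' Y) := le_mul_of_one_le_right (sq_nonneg t) h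
  linarith

/-- Differences of a function are dominated by differences of an immersion. -/
lemma eventually_norm_sub_le_of_injective [FiniteDimensional ℝ E] {f' V' : E →L[ℝ] G}
    (hf : HasStrictFDerivAt f f' c) (hinj : Function.Injective f') (hV : HasStrictFDerivAt V V' c) :
    ∃ L : ℝ, ∀ᶠ p : E × E in 𝓝 (c, c), ‖V p.1 - V p.2‖ ≤ L * ‖f p.1 - f p.2‖ := by
  obtain ⟨K, hK, hanti⟩ := (f' : E →ₗ[ℝ] G).exists_antilipschitzWith (LinearMap.ker_eq_bot.2 hinj)
  have hlow : ∀ v, ‖v‖ ≤ K * ‖f' v‖ := fun v => by simpa using hanti.le_mul_dist v 0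
  have hK0 : (0 : ℝ) < K := hK
  obtain ⟨C, hC0, hC⟩ := (hV.isLittleO_diag.isBigO.add
    (V'.isBigO_comp (fun p : E × E => p.1 - p.2) (𝓝 (c, c)))).exists_pos
  refine ⟨C * (2 * K), ?_⟩
  filter_upwards [hC.bound, hf.isLittleO_diag.bound (by positivity : 0 < 1 / (2 * (K : ℝ)))]
    with p h1 h2
  rw [sub_add_cancel] at h1
  have h3 := hlow (p.1 - p.2)
  have h4 : ‖f' (p.1 - p.2)‖ ≤ ‖f p.1 - f p.2‖ + ‖f p.1 - f p.2 - f' (p.1 - p.2)‖ := by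
    have := norm_sub_le (f p.1 - f p.2) (f p.1 - f p.2 - f' (p.1 - p.2))
    rwa [sub_sub_cancel] at this
  have h5 : ‖p.1 - p.2‖ ≤ 2 * K * ‖f p.1 - f p.2‖ := by
    have h6 : (K : ℝ) * ‖f p.1 - f p.2 - f' (p.1 - p.2)‖ ≤ ‖p.1 - p.2‖ / 2 := by
      refine (mul_le_mul_of_nonneg_left h2 hK0.le).trans_eq ?_
      field_simp
    have h7 := mul_le_mul_of_nonneg_left h4 hK0.le
    linarith
  refine h1.trans ?_
  rw [mul_assoc]
  exact mul_le_mul_of_nonneg_left h5 hC0.le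

end Asymptotics

section Quadratic

variable {G : Type*} [NormedAddCommGroup G] [NormedSpace ℝ G]
variable {μ : ℝ} {b p s : Model 3 → Model 3 →L[ℝ] ℝ} {c : Model 3} {X Y Z : Model 3 → Model 3}
  {f : Model 3 → G} {B : Model 3 → G →L[ℝ] G →L[ℝ] ℝ}

/-- The Lie derivative along the Reeb field of the quadratic form `p² - s² - b²`, transported to the
target of an immersion. -/
lemma AnosovGerm.lie_quadratic (h : AnosovGerm μ b p s c) (hX : ContDiffAt ℝ ∞ X c)
    (hfr : ∀ᶠ u in 𝓝 c, IsDualFrame (b u) (p u) (s u) (X u) (Y u) (Z u))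
    (hf : ContDiffAt ℝ ∞ f c) (hB : DifferentiableAt ℝ B c)
    (hw : ∀ᶠ u in 𝓝 c, ∀ v w, B u (fderiv ℝ f u v) (fderiv ℝ f u w) =
      p u v * p u w - s u v * s u w - b u v * b u w) (v : Model 3) :
    fderiv ℝ B c (X c) (fderiv ℝ f c v) (fderiv ℝ f c v) +
      B c (fderiv ℝ (fun u => fderiv ℝ f u (X u)) c v) (fderiv ℝ f c v) +
      B c (fderiv ℝ f c v) (fderiv ℝ (fun u => fderiv ℝ f u (X u)) c v) =
      2 * μ * ((p c v) ^ 2 + (s c v) ^ 2) := by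
  have hf1 : ContDiffAt ℝ ∞ (fderiv ℝ f) c := hf.fderiv_right (by simp)
  have hdf := hf1.differentiableAt_infty
  have hdX := hX.differentiableAt_infty
  have hdV : fderiv ℝ (fun u => fderiv ℝ f u (X u)) c v =
      fderiv ℝ (fderiv ℝ f) c (X c) v + fderiv ℝ f c (fderiv ℝ X c v) := by
    rw [(hdf.hasFDerivAt.clm_apply hdX.hasFDerivAt).fderiv]
    have hs : IsSymmSndFDerivAt ℝ f c := hf.isSymmSndFDerivAt (by
      simpa using WithTop.coe_le_coe.2 (le_top : (2 : ℕ∞) ≤ ⊤))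
    simp only [add_apply, ContinuousLinearMap.comp_apply, ContinuousLinearMap.flip_apply]
    rw [add_comm]
    congr 1
    exact hs v (X c)
  have hcur := hfr.self_of_nhds
  have lb := extD_eq_lie h.smooth_b.differentiableAt_infty hdX (hfr.mono fun u hu => hu.bX) v
  have lp := extD_eq_lie h.smooth_p.differentiableAt_infty hdX (hfr.mono fun u hu => hu.pX) v
  have ls := extD_eq_lie h.smooth_s.differentiableAt_infty hdX (hfr.mono fun u hu => hu.sX) v
  rw [h.db.self_of_nhds, hcur.pX, hcur.sX] at lb
  rw [h.dp.self_of_nhds _ _ hcur.bX hcur.pX hcur.sX] at lp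
  rw [h.ds.self_of_nhds _ _ hcur.bX hcur.pX hcur.sX] at ls
  -- Both sides are differentiated along X with v held fixed. Replacing the derivatives of p, s, b
  -- by `lp`, `ls`, `lb` turns this into the Lie derivative; b is invariant and contributes nothing.
  have hq : (fun u => B u (fderiv ℝ f u v) (fderiv ℝ f u v)) =ᶠ[𝓝 c]
      fun u => p u v * p u v - s u v * s u v - b u v * b u v := hw.mono fun u hu => hu v v
  have d1 := ((hB.hasFDerivAt.clm_apply
    (hdf.hasFDerivAt.clm_apply (hasFDerivAt_const v c))).clm_apply
    (hdf.hasFDerivAt.clm_apply (hasFDerivAt_const v c)))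
  have hpv := h.smooth_p.differentiableAt_infty.hasFDerivAt.clm_apply (hasFDerivAt_const v c)
  have hsv := h.smooth_s.differentiableAt_infty.hasFDerivAt.clm_apply (hasFDerivAt_const v c)
  have hbv := h.smooth_b.differentiableAt_infty.hasFDerivAt.clm_apply (hasFDerivAt_const v c)
  have d2 := ((hpv.mul hpv).sub (hsv.mul hsv)).sub (hbv.mul hbv)
  have d3 := congrArg (fun L => L (X c)) (d1.fderiv.symm.trans (hq.fderiv_eq.trans d2.fderiv))
  simp only [add_apply, sub_apply, smul_apply, smul_eq_mul, ContinuousLinearMap.comp_apply,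
    ContinuousLinearMap.flip_apply, zero_apply, map_zero, zero_add] at d3
  have hw1 := hw.self_of_nhds v (fderiv ℝ X c v)
  have hw2 := hw.self_of_nhds (fderiv ℝ X c v) v
  rw [hdV]
  simp only [map_add, add_apply]
  rw [hw1, hw2]
  linear_combination d3 + 2 * p c v * lp - 2 * s c v * ls - 2 * b c v * lb

end Quadratic

section Lines

variable {E : Type*} [NormedAddCommGroup E] [NormedSpace ℝ E] [FiniteDimensional ℝ E]
  [MeasurableSpace E] [BorelSpace E]

/-- A set which meets the lines of a given direction in short pieces has small volume. -/
lemma measure_le_of_lines (ν : Measure E) [ν.IsAddHaarMeasure] {S : Set E} (hS : MeasurableSet S)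
    {c : E} {R : ℝ} (hSR : S ⊆ Metric.closedBall c R) (Y : E) {d : ℝ≥0∞}
    (h : ∀ u, volume {t : ℝ | u + t • Y ∈ S} ≤ d) :
    ν S ≤ d * ν (Metric.closedBall c (R + ‖Y‖)) := by
  have h1 : ∀ t : ℝ, ∫⁻ u, S.indicator 1 (u + t • Y) ∂ν = ν S := fun t => by
    rw [lintegral_add_right_eq_self (S.indicator (1 : E → ℝ≥0∞)) (t • Y), lintegral_indicator_one hS]
  have hm : Measurable (Function.uncurry fun (t : ℝ) (u : E) =>
      S.indicator (1 : E → ℝ≥0∞) (u + t • Y)) := by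
    have : Measurable (S.indicator (1 : E → ℝ≥0∞)) := measurable_one.indicator hS
    refine this.comp ?_
    exact (by fun_prop : Continuous fun p : ℝ × E => p.2 + p.1 • Y).measurable
  -- The measure of S is averaged over its translates by tY with 0 ≤ t ≤ 1. After exchanging the
  -- integrals, the inner one measures the trace of S on a line, and it vanishes unless u is within
  -- R + ‖Y‖ of c.
  have h2 : ν S = ∫⁻ t in Icc (0 : ℝ) 1, (∫⁻ u, S.indicator 1 (u + t • Y) ∂ν) := by
    simp_rw [h1]
    simp
  rw [h2, lintegral_lintegral_swap hm.aemeasurable]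
  calc ∫⁻ u, (∫⁻ t in Icc (0 : ℝ) 1, S.indicator 1 (u + t • Y)) ∂ν
      ≤ ∫⁻ u, (Metric.closedBall c (R + ‖Y‖)).indicator (fun _ => d) u ∂ν := by
        refine lintegral_mono fun u => ?_
        by_cases hu : u ∈ Metric.closedBall c (R + ‖Y‖)
        · rw [indicator_of_mem hu]
          refine le_trans ?_ (h u)
          have hms : MeasurableSet {t : ℝ | u + t • Y ∈ S} :=
            (by fun_prop : Continuous fun t : ℝ => u + t • Y).measurable hS
          rw [← lintegral_indicator_one hms]
          refine (setLIntegral_le_lintegral _ _).trans_eq (lintegral_congr fun t => ?_)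
          simp [indicator]
        · rw [indicator_of_notMem hu, nonpos_iff_eq_zero]
          rw [setLIntegral_congr_fun measurableSet_Icc (g := fun _ => 0), lintegral_zero]
          intro t ht
          refine indicator_of_notMem (fun hm => hu ?_) _
          have h3 := hSR hm
          rw [Metric.mem_closedBall, dist_eq_norm] at h3 ⊢
          have h4 : ‖t • Y‖ ≤ ‖Y‖ := by
            rw [norm_smul, Real.norm_eq_abs, abs_of_nonneg ht.1]
            exact mul_le_of_le_one_left (norm_nonneg _) ht.2
          calc ‖u - c‖ = ‖(u + t • Y - c) - t • Y‖ := by congr 1; abel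
            _ ≤ ‖u + t • Y - c‖ + ‖t • Y‖ := norm_sub_le _ _
            _ ≤ R + ‖Y‖ := add_le_add h3 h4
    _ = d * ν (Metric.closedBall c (R + ‖Y‖)) := by
        rw [lintegral_indicator measurableSet_closedBall, setLIntegral_const]

end Lines

/-! ### The contact volume in coordinates -/

section Wedge

lemma sum_coord_stdVec (v : Model 3) : v = v 0 • stdVec 0 + v 1 • stdVec 1 + v 2 • stdVec 2 := by
  ext i
  fin_cases i <;> simp [stdVec]

/-- The coefficient of the 3-form `a ∧ d`, for a 1-form and a 2-form on `ℝ³`. -/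
def wedge (a : Model 3 → ℝ) (d : Model 3 → Model 3 → ℝ) : ℝ :=
  a (stdVec 0) * d (stdVec 1) (stdVec 2) - a (stdVec 1) * d (stdVec 0) (stdVec 2) +
    a (stdVec 2) * d (stdVec 0) (stdVec 1)

/-- A 3-form on ℝ³ is multiplied by the determinant under a linear map. -/
lemma wedge_pull (a : Model 3 →L[ℝ] ℝ) (b : Model 3 → Model 3 →L[ℝ] ℝ) (c : Model 3)
    (L : Model 3 →L[ℝ] Model 3) : wedge (fun v => a (L v)) (fun v w => extD b c (L v) (L w)) =
      L.det * wedge a (extD b c) := by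
  have hdet : L.det = Matrix.det (Matrix.of fun i j => L (stdVec j) i) := by
    rw [ContinuousLinearMap.det, ← LinearMap.det_toMatrix (EuclideanSpace.basisFun (Fin 3) ℝ).toBasis]
    congr 1
  have hself : ∀ v, extD b c v v = 0 := fun v => by simp [extD]
  have hadd' : ∀ w v v', extD b c w (v + v') = extD b c w v + extD b c w v' := fun w v v' => by
    rw [extD_swap, extD_add_left, extD_swap b c w v, extD_swap b c w v']; ring
  have hsmul' : ∀ w (r : ℝ) v, extD b c w (r • v) = r * extD b c w v := fun w r v => by
    rw [extD_swap, extD_smul_left, extD_swap b c w v]; ring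
  have ha : ∀ v, a v = v 0 * a (stdVec 0) + v 1 * a (stdVec 1) + v 2 * a (stdVec 2) := fun v => by
    conv_lhs => rw [sum_coord_stdVec v]
    simp
  have hd : ∀ v w, extD b c v w = (v 0 * w 1 - v 1 * w 0) * extD b c (stdVec 0) (stdVec 1) +
      (v 0 * w 2 - v 2 * w 0) * extD b c (stdVec 0) (stdVec 2) +
      (v 1 * w 2 - v 2 * w 1) * extD b c (stdVec 1) (stdVec 2) := fun v w => by
    conv_lhs => rw [sum_coord_stdVec v, sum_coord_stdVec w]
    simp only [extD_add_left, hadd', hsmul', extD_smul_left, hself]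
    rw [extD_swap b c (stdVec 0) (stdVec 1), extD_swap b c (stdVec 0) (stdVec 2),
      extD_swap b c (stdVec 1) (stdVec 2)]
    ring
  rw [hdet, Matrix.det_fin_three]
  simp only [wedge, Matrix.of_apply]
  rw [ha (L (stdVec 0)), ha (L (stdVec 1)), ha (L (stdVec 2)), hd (L (stdVec 1)) (L (stdVec 2)),
    hd (L (stdVec 0)) (L (stdVec 2)), hd (L (stdVec 0)) (L (stdVec 1))]
  ring

end Wedge

section CoordChange

variable {M : Type*} [TopologicalSpace M] [ChartedSpace (Model 3) M] [IsManifold (𝓡 3) ∞ M]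
variable {α : OneForm M} {x z : M} {u : Model 3}

lemma contDiffAt_coordChange (hu : u ∈ (extChartAt (𝓡 3) x).target)
    (hz : chartInv x u ∈ (extChartAt (𝓡 3) z).source) :
    ContDiffAt ℝ ∞ (chartRep 3 3 (id : M → M) x z) u := by
  rw [← contMDiffAt_iff_contDiffAt]
  have h2 : ContMDiffAt (𝓡 3) 𝓘(ℝ, Model 3) ∞ (extChartAt (𝓡 3) z) (chartInv x u) :=
    contMDiffAt_extChartAt' (by rwa [extChartAt_source] at hz)
  exact h2.comp u (contMDiffAt_chartInv hu)

lemma eventually_coordChange (hu : u ∈ (extChartAt (𝓡 3) x).target)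
    (hz : chartInv x u ∈ (extChartAt (𝓡 3) z).source) :
    ∀ᶠ v in 𝓝 u, v ∈ (extChartAt (𝓡 3) x).target ∧ chartInv x v ∈ (extChartAt (𝓡 3) z).source :=
  Filter.Eventually.and (extChartAt_target_mem_nhds_of_mem hu)
    ((continuousAt_chartInv hu).eventually ((isOpen_extChartAt_source z).mem_nhds hz))

lemma chartInvDeriv_coordChange (hu : u ∈ (extChartAt (𝓡 3) x).target)
    (hz : chartInv x u ∈ (extChartAt (𝓡 3) z).source) (v : Model 3) :
    (chartInvDeriv x u v : Model 3) = (chartInvDeriv z (chartRep 3 3 (id : M → M) x z u)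
      (fderiv ℝ (chartRep 3 3 (id : M → M) x z) u v) : Model 3) := by
  have hd := (contDiffAt_coordChange hu hz).differentiableAt_infty
  have ht : chartRep 3 3 (id : M → M) x z u ∈ (extChartAt (𝓡 3) z).target :=
    (extChartAt (𝓡 3) z).map_source hz
  have e2 := mfderiv_comp u (mdifferentiableAt_chartInv ht) hd.mdifferentiableAt
  have e3 : chartInv x =ᶠ[𝓝 u] (chartInv z ∘ chartRep 3 3 (id : M → M) x z) :=
    (eventually_coordChange hu hz).mono fun v hv => (chartInv_extChartAt hv.2).symm
  have e4 := e3.mfderiv_eq (I := 𝓘(ℝ, Model 3)) (I' := 𝓡 3)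
  rw [mfderiv_eq_fderiv] at e2
  have e6 := congrArg (fun L : Model 3 →L[ℝ] Model 3 => L v) e2
  have e7 := congrArg (fun L : Model 3 →L[ℝ] Model 3 => L v) e4
  exact e7.trans e6

lemma formInChart_coordChange (α : OneForm M) (hu : u ∈ (extChartAt (𝓡 3) x).target)
    (hz : chartInv x u ∈ (extChartAt (𝓡 3) z).source) :
    formInChart α x =ᶠ[𝓝 u]
      pullForm (chartRep 3 3 (id : M → M) x z) (formInChart α z) := by
  filter_upwards [eventually_coordChange hu hz] with v hv
  ext w
  exact apply_congr_point (fun x v => α x v) (chartInv_extChartAt hv.2).symm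
    (chartInvDeriv_coordChange hv.1 hv.2 w)

lemma IsContactForm.contDiffAt_of_mem (h : IsContactForm α)
    (hu : u ∈ (extChartAt (𝓡 3) x).target) : ContDiffAt ℝ ∞ (formInChart α x) u := by
  have hz := mem_extChartAt_source (I := 𝓡 3) (chartInv (n := 3) x u)
  have h1 : ContDiffAt ℝ ∞ (formInChart α (chartInv x u))
      (chartRep 3 3 (id : M → M) x (chartInv x u) u) := h.contDiffAt (chartInv x u)
  exact (ContDiffAt.pullForm h1 (contDiffAt_coordChange hu hz) (by simp)).congr_of_eventuallyEq (formInChart_coordChange α hu hz)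

lemma contactDensity_eq (α : OneForm M) (x : M) (u : Model 3) :
    contactDensity α x u = |wedge (formInChart α x u) (extD (formInChart α x) u)| := rfl

lemma IsContactForm.contactDensity_coordChange (h : IsContactForm α)
    (hu : u ∈ (extChartAt (𝓡 3) x).target) (hz : chartInv x u ∈ (extChartAt (𝓡 3) z).source) :
    contactDensity α x u = |(fderiv ℝ (chartRep 3 3 (id : M → M) x z) u).det| *
      contactDensity α z (chartRep 3 3 (id : M → M) x z u) := by
  have ht : chartRep 3 3 (id : M → M) x z u ∈ (extChartAt (𝓡 3) z).target :=
    (extChartAt (𝓡 3) z).map_source hz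
  have he := formInChart_coordChange α hu hz
  rw [contactDensity_eq, contactDensity_eq, ← abs_mul, ← wedge_pull]
  congr 2
  · rw [he.eq_of_nhds]; rfl
  · funext v w
    rw [extD_congr he, extD_pullForm (h.contDiffAt_of_mem ht).differentiableAt_infty
      ((contDiffAt_coordChange hu hz).of_le (WithTop.coe_le_coe.2 (le_top : (2 : ℕ∞) ≤ ⊤)))]

lemma IsContactForm.continuousAt_contactDensity (h : IsContactForm α)
    (hu : u ∈ (extChartAt (𝓡 3) x).target) : ContinuousAt (contactDensity α x) u := by
  have h1 := h.contDiffAt_of_mem hu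
  have h2 : ContinuousAt (fderiv ℝ (formInChart α x)) u :=
    (h1.fderiv_right (m := ∞) (by simp)).continuousAt
  have h3 : ∀ v, ContinuousAt (fun y => formInChart α x y v) u := fun v =>
    h1.continuousAt.clm_apply continuousAt_const
  have h4 : ∀ v w, ContinuousAt (fun y => extD (formInChart α x) y v w) u := fun v w =>
    ((h2.clm_apply continuousAt_const).clm_apply continuousAt_const).sub
      ((h2.clm_apply continuousAt_const).clm_apply continuousAt_const)
  exact ((((h3 _).mul (h4 _ _)).sub ((h3 _).mul (h4 _ _))).add ((h3 _).mul (h4 _ _))).abs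

/-- Let L send the standard basis to a triple on which α∧dα is nonzero; that value is det L times
the signed density, which therefore cannot vanish. -/
lemma IsContactForm.contactDensity_pos (h : IsContactForm α) (x : M) :
    0 < contactDensity α x (extChartAt (𝓡 3) x x) := by
  obtain ⟨u, v, w, hn⟩ := h.nondegenerate x
  rw [contactDensity_eq, abs_pos]
  intro h0
  set c := extChartAt (𝓡 3) x x
  set L : Model 3 →L[ℝ] Model 3 :=
    LinearMap.toContinuousLinearMap (Matrix.toEuclideanLin
      (Matrix.of ![fun j => (show Model 3 from u) j, fun j => (show Model 3 from v) j,
        fun j => (show Model 3 from w) j]).transpose)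
  have hL : L (stdVec 0) = u ∧ L (stdVec 1) = v ∧ L (stdVec 2) = w := by
    refine ⟨?_, ?_, ?_⟩ <;>
    · ext i
      simp [L, stdVec, Matrix.toEuclideanLin, Matrix.toLpLin]
  have h1 := wedge_pull (formInChart α x c) (formInChart α x) c L
  rw [h0, mul_zero] at h1
  simp only [wedge] at h1
  rw [hL.1, hL.2.1, hL.2.2] at h1
  have hb : ∀ v : Model 3, α x (show TangentSpace (𝓡 3) x from v) =
    formInChart α x c v := fun v => (formInChart_center α x v).symm
  apply hn
  refine Eq.trans ?_ h1
  exact congrArg₂ (· + ·) (congrArg₂ (· - ·) (congrArg (· * _) (hb u)) (congrArg (· * _) (hb v)))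
    (congrArg (· * _) (hb w))

end CoordChange

section ContactVolume

variable {M : Type*} [TopologicalSpace M] [ChartedSpace (Model 3) M] [IsManifold (𝓡 3) ∞ M]
  [MeasurableSpace M] [BorelSpace M] {α : OneForm M}

/-- The part of the contact volume that is seen in a chart. -/
def chartVolume (α : OneForm M) (x : M) : Measure M :=
  Measure.map (chartInv x)
    ((volume.withDensity fun u => ENNReal.ofReal (contactDensity α x u)).restrict
      (extChartAt (𝓡 3) x).target)

lemma measurableSet_target_inter (x : M) {A : Set M} (hA : MeasurableSet A) :
    MeasurableSet ((extChartAt (𝓡 3) x).target ∩ chartInv x ⁻¹' A) := by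
  classical
  have ht : MeasurableSet (extChartAt (𝓡 3) x).target := (isOpen_extChartAt_target x).measurableSet
  have hm : Measurable ((extChartAt (𝓡 3) x).target.piecewise (chartInv (n := 3) x) fun _ => x) :=
    ContinuousOn.measurable_piecewise (continuousOn_extChartAt_symm x) continuousOn_const ht
  have he : (extChartAt (𝓡 3) x).target ∩ chartInv x ⁻¹' A = (extChartAt (𝓡 3) x).target ∩
      ((extChartAt (𝓡 3) x).target.piecewise (chartInv (n := 3) x) fun _ => x) ⁻¹' A := by
    ext u
    simp only [mem_inter_iff, mem_preimage]
    refine and_congr_right fun hu => ?_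
    rw [piecewise_eq_of_mem _ _ _ hu]
  rw [he]
  exact ht.inter (hm hA)

lemma chartVolume_apply (α : OneForm M) (x : M) {A : Set M} (hA : MeasurableSet A) :
    chartVolume α x A = ∫⁻ u in (extChartAt (𝓡 3) x).target ∩ chartInv x ⁻¹' A,
      ENNReal.ofReal (contactDensity α x u) := by
  have ht : MeasurableSet (extChartAt (𝓡 3) x).target := (isOpen_extChartAt_target x).measurableSet
  have hc : ContinuousOn (chartInv (n := 3) x) (extChartAt (𝓡 3) x).target :=
    continuousOn_extChartAt_symm x
  rw [chartVolume, Measure.map_apply_of_aemeasurable (hc.aemeasurable ht) hA,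
    Measure.restrict_apply' ht, withDensity_apply', inter_comm]

lemma contactVolume_eq (α : OneForm M) : contactVolume α = ⨆ x, chartVolume α x := rfl

lemma chartVolume_le_contactVolume (α : OneForm M) (x : M) : chartVolume α x ≤ contactVolume α :=
  le_iSup (chartVolume α) x

/-- Change of variables between the two charts. It is only an inequality because the chart at x may
not see all of A. -/
lemma IsContactForm.chartVolume_le (h : IsContactForm α) (x z : M) {A : Set M}
    (hA : MeasurableSet A) (hz : A ⊆ (extChartAt (𝓡 3) z).source) :
    chartVolume α x A ≤ chartVolume α z A := by
  rw [chartVolume_apply α x hA, chartVolume_apply α z hA]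
  set B := (extChartAt (𝓡 3) x).target ∩ chartInv x ⁻¹' A
  have hB : MeasurableSet B := measurableSet_target_inter x hA
  set τ := chartRep 3 3 (id : M → M) x z
  have hder : ∀ u ∈ B, HasFDerivWithinAt τ (fderiv ℝ τ u) B u := fun u hu =>
    (contDiffAt_coordChange hu.1 (hz hu.2)).differentiableAt_infty.hasFDerivAt.hasFDerivWithinAt
  have hinj : InjOn τ B := fun u hu v hv huv => by
    have h1 : chartInv (n := 3) z (τ u) = chartInv x u := chartInv_extChartAt (hz hu.2)
    have h2 : chartInv (n := 3) z (τ v) = chartInv x v := chartInv_extChartAt (hz hv.2)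
    rw [huv, h2] at h1
    rw [← extChartAt_chartInv hu.1, ← extChartAt_chartInv hv.1, h1]
  have hsub : τ '' B ⊆ (extChartAt (𝓡 3) z).target ∩ chartInv z ⁻¹' A := by
    rintro _ ⟨u, hu, rfl⟩
    refine ⟨(extChartAt (𝓡 3) z).map_source (hz hu.2), ?_⟩
    have h1 : chartInv (n := 3) z (τ u) = chartInv x u := chartInv_extChartAt (hz hu.2)
    rw [mem_preimage, h1]
    exact hu.2
  calc ∫⁻ u in B, ENNReal.ofReal (contactDensity α x u)
      = ∫⁻ u in B, ENNReal.ofReal |(fderiv ℝ τ u).det| * ENNReal.ofReal (contactDensity α z (τ u)) := by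
        refine setLIntegral_congr_fun hB fun u hu => ?_
        rw [← ENNReal.ofReal_mul (abs_nonneg _), ← h.contactDensity_coordChange hu.1 (hz hu.2)]
    _ = ∫⁻ u in τ '' B, ENNReal.ofReal (contactDensity α z u) :=
        (lintegral_image_eq_lintegral_abs_det_fderiv_mul volume hB hder hinj
          fun u => ENNReal.ofReal (contactDensity α z u)).symm
    _ ≤ _ := lintegral_mono_set hsub

/-- On a closed manifold, the contact volume is controlled by the Lebesgue measure in finitely many
arbitrarily small closed coordinate balls. -/
theorem IsContactForm.exists_volume_le [T2Space M] [CompactSpace M] (h : IsContactForm α)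
    {U : M → Set (Model 3)} (hU : ∀ z, U z ∈ 𝓝 (extChartAt (𝓡 3) z z)) :
    ∃ (t : Finset M) (K : ℝ≥0∞) (V : M → Set M) (R : M → ℝ), K ≠ (⊤ : ℝ≥0∞) ∧ ∀ z, IsClosed (V z) ∧
      V z ⊆ (extChartAt (𝓡 3) z).source ∧ extChartAt (𝓡 3) z '' V z ⊆ U z ∧
      extChartAt (𝓡 3) z '' V z ⊆ Metric.closedBall (extChartAt (𝓡 3) z z) (R z) ∧
      ∀ A : Set M, MeasurableSet A →
        contactVolume α A ≤ ∑ z ∈ t, K * volume (extChartAt (𝓡 3) z '' (A ∩ V z)) := by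
  -- The balls are small enough to lie in the chart and in the prescribed neighbourhood, and to keep
  -- the density below its central value plus one.
  have hN : ∀ z : M, ∃ r > 0, Metric.closedBall (extChartAt (𝓡 3) z z) r ⊆
      (U z ∩ (extChartAt (𝓡 3) z).target) ∩
        {u | contactDensity α z u < contactDensity α z (extChartAt (𝓡 3) z z) + 1} := fun z =>
    Metric.nhds_basis_closedBall.mem_iff.1 (inter_mem (inter_mem (hU z) (extChartAt_target_mem_nhds z))
      ((h.continuousAt_contactDensity (mem_extChartAt_target z)).eventually
        (gt_mem_nhds (lt_add_one _))))
  choose r hr hsub using hN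
  set V : M → Set M := fun z => chartInv z '' Metric.closedBall (extChartAt (𝓡 3) z z) (r z)
  have hVt : ∀ z, Metric.closedBall (extChartAt (𝓡 3) z z) (r z) ⊆ (extChartAt (𝓡 3) z).target :=
    fun z => (hsub z).trans (inter_subset_left.trans inter_subset_right)
  have hVs : ∀ z, V z ⊆ (extChartAt (𝓡 3) z).source := by
    rintro z _ ⟨u, hu, rfl⟩
    exact chartInv_mem_source (hVt z hu)
  have hVim : ∀ z, extChartAt (𝓡 3) z '' V z = Metric.closedBall (extChartAt (𝓡 3) z z) (r z) :=
    fun z => by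
      rw [image_image]
      exact (image_congr fun u hu => extChartAt_chartInv (hVt z hu)).trans (image_id' _)
  have hVc : ∀ z, IsClosed (V z) := fun z =>
    ((isCompact_closedBall _ _).image_of_continuousOn
      ((continuousOn_extChartAt_symm z).mono (hVt z))).isClosed
  have hVn : ∀ z, V z ∈ 𝓝 z := fun z => by
    have h1 : extChartAt (𝓡 3) z ⁻¹' Metric.closedBall (extChartAt (𝓡 3) z z) (r z) ∈ 𝓝 z :=
      (continuousAt_extChartAt z).preimage_mem_nhds (Metric.closedBall_mem_nhds _ (hr z))
    filter_upwards [h1, extChartAt_source_mem_nhds (I := 𝓡 3) z] with y h2 h3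
    exact ⟨_, h2, chartInv_extChartAt h3⟩
  obtain ⟨t, -, ht⟩ := isCompact_univ.elim_nhds_subcover V fun z _ => hVn z
  set K : ℝ≥0∞ := ∑ z ∈ t, ENNReal.ofReal (contactDensity α z (extChartAt (𝓡 3) z z) + 1)
  refine ⟨t, K, V, r, ?_, fun z => ⟨hVc z, hVs z, ?_, (hVim z).le, fun A hA => ?_⟩⟩
  · exact (ENNReal.sum_lt_top.2 fun z _ => ENNReal.ofReal_lt_top).ne
  · rw [hVim]
    exact (hsub z).trans (inter_subset_left.trans inter_subset_left)
  · have key : ∀ z ∈ t, chartVolume α z (A ∩ V z) ≤ K * volume (extChartAt (𝓡 3) z '' (A ∩ V z)) :=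
      fun z hz => by
        have hm := hA.inter (hVc z).measurableSet
        rw [chartVolume_apply α z hm]
        have himg : (extChartAt (𝓡 3) z).target ∩ chartInv z ⁻¹' (A ∩ V z) =
            extChartAt (𝓡 3) z '' (A ∩ V z) := by
          ext u
          constructor
          · rintro ⟨h1, h2⟩
            exact ⟨_, h2, extChartAt_chartInv h1⟩
          · rintro ⟨y, hy, rfl⟩
            refine ⟨(extChartAt (𝓡 3) z).map_source (hVs z hy.2), ?_⟩
            rw [mem_preimage, chartInv_extChartAt (hVs z hy.2)]
            exact hy
        have hmi := measurableSet_target_inter z hm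
        rw [himg] at hmi ⊢
        refine (setLIntegral_mono' hmi (g := fun _ => K) fun u hu => ?_).trans_eq
          (setLIntegral_const _ _)
        have hu' : u ∈ extChartAt (𝓡 3) z '' V z := image_mono inter_subset_right hu
        rw [hVim] at hu'
        exact (ENNReal.ofReal_le_ofReal (hsub z hu').2.le).trans (Finset.single_le_sum
          (f := fun z => ENNReal.ofReal (contactDensity α z (extChartAt (𝓡 3) z z) + 1))
          (fun _ _ => zero_le) hz)
    -- As `contactVolume` is a supremum of measures, it suffices to bound each chart measure; over a
    -- piece V z it is at most the measure seen in the chart at z.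
    have hle : contactVolume α ≤ ∑ z ∈ t, (chartVolume α z).restrict (V z) := by
      rw [contactVolume_eq]
      refine iSup_le fun x => Measure.le_iff.2 fun A hA => ?_
      have hcov : A ⊆ ⋃ z ∈ t, A ∩ V z := fun y hy => by
        obtain ⟨z, hz, hyz⟩ := mem_iUnion₂.1 (ht (mem_univ y))
        exact mem_iUnion₂.2 ⟨z, hz, hy, hyz⟩
      rw [Measure.finsetSum_apply]
      refine (measure_mono hcov).trans ((measure_biUnion_finset_le _ _).trans ?_)
      refine Finset.sum_le_sum fun z _ => ?_
      rw [Measure.restrict_apply hA]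
      exact h.chartVolume_le x z (hA.inter (hVc z).measurableSet)
        (inter_subset_right.trans (hVs z))
    refine (hle A).trans ?_
    rw [Measure.finsetSum_apply]
    refine Finset.sum_le_sum fun z hz => ?_
    rw [Measure.restrict_apply hA]
    exact key z hz

lemma IsContactForm.contactVolume_univ_ne_zero [Nonempty M] (h : IsContactForm α) :
    contactVolume α univ ≠ 0 := by
  obtain ⟨x⟩ := ‹Nonempty M›
  refine (lt_of_lt_of_le ?_ (chartVolume_le_contactVolume α x univ)).ne'
  rw [chartVolume_apply α x MeasurableSet.univ, preimage_univ, inter_univ]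
  set c := extChartAt (𝓡 3) x x
  have hN : {u | contactDensity α x c / 2 < contactDensity α x u} ∩ (extChartAt (𝓡 3) x).target ∈ 𝓝 c :=
    inter_mem ((h.continuousAt_contactDensity (mem_extChartAt_target x)).eventually
      (lt_mem_nhds (half_lt_self (h.contactDensity_pos x)))) (extChartAt_target_mem_nhds x)
  obtain ⟨r, hr, hs⟩ := Metric.nhds_basis_ball.mem_iff.1 hN
  refine lt_of_lt_of_le ?_ (lintegral_mono_set (hs.trans inter_subset_right))
  refine lt_of_lt_of_le ?_ (setLIntegral_mono' measurableSet_ball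
    (f := fun _ => ENNReal.ofReal (contactDensity α x c / 2))
    fun u hu => ENNReal.ofReal_le_ofReal (hs hu).1.le)
  rw [setLIntegral_const]
  exact ENNReal.mul_pos (ENNReal.ofReal_pos.2 (half_pos (h.contactDensity_pos x))).ne'
    (Metric.measure_ball_pos volume c hr).ne'

lemma IsContactForm.contactVolume_univ_ne_top [T2Space M] [CompactSpace M] (h : IsContactForm α) :
    contactVolume α univ ≠ (⊤ : ℝ≥0∞) := by
  obtain ⟨t, K, V, R, hK, hV⟩ := h.exists_volume_le (U := fun _ => univ) fun z => univ_mem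
  rcases isEmpty_or_nonempty M with hM | ⟨⟨z₀⟩⟩
  · rw [univ_eq_empty_iff.2 hM, measure_empty]; exact ENNReal.zero_ne_top
  refine ((hV z₀).2.2.2.2 univ MeasurableSet.univ).trans_lt (ENNReal.sum_lt_top.2 fun z _ => ?_) |>.ne
  refine ENNReal.mul_lt_top hK.lt_top ?_
  rw [univ_inter]
  exact (measure_mono (hV z).2.2.2.1).trans_lt measure_closedBall_lt_top

end ContactVolume

/-! ### Entropy bound from decay of cylinders -/

section EntropyBound

/-- If the cylinders of a partition decay exponentially in measure, the entropy is bounded below by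
the rate of decay. -/
theorem ofReal_le_measureEntropy {Ω : Type*} [MeasurableSpace Ω] (ν : Measure Ω)
    [IsProbabilityMeasure ν] (T : Ω → Ω) {k : ℕ} {P : Ω → Fin k} (hP : Measurable P) {κ c : ℝ}
    (hκ : 0 < κ) (h : ∀ (n : ℕ) (a : Fin n → Fin k),
      ν.real {x | ∀ i : Fin n, P (T^[i] x) = a i} ≤ Real.exp (c - κ * n)) :
    ENNReal.ofReal κ ≤ measureEntropy ν T := by
  refine le_trans ?_ (le_iSup_of_le k (le_iSup_of_le P (le_iSup_of_le hP le_rfl)))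
  have hlim : Tendsto (fun n : ℕ => ENNReal.ofReal (κ - c / n)) atTop (𝓝 (ENNReal.ofReal κ)) := by
    refine (ENNReal.continuous_ofReal.tendsto κ).comp ?_
    simpa using (tendsto_const_nhds (x := κ)).sub (tendsto_const_div_atTop_nhds_zero_nat c)
  rw [← hlim.limsup_eq]
  refine limsup_le_limsup ?_
  obtain ⟨N, hN⟩ := exists_nat_gt (c / κ)
  filter_upwards [eventually_ge_atTop (max N 1)] with n hn
  have hn1 : (1 : ℝ) ≤ n := by exact_mod_cast (le_max_right N 1).trans hn
  have hn0 : (0 : ℝ) < n := by linarith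
  have hnN : c ≤ κ * n := by
    have h1 : (N : ℝ) ≤ n := by exact_mod_cast (le_max_left N 1).trans hn
    rw [div_lt_iff₀ hκ] at hN
    nlinarith
  refine ENNReal.ofReal_le_ofReal ?_
  rw [show κ - c / n = (κ * n - c) / n by field_simp]
  refine div_le_div_of_nonneg_right ?_ hn0.le
  -- Subadditivity is enough here: neither measurability of the cylinders nor invariance of ν is
  -- used.
  have hsum : 1 ≤ ∑ a : Fin n → Fin k, ν.real {x | ∀ i : Fin n, P (T^[i] x) = a i} := by
    have hu : (⋃ a : Fin n → Fin k, {x | ∀ i : Fin n, P (T^[i] x) = a i}) = univ := by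
      refine eq_univ_of_forall fun x => mem_iUnion.2 ⟨fun i => P (T^[i] x), fun i => rfl⟩
    have h1 := measureReal_iUnion_fintype_le (μ := ν)
      (fun a : Fin n → Fin k => {x | ∀ i : Fin n, P (T^[i] x) = a i})
    rwa [hu, probReal_univ] at h1
  calc κ * n - c = (κ * n - c) * 1 := (mul_one _).symm
    _ ≤ (κ * n - c) * ∑ a : Fin n → Fin k, ν.real {x | ∀ i : Fin n, P (T^[i] x) = a i} :=
        mul_le_mul_of_nonneg_left hsum (by linarith)
    _ ≤ _ := by
        rw [Finset.mul_sum]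
        refine Finset.sum_le_sum fun a _ => ?_
        set p := ν.real {x | ∀ i : Fin n, P (T^[i] x) = a i}
        rcases (measureReal_nonneg : 0 ≤ p).eq_or_lt with h0 | h0
        · rw [show p = 0 from h0.symm]; simp
        · have h2 := Real.log_le_log h0 (h n a)
          rw [Real.log_exp] at h2
          -- If p ≤ exp(c - κn) then -p log p ≥ (κn - c)p.
          rw [Real.negMulLog, mul_comm, neg_mul, ← mul_neg]
          exact mul_le_mul_of_nonneg_left (by linarith) h0.le

end EntropyBound

/-! ### The Reeb flow -/

section Flow

/-- Joint continuity of the local flow provides one existence time for all initial points near x₀,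
during which the curves stay in U. -/
lemma ContDiffAt.exists_integralCurve_mem {E : Type*} [NormedAddCommGroup E] [NormedSpace ℝ E]
    [CompleteSpace E] {f : E → E} {x₀ : E} (hf : ContDiffAt ℝ 1 f x₀) {U : Set E} (hU : U ∈ 𝓝 x₀) :
    ∃ W ∈ 𝓝 x₀, ∃ ε > 0, ∀ x ∈ W, ∃ γ : ℝ → E, γ 0 = x ∧
      ∀ t ∈ Ioo (-ε) ε, HasDerivAt γ (f (γ t)) t ∧ γ t ∈ U := by
  obtain ⟨ε, hε, a, r, L, K, hr, hpl⟩ := IsPicardLindelof.of_contDiffAt_one hf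
  obtain ⟨Φ, hΦ, hcont⟩ := (hpl 0).exists_forall_mem_closedBall_eq_hasDerivWithinAt_continuousOn
  have hr' : (0 : ℝ) < r := hr
  have hnb : Metric.closedBall x₀ r ×ˢ Icc (0 - ε) (0 + ε) ∈ 𝓝 (x₀, (0 : ℝ)) :=
    prod_mem_nhds (Metric.closedBall_mem_nhds _ hr') (Icc_mem_nhds (by linarith) (by linarith))
  have h0 : Φ (x₀, 0) = x₀ := (hΦ x₀ (Metric.mem_closedBall_self hr'.le)).1
  have hc : Φ ⁻¹' U ∈ 𝓝 (x₀, (0 : ℝ)) :=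
    (hcont.continuousAt hnb).preimage_mem_nhds (by rwa [h0])
  obtain ⟨W, hW, T, hT, hWT⟩ := mem_nhds_prod_iff.1 hc
  obtain ⟨δ, hδ, hδT⟩ := Metric.mem_nhds_iff.1 hT
  refine ⟨W ∩ Metric.closedBall x₀ r, inter_mem hW (Metric.closedBall_mem_nhds _ hr'), min ε δ,
    lt_min hε hδ, fun x hx => ⟨fun t => Φ (x, t), (hΦ x hx.2).1, fun t ht => ⟨?_, ?_⟩⟩⟩
  · have h1 : t ∈ Ioo (0 - ε) (0 + ε) := ⟨by linarith [ht.1, min_le_left ε δ],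
      by linarith [ht.2, min_le_left ε δ]⟩
    exact ((hΦ x hx.2).2 t (Ioo_subset_Icc_self h1)).hasDerivAt (Icc_mem_nhds h1.1 h1.2)
  · refine hWT ⟨hx.1, hδT ?_⟩
    rw [Metric.mem_ball, Real.dist_eq, sub_zero, abs_lt]
    exact ⟨by linarith [ht.1, min_le_right ε δ], by linarith [ht.2, min_le_right ε δ]⟩

variable {M : Type*} [TopologicalSpace M] [ChartedSpace (Model 3) M] [IsManifold (𝓡 3) ∞ M]
variable {μ : ℝ} {α : OneForm M} {q : ∀ x : M, TangentSpace (𝓡 3) x → ℂ}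

lemma exists_reeb_chart (h : ∀ x, HasGermAt μ α q x) (x : M) :
    ∃ X : Model 3 → Model 3, ContDiffAt ℝ ∞ X (extChartAt (𝓡 3) x x) ∧
      ∀ᶠ u in 𝓝 (extChartAt (𝓡 3) x x), reeb α (chartInv x u) = chartInvDeriv x u (X u) := by
  obtain ⟨p, s, hg, -⟩ := h x
  obtain ⟨X, Y, Z, hX, -, -, hf⟩ := hg.exists_frame
  exact ⟨X, hX, hg.eventually_reeb h hf⟩

lemma contMDiff_reeb (h : ∀ x, HasGermAt μ α q x) :
    ContMDiff (𝓡 3) (𝓡 3).tangent ∞ (fun x => (⟨x, reeb α x⟩ : TangentBundle (𝓡 3) M)) := by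
  intro x
  have : IsManifold (𝓡 3) 1 M := IsManifold.of_le (n := ∞) (by simp)
  obtain ⟨X, hX, hr⟩ := exists_reeb_chart h x
  refine (Bundle.contMDiffAt_section (𝕜 := ℝ) (IB := 𝓡 3) (E := fun x : M => TangentSpace (𝓡 3) x) (F := Model 3) (s := fun x => reeb α x) x).2 ?_
  refine ((contMDiffAt_comp_extChartAt_iff (G := X) (x := x)).2 hX).congr_of_eventuallyEq ?_
  filter_upwards [(continuousAt_extChartAt (I := 𝓡 3) x).eventually hr,
    extChartAt_source_mem_nhds (I := 𝓡 3) x] with y hy hs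
  have hs' : y ∈ (chartAt (Model 3) x).source := by rwa [extChartAt_source] at hs
  have h1 : reeb α y = (trivializationAt (Model 3) (TangentSpace (𝓡 3)) x).symm y
      (X (extChartAt (𝓡 3) x y)) := by
    rw [← chartInvDeriv_eq_symmL hs']
    have := apply_congr_point (R := Model 3) (fun y _ => reeb α y) (chartInv_extChartAt hs).symm
      (rfl : (0 : Model 3) = 0)
    exact this.trans hy
  rw [h1]
  exact (trivializationAt (Model 3) (TangentSpace (𝓡 3)) x).apply_mk_symm
    (by simpa using hs') _ ▸ rfl

/-- The Reeb flow of a closed manifold is complete. -/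
lemma exists_integralCurve_reeb [T2Space M] [CompactSpace M] (h : ∀ x, HasGermAt μ α q x) (x : M) :
    ∃ γ : ℝ → M, γ 0 = x ∧ IsMIntegralCurve (I := 𝓡 3) γ (reeb α) := by
  have : IsManifold (𝓡 3) 1 M := IsManifold.of_le (n := ∞) (by simp)
  have hloc : ∀ z : M, ∃ V ∈ 𝓝 z, ∃ ε > 0, ∀ y ∈ V, ∃ γ : ℝ → M, γ 0 = y ∧
      IsMIntegralCurveOn (I := 𝓡 3) γ (reeb α) (Ioo (-ε) ε) := fun z => by
    obtain ⟨X, hX, hr⟩ := exists_reeb_chart h z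
    obtain ⟨W, hW, ε, hε, hcur⟩ := (hX.of_le (m := 1) (by simp)).exists_integralCurve_mem
      (inter_mem hr (extChartAt_target_mem_nhds (I := 𝓡 3) z))
    refine ⟨_, inter_mem ((continuousAt_extChartAt (I := 𝓡 3) z).preimage_mem_nhds hW)
      (extChartAt_source_mem_nhds (I := 𝓡 3) z), ε, hε, fun y hy => ?_⟩
    obtain ⟨γ, h0, hγ⟩ := hcur _ hy.1
    refine ⟨fun t => chartInv z (γ t), (congrArg (chartInv z) h0).trans (chartInv_extChartAt hy.2), fun t ht => ?_⟩
    obtain ⟨hd, hU⟩ := hγ t ht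
    have h1 := (mdifferentiableAt_chartInv hU.2).hasMFDerivAt
    have h2 : HasMFDerivAt 𝓘(ℝ, ℝ) 𝓘(ℝ, Model 3) γ t ((1 : ℝ →L[ℝ] ℝ).smulRight (X (γ t))) :=
      hd.hasFDerivAt.hasMFDerivAt
    have h3 := (h1.comp t h2).hasMFDerivWithinAt (s := Ioo (-ε) ε)
    have h4 : (mfderiv 𝓘(ℝ, Model 3) (𝓡 3) (chartInv (n := 3) z) (γ t)).comp
        ((1 : ℝ →L[ℝ] ℝ).smulRight (X (γ t))) =
        (1 : ℝ →L[ℝ] ℝ).smulRight (reeb α (chartInv z (γ t))) := by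
      have h5 : reeb α (chartInv z (γ t)) = chartInvDeriv z (γ t) (X (γ t)) := hU.1
      refine ContinuousLinearMap.ext fun τ => ?_
      exact (map_smul (mfderiv 𝓘(ℝ, Model 3) (𝓡 3) (chartInv (n := 3) z) (γ t)) τ
        (X (γ t))).trans (congrArg (fun w => τ • w) h5.symm)
    rw [← h4]
    exact h3
  choose V hV ε hε hcur using hloc
  obtain ⟨t, -, ht⟩ := isCompact_univ.elim_nhds_subcover V fun z _ => hV z
  have hne : t.Nonempty := by
    obtain ⟨z, hz, -⟩ := mem_iUnion₂.1 (ht (mem_univ x))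
    exact ⟨z, hz⟩
  -- By compactness finitely many local existence times suffice; their minimum is a uniform time,
  -- and curves of uniform length can be continued forever.
  refine exists_isMIntegralCurve_of_isMIntegralCurveOn (I := 𝓡 3)
    ((contMDiff_reeb h).of_le (by simp)) (ε := t.inf' hne ε)
    ((Finset.lt_inf'_iff _).2 fun z _ => hε z) (fun y => ?_) x
  obtain ⟨z, hz, hyz⟩ := mem_iUnion₂.1 (ht (mem_univ y))
  obtain ⟨γ, h0, hγ⟩ := hcur z y hyz
  have hle := Finset.inf'_le ε hz
  exact ⟨γ, h0, hγ.mono (Ioo_subset_Ioo (neg_le_neg hle) hle)⟩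

/-- The time-one map of the Reeb flow moves points along integral curves. -/
lemma exists_integralCurve_reebFlow [T2Space M] [CompactSpace M] (h : ∀ x, HasGermAt μ α q x)
    (x : M) : ∃ γ : ℝ → M, γ 0 = x ∧ γ 1 = reebFlow α 1 x ∧
      IsMIntegralCurve (I := 𝓡 3) γ (reeb α) := by
  have hs := @Classical.epsilon_spec_aux (ℝ → M) ⟨fun _ => x⟩
    (fun γ => γ 0 = x ∧ IsMIntegralCurve (I := 𝓡 3) γ (reeb α)) (exists_integralCurve_reeb h x)
  exact ⟨_, hs.1, rfl, hs.2⟩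

end Flow

/-! ### Extending the quadratic form to the ambient space -/

section LeftInverse

variable {E G : Type*} [NormedAddCommGroup E] [NormedSpace ℝ E] [FiniteDimensional ℝ E]
  [NormedAddCommGroup G] [NormedSpace ℝ G] [FiniteDimensional ℝ G]

/-- The differential of an immersion has a smooth left inverse. -/
lemma exists_smooth_leftInverse {f : E → G} {c : E} (hf : ContDiffAt ℝ ∞ f c)
    (hinj : Function.Injective (fderiv ℝ f c)) :
    ∃ L : E → G →L[ℝ] E, ContDiffAt ℝ ∞ L c ∧ ∀ᶠ u in 𝓝 c, ∀ v, L u (fderiv ℝ f u v) = v := by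
  have : CompleteSpace E := FiniteDimensional.complete ℝ E
  obtain ⟨R₀, hR₀⟩ := LinearMap.exists_leftInverse_of_injective (fderiv ℝ f c : E →ₗ[ℝ] G)
    (LinearMap.ker_eq_bot.2 hinj)
  set R : G →L[ℝ] E := LinearMap.toContinuousLinearMap R₀
  -- R is a left inverse at c only; (R df)⁻¹R corrects it at nearby points.
  set N : E → E →L[ℝ] E := fun u => R.comp (fderiv ℝ f u)
  have hNc : N c = (ContinuousLinearEquiv.refl ℝ E : E →L[ℝ] E) := by
    ext v
    exact congrArg (fun L : E →ₗ[ℝ] E => L v) hR₀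
  have hN : ContDiffAt ℝ ∞ N c := contDiffAt_const.clm_comp (hf.fderiv_right (by simp))
  have hinv : ContDiffAt ℝ ∞ (fun u => (N u).inverse) c := by
    have h1 : ContDiffAt ℝ ∞ (ContinuousLinearMap.inverse : (E →L[ℝ] E) → _) (N c) := by
      rw [hNc]
      exact contDiffAt_map_inverse _
    exact h1.comp c hN
  refine ⟨fun u => (N u).inverse.comp R, hinv.clm_comp contDiffAt_const, ?_⟩
  have hev : ∀ᶠ u in 𝓝 c, N u ∈ range ((↑) : (E ≃L[ℝ] E) → E →L[ℝ] E) :=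
    hN.continuousAt.preimage_mem_nhds (by
      rw [hNc]
      exact ContinuousLinearEquiv.nhds _)
  filter_upwards [hev] with u ⟨e, he⟩ v
  have h1 : R (fderiv ℝ f u v) = e v := congrArg (fun L : E →L[ℝ] E => L v) he.symm
  show (N u).inverse (R (fderiv ℝ f u v)) = v
  rw [h1, ← he, ContinuousLinearMap.inverse_equiv]
  exact e.symm_apply_apply v

end LeftInverse

section DirDeriv

variable {M : Type*} [TopologicalSpace M] [ChartedSpace (Model 3) M] [IsManifold (𝓡 3) ∞ M]
variable {μ : ℝ} {α : OneForm M} {q : ∀ x : M, TangentSpace (𝓡 3) x → ℂ}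
variable {H : Type*} [NormedAddCommGroup H] [NormedSpace ℝ H]

/-- The derivative of a vector valued function along the Reeb field. -/
def reebDeriv (α : OneForm M) (φ : M → H) (x : M) : H :=
  mfderiv (𝓡 3) 𝓘(ℝ, H) φ x (reeb α x)

lemma fderiv_comp_chartInv {φ : M → H} {z : M} {u : Model 3}
    (hu : u ∈ (extChartAt (𝓡 3) z).target)
    (hφ : MDifferentiableAt (𝓡 3) 𝓘(ℝ, H) φ (chartInv z u)) (v : Model 3) :
    fderiv ℝ (fun u => φ (chartInv z u)) u v =
      (mfderiv (𝓡 3) 𝓘(ℝ, H) φ (chartInv z u) (chartInvDeriv z u v) : H) := by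
  have e1 := mfderiv_comp u hφ (mdifferentiableAt_chartInv hu)
  rw [mfderiv_eq_fderiv] at e1
  exact congrArg (fun L : Model 3 →L[ℝ] H => L v) e1

lemma contDiffAt_comp_chartInv {k : WithTop ℕ∞} (hk : k ≤ ((⊤ : ℕ∞) : WithTop ℕ∞)) {φ : M → H}
    {z : M} {u : Model 3} (hu : u ∈ (extChartAt (𝓡 3) z).target)
    (hφ : ContMDiffAt (𝓡 3) 𝓘(ℝ, H) k φ (chartInv z u)) :
    ContDiffAt ℝ k (fun u => φ (chartInv z u)) u := by
  rw [← contMDiffAt_iff_contDiffAt]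
  exact hφ.comp u ((contMDiffAt_chartInv hu).of_le hk)

lemma eventually_reebDeriv {φ : M → H} (hφ : ContMDiff (𝓡 3) 𝓘(ℝ, H) 1 φ) {z : M}
    {X : Model 3 → Model 3}
    (hX : ∀ᶠ u in 𝓝 (extChartAt (𝓡 3) z z), reeb α (chartInv z u) = chartInvDeriv z u (X u)) :
    ∀ᶠ u in 𝓝 (extChartAt (𝓡 3) z z), reebDeriv α φ (chartInv z u) =
      fderiv ℝ (fun u => φ (chartInv z u)) u (X u) := by
  filter_upwards [hX, eventually_mem_target z] with u hu ht
  rw [fderiv_comp_chartInv ht ((hφ _).mdifferentiableAt (by simp)), ← hu]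
  rfl

lemma hasDerivAt_comp_integralCurve {φ : M → H} (hφ : ContMDiff (𝓡 3) 𝓘(ℝ, H) 1 φ) {γ : ℝ → M}
    (hγ : IsMIntegralCurve (I := 𝓡 3) γ (reeb α)) (t : ℝ) :
    HasDerivAt (fun t => φ (γ t)) (reebDeriv α φ (γ t)) t := by
  have h1 : HasFDerivAt (fun t => φ (γ t))
      ((show Model 3 →L[ℝ] H from mfderiv (𝓡 3) 𝓘(ℝ, H) φ (γ t)).comp
        ((1 : ℝ →L[ℝ] ℝ).smulRight (show Model 3 from reeb α (γ t)))) t :=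
    (((hφ (γ t)).mdifferentiableAt (by simp)).hasMFDerivAt.comp t (hγ t)).hasFDerivAt
  refine h1.hasDerivAt.congr_deriv ?_
  have h3 : ((1 : ℝ →L[ℝ] ℝ).smulRight (show Model 3 from reeb α (γ t))) (1 : ℝ) =
    (show Model 3 from reeb α (γ t)) := one_smul ℝ (show Model 3 from reeb α (γ t))
  exact congrArg (show Model 3 →L[ℝ] H from mfderiv (𝓡 3) 𝓘(ℝ, H) φ (γ t)) h3

lemma tendsto_extChartAt_prod (z : M) :
    Tendsto (fun p : M × M => (extChartAt (𝓡 3) z p.1, extChartAt (𝓡 3) z p.2)) (𝓝 (z, z))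
      (𝓝 (extChartAt (𝓡 3) z z, extChartAt (𝓡 3) z z)) := by
  rw [nhds_prod_eq, nhds_prod_eq]
  exact (continuousAt_extChartAt z).tendsto.prodMap (continuousAt_extChartAt z).tendsto

lemma eventually_diag_of_chart {z : M} {P : M × M → Prop}
    (h : ∀ᶠ p : Model 3 × Model 3 in 𝓝 (extChartAt (𝓡 3) z z, extChartAt (𝓡 3) z z),
      P (chartInv z p.1, chartInv z p.2)) : ∀ᶠ p in 𝓝 (z, z), P p := by
  have hs : ∀ᶠ p : M × M in 𝓝 (z, z), p.1 ∈ (extChartAt (𝓡 3) z).source ∧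
      p.2 ∈ (extChartAt (𝓡 3) z).source :=
    prod_mem_nhds (extChartAt_source_mem_nhds z) (extChartAt_source_mem_nhds z)
  filter_upwards [(tendsto_extChartAt_prod z).eventually h, hs] with p hp h2
  rwa [chartInv_extChartAt h2.1, chartInv_extChartAt h2.2] at hp

/-- A property that holds near the diagonal holds for all pairs of points with close images under an
injective continuous map. -/
lemma exists_pos_forall_of_diag [CompactSpace M] {F : M → H} (hF : Continuous F)
    (hinj : Function.Injective F) {P : M × M → Prop} (h : ∀ z, ∀ᶠ p in 𝓝 (z, z), P p) :
    ∃ ε > 0, ∀ x y, ‖F x - F y‖ < ε → P (x, y) := by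
  -- This compact set misses the diagonal, so by injectivity ‖F x - F y‖ has a positive lower bound
  -- on it.
  have hK : IsCompact (interior {p | P p})ᶜ := isOpen_interior.isClosed_compl.isCompact
  have hc : ContinuousOn (fun p : M × M => ‖F p.1 - F p.2‖) (interior {p | P p})ᶜ := by fun_prop
  obtain ⟨ε, hε, hmin⟩ := hK.exists_forall_le' hc (a := 0) fun p hp => by
    rw [norm_pos_iff, sub_ne_zero]
    intro he
    have h1 := hinj he
    refine hp ?_
    rw [mem_interior_iff_mem_nhds, ← Prod.mk.eta (p := p), ← h1]
    exact h p.1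
  refine ⟨ε, hε, fun x y hxy => ?_⟩
  by_contra hn
  exact absurd (hmin (x, y) fun hi => hn (interior_subset hi)) (not_le.2 hxy)

end DirDeriv

section BilinearExtension

variable {E G : Type*} [NormedAddCommGroup E] [NormedSpace ℝ E] [FiniteDimensional ℝ E]
  [NormedAddCommGroup G] [NormedSpace ℝ G] [FiniteDimensional ℝ G]

/-- Convexity of the fibrewise condition is what allows local extensions to be glued by a partition
of unity. -/
lemma convex_setOf_bilin_eq {V : Type*} (a : V → G) (r : V → V → ℝ) :
    Convex ℝ {B : G →L[ℝ] G →L[ℝ] ℝ | ∀ v w, B (a v) (a w) = r v w} := by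
  intro B₁ h₁ B₂ h₂ x y _ _ hxy v w
  have e1 := h₁ v w
  have e2 := h₂ v w
  rw [add_apply, add_apply, smul_apply, smul_apply, smul_apply, smul_apply, e1, e2, smul_eq_mul,
    smul_eq_mul, ← add_mul, hxy, one_mul]

/-- Compose p, s and b with a smooth left inverse of df. -/
lemma exists_bilin_extension {f : E → G} {c : E} (hf : ContDiffAt ℝ ∞ f c)
    (hinj : Function.Injective (fderiv ℝ f c)) {b p s : E → E →L[ℝ] ℝ} (hb : ContDiffAt ℝ ∞ b c)
    (hp : ContDiffAt ℝ ∞ p c) (hs : ContDiffAt ℝ ∞ s c) :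
    ∃ A : E → G →L[ℝ] G →L[ℝ] ℝ, ContDiffAt ℝ ∞ A c ∧ ∀ᶠ u in 𝓝 c, ∀ v w,
      A u (fderiv ℝ f u v) (fderiv ℝ f u w) = p u v * p u w - s u v * s u w - b u v * b u w := by
  obtain ⟨L, hL, hLf⟩ := exists_smooth_leftInverse hf hinj
  have hcomp : ∀ {a : E → E →L[ℝ] ℝ}, ContDiffAt ℝ ∞ a c →
      ContDiffAt ℝ ∞ (fun u => ((a u).comp (L u)).smulRight ((a u).comp (L u))) c :=
    fun ha => (ha.clm_comp hL).smulRight (ha.clm_comp hL)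
  refine ⟨fun u => ((p u).comp (L u)).smulRight ((p u).comp (L u)) -
    ((s u).comp (L u)).smulRight ((s u).comp (L u)) -
    ((b u).comp (L u)).smulRight ((b u).comp (L u)), ((hcomp hp).sub (hcomp hs)).sub (hcomp hb), ?_⟩
  filter_upwards [hLf] with u hu v w
  simp only [sub_apply, ContinuousLinearMap.smulRight_apply, smul_apply,
    ContinuousLinearMap.comp_apply, smul_eq_mul, hu]

end BilinearExtension

section FormExtension

variable {M : Type*} [TopologicalSpace M] [ChartedSpace (Model 3) M] [IsManifold (𝓡 3) ∞ M]
variable {μ : ℝ} {α : OneForm M} {q : ∀ x : M, TangentSpace (𝓡 3) x → ℂ}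
variable {G : Type*} [NormedAddCommGroup G] [NormedSpace ℝ G] [FiniteDimensional ℝ G]

lemma injective_fderiv_comp_chartInv {F : M → G} {z : M} {u : Model 3}
    (hu : u ∈ (extChartAt (𝓡 3) z).target) (hF : MDifferentiableAt (𝓡 3) 𝓘(ℝ, G) F (chartInv z u))
    (hinj : Function.Injective (mfderiv (𝓡 3) 𝓘(ℝ, G) F (chartInv z u))) :
    Function.Injective (fderiv ℝ (fun u => F (chartInv z u)) u) := fun v w hvw => by
  rw [fderiv_comp_chartInv hu hF, fderiv_comp_chartInv hu hF] at hvw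
  exact chartInvDeriv_injective hu (hinj hvw)

/-- Re q = p² - s², so polarizing Re q gives a bilinear form that is independent of the sign choice
and hence global. -/
lemma funInChart_polar {z : M} {u : Model 3} {p s : Model 3 → Model 3 →L[ℝ] ℝ}
    (hq : ∀ v, funInChart q z u v = ((p u v : ℂ) + s u v * Complex.I) ^ 2) (v w : Model 3) :
    ((funInChart q z u (v + w)).re - (funInChart q z u v).re - (funInChart q z u w).re) / 2 -
      formInChart α z u v * formInChart α z u w =
      p u v * p u w - s u v * s u w - formInChart α z u v * formInChart α z u w := by
  rw [hq, hq, hq, re_sq_add_mul_I, re_sq_add_mul_I, re_sq_add_mul_I, map_add, map_add]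
  ring

/-- The bilinear forms on the target of a map `F` that restrict along `F` to the polarization of
`Re q - α²`. -/
def formExtension (α : OneForm M) (q : ∀ x : M, TangentSpace (𝓡 3) x → ℂ) (F : M → G) (y : M) :
    Set (G →L[ℝ] G →L[ℝ] ℝ) :=
  {B | ∀ v w : TangentSpace (𝓡 3) y,
    B (mfderiv (𝓡 3) 𝓘(ℝ, G) F y v : G) (mfderiv (𝓡 3) 𝓘(ℝ, G) F y w : G) =
      ((q y (v + w)).re - (q y v).re - (q y w).re) / 2 - α y v * α y w}

lemma convex_formExtension (F : M → G) (y : M) : Convex ℝ (formExtension α q F y) :=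
  convex_setOf_bilin_eq (G := G) (V := TangentSpace (𝓡 3) y)
    (fun v => show G from mfderiv (𝓡 3) 𝓘(ℝ, G) F y v)
    fun v w => ((q y (v + w)).re - (q y v).re - (q y w).re) / 2 - α y v * α y w

lemma mem_formExtension_chartInv {F : M → G} {z : M} {u : Model 3}
    (hu : u ∈ (extChartAt (𝓡 3) z).target)
    (hF : MDifferentiableAt (𝓡 3) 𝓘(ℝ, G) F (chartInv z u)) {A : G →L[ℝ] G →L[ℝ] ℝ} :
    A ∈ formExtension α q F (chartInv z u) ↔ ∀ v w : Model 3,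
      A (fderiv ℝ (fun u => F (chartInv z u)) u v) (fderiv ℝ (fun u => F (chartInv z u)) u w) =
        ((funInChart q z u (v + w)).re - (funInChart q z u v).re - (funInChart q z u w).re) / 2 -
          formInChart α z u v * formInChart α z u w := by
  constructor
  · intro h v w
    rw [fderiv_comp_chartInv hu hF, fderiv_comp_chartInv hu hF]
    refine (h _ _).trans ?_
    rw [← map_add]
    rfl
  · intro h v w
    obtain ⟨v, rfl⟩ := chartInvDeriv_surjective hu v
    obtain ⟨w, rfl⟩ := chartInvDeriv_surjective hu w
    have e1 := h v w
    rw [fderiv_comp_chartInv hu hF, fderiv_comp_chartInv hu hF] at e1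
    refine e1.trans ?_
    rw [← map_add]
    rfl

lemma exists_form_extension_nhds {F : M → G} (hF : ContMDiff (𝓡 3) 𝓘(ℝ, G) ∞ F)
    (hinj : ∀ x, Function.Injective (mfderiv (𝓡 3) 𝓘(ℝ, G) F x)) {z : M} (h : HasGermAt μ α q z) :
    ∃ U ∈ 𝓝 z, ∃ A : M → G →L[ℝ] G →L[ℝ] ℝ,
      ContMDiffOn (𝓡 3) 𝓘(ℝ, G →L[ℝ] G →L[ℝ] ℝ) 1 A U ∧ ∀ y ∈ U, A y ∈ formExtension α q F y := by
  obtain ⟨p, s, hg, hq⟩ := h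
  set c := extChartAt (𝓡 3) z z
  have hct : c ∈ (extChartAt (𝓡 3) z).target := mem_extChartAt_target z
  have hf : ContDiffAt ℝ ∞ (fun u => F (chartInv z u)) c :=
    contDiffAt_comp_chartInv le_rfl hct (hF _)
  have hmd : ∀ y, MDifferentiableAt (𝓡 3) 𝓘(ℝ, G) F y := fun y =>
    (hF y).mdifferentiableAt (by simp)
  obtain ⟨A, hAs, hA⟩ := exists_bilin_extension hf
    (injective_fderiv_comp_chartInv hct (hmd _) (hinj _)) hg.smooth_b hg.smooth_p hg.smooth_s
  have hgM : ContMDiffAt (𝓡 3) 𝓘(ℝ, G →L[ℝ] G →L[ℝ] ℝ) 1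
      (fun y => A (extChartAt (𝓡 3) z y)) z :=
    (contMDiffAt_comp_extChartAt_iff.2 hAs).of_le (by simp)
  have hev := (contMDiffAt_iff_contMDiffAt_nhds (by simp)).1 hgM
  refine ⟨_, inter_mem hev (inter_mem ((continuousAt_extChartAt (I := 𝓡 3) z).eventually
      ((hA.and hq).and (eventually_mem_target z))) (extChartAt_source_mem_nhds (I := 𝓡 3) z)),
    fun y => A (extChartAt (𝓡 3) z y), fun y hy => hy.1.contMDiffWithinAt, fun y hy => ?_⟩
  obtain ⟨-, ⟨⟨h1, h2⟩, h3⟩, h4⟩ := hy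
  have h5 := (mem_formExtension_chartInv h3 (hmd _)).2 fun v w =>
    (h1 v w).trans (funInChart_polar (α := α) h2 v w).symm
  rwa [chartInv_extChartAt h4] at h5

/-- The quadratic form `p² - s² - α²` on an embedded manifold extends to the ambient space. -/
lemma exists_form_extension [T2Space M] [CompactSpace M] (h : ∀ x, HasGermAt μ α q x) {F : M → G}
    (hF : ContMDiff (𝓡 3) 𝓘(ℝ, G) ∞ F)
    (hinj : ∀ x, Function.Injective (mfderiv (𝓡 3) 𝓘(ℝ, G) F x)) :
    ∃ B : M → G →L[ℝ] G →L[ℝ] ℝ, ContMDiff (𝓡 3) 𝓘(ℝ, G →L[ℝ] G →L[ℝ] ℝ) 1 B ∧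
      ∀ y, B y ∈ formExtension α q F y := by
  obtain ⟨B, hB⟩ := exists_contMDiffMap_forall_mem_convex_of_local (n := 1) (𝓡 3)
    (fun y => convex_formExtension (α := α) (q := q) F y)
    fun z => exists_form_extension_nhds hF hinj (h z)
  exact ⟨B, B.contMDiff, hB⟩

end FormExtension

/-! ### Expansion of small differences under the time-one map -/

section LocalGrowth

variable {M : Type*} [TopologicalSpace M] [ChartedSpace (Model 3) M] [IsManifold (𝓡 3) ∞ M]
variable {μ : ℝ} {α : OneForm M} {q : ∀ x : M, TangentSpace (𝓡 3) x → ℂ}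
variable {G : Type*} [NormedAddCommGroup G] [NormedSpace ℝ G] [FiniteDimensional ℝ G]

/-- The right-hand side equals (2μ - λ)p² + (2μ + λ)s² + λb², which is definite for 0 < λ < 2μ. The
term -b² is included in the quadratic form precisely to gain this positivity in the flow direction.
-/
lemma AnosovGerm.exists_growth_rate {b p s : Model 3 → Model 3 →L[ℝ] ℝ} {c : Model 3}
    (h : AnosovGerm μ b p s c) {lam : ℝ} (h0 : 0 < lam) (h1 : lam < 2 * μ) :
    ∃ κ > 0, ∀ v, κ * ‖v‖ ^ 2 ≤ 2 * μ * ((p c v) ^ 2 + (s c v) ^ 2) -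
      lam * (p c v * p c v - s c v * s c v - b c v * b c v) := by
  set T : Model 3 →L[ℝ] Model 3 →L[ℝ] ℝ := (2 * μ - lam) • (p c).smulRight (p c) +
    (2 * μ + lam) • (s c).smulRight (s c) + lam • (b c).smulRight (b c)
  have hT : ∀ v, T v v = (2 * μ - lam) * (p c v) ^ 2 + (2 * μ + lam) * (s c v) ^ 2 +
      lam * (b c v) ^ 2 := fun v => by
    simp only [T, add_apply, smul_apply, ContinuousLinearMap.smulRight_apply, smul_eq_mul]
    ring
  obtain ⟨κ, hκ, hk⟩ := exists_pos_mul_sq_le (T := T) fun v hv => by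
    rw [hT]
    have a1 : 0 < 2 * μ - lam := by linarith
    have a2 : 0 < 2 * μ + lam := by linarith
    by_contra hn
    have b1 := mul_nonneg a1.le (sq_nonneg (p c v))
    have b2 := mul_nonneg a2.le (sq_nonneg (s c v))
    have b3 := mul_nonneg h0.le (sq_nonneg (b c v))
    have c1 : (2 * μ - lam) * (p c v) ^ 2 = 0 := by linarith
    have c2 : (2 * μ + lam) * (s c v) ^ 2 = 0 := by linarith
    have c3 : lam * (b c v) ^ 2 = 0 := by linarith
    refine hv (h.coframe v ?_ ?_ ?_)
    · simpa [h0.ne'] using c3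
    · simpa [a1.ne'] using c1
    · simpa [a2.ne'] using c2
  refine ⟨κ, hκ, fun v => (hk v).trans_eq ?_⟩
  rw [hT]
  ring

lemma ContDiffAt.fderiv_apply_field {f : Model 3 → G} {X : Model 3 → Model 3} {c : Model 3}
    (hf : ContDiffAt ℝ ∞ f c) (hX : ContDiffAt ℝ ∞ X c) :
    ContDiffAt ℝ ∞ (fun u => fderiv ℝ f u (X u)) c :=
  (hf.fderiv_right (by simp)).clm_apply hX

lemma eventually_formExtension_chart {F : M → G} (hF : ContMDiff (𝓡 3) 𝓘(ℝ, G) ∞ F)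
    {B : M → G →L[ℝ] G →L[ℝ] ℝ} (hB : ∀ y, B y ∈ formExtension α q F y) {z : M}
    {p s : Model 3 → Model 3 →L[ℝ] ℝ}
    (hq : ∀ᶠ u in 𝓝 (extChartAt (𝓡 3) z z), ∀ v,
      funInChart q z u v = ((p u v : ℂ) + s u v * Complex.I) ^ 2) :
    ∀ᶠ u in 𝓝 (extChartAt (𝓡 3) z z), ∀ v w,
      B (chartInv z u) (fderiv ℝ (fun u => F (chartInv z u)) u v)
        (fderiv ℝ (fun u => F (chartInv z u)) u w) =
      p u v * p u w - s u v * s u w - formInChart α z u v * formInChart α z u w := by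
  filter_upwards [hq, eventually_mem_target z] with u h1 h2 v w
  rw [← funInChart_polar h1 v w]
  exact (mem_formExtension_chartInv h2 ((hF _).mdifferentiableAt (by simp))).1 (hB _) v w

/-- The quadratic form of differences grows near the diagonal. -/
lemma eventually_growth (h : ∀ x, HasGermAt μ α q x) {F : M → G}
    (hF : ContMDiff (𝓡 3) 𝓘(ℝ, G) ∞ F) {B : M → G →L[ℝ] G →L[ℝ] ℝ}
    (hBs : ContMDiff (𝓡 3) 𝓘(ℝ, G →L[ℝ] G →L[ℝ] ℝ) 1 B)
    (hB : ∀ y, B y ∈ formExtension α q F y) {lam : ℝ} (h0 : 0 < lam) (h1 : lam < 2 * μ) (z : M) :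
    ∀ᶠ p : M × M in 𝓝 (z, z), lam * B p.1 (F p.1 - F p.2) (F p.1 - F p.2) ≤
      reebDeriv α B p.1 (F p.1 - F p.2) (F p.1 - F p.2) +
      B p.1 (reebDeriv α F p.1 - reebDeriv α F p.2) (F p.1 - F p.2) +
      B p.1 (F p.1 - F p.2) (reebDeriv α F p.1 - reebDeriv α F p.2) := by
  obtain ⟨p, s, hg, hq⟩ := h z
  obtain ⟨X, Y, Z, hX, -, -, hfr⟩ := hg.exists_frame
  have hct : extChartAt (𝓡 3) z z ∈ (extChartAt (𝓡 3) z).target := mem_extChartAt_target z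
  have hf : ContDiffAt ℝ ∞ (fun u => F (chartInv z u)) (extChartAt (𝓡 3) z z) :=
    contDiffAt_comp_chartInv le_rfl hct (hF _)
  have hBc : ContDiffAt ℝ 1 (fun u => B (chartInv z u)) (extChartAt (𝓡 3) z z) :=
    contDiffAt_comp_chartInv (by simp) hct (hBs _)
  have hw := eventually_formExtension_chart hF hB hq
  obtain ⟨κ, hκ, hk⟩ := hg.exists_growth_rate h0 h1
  have hBd : ContinuousAt (fun u => fderiv ℝ (fun u => B (chartInv z u)) u (X u))
      (extChartAt (𝓡 3) z z) :=
    ((hBc.fderiv_right (m := 0) (by simp)).continuousAt).clm_apply hX.continuousAt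
  have key := eventually_growth_of_pos (hf.hasStrictFDerivAt (by simp))
    ((hf.fderiv_apply_field hX).hasStrictFDerivAt (by simp)) hBc.continuousAt hBd hκ
    (lam := lam) (fun v => by
      have e1 := hg.lie_quadratic hX hfr hf (hBc.differentiableAt (by simp)) hw v
      have e2 := hw.self_of_nhds v v
      rw [e1, e2]
      exact hk v)
  have hr := hg.eventually_reeb h hfr
  have hFd := eventually_reebDeriv (φ := F) (hF.of_le (by simp)) hr
  have hBd' := eventually_reebDeriv hBs hr
  refine eventually_diag_of_chart ?_
  filter_upwards [key, (hFd.and hBd').prod_nhds hFd] with p hp ⟨⟨e1, e2⟩, e3⟩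
  rw [e1, e2, e3]
  exact hp

/-- The quadratic form is positive on differences along the expanding direction. -/
lemma exists_cone (h : ∀ x, HasGermAt μ α q x) {F : M → G}
    (hF : ContMDiff (𝓡 3) 𝓘(ℝ, G) ∞ F) {B : M → G →L[ℝ] G →L[ℝ] ℝ}
    (hBs : ContMDiff (𝓡 3) 𝓘(ℝ, G →L[ℝ] G →L[ℝ] ℝ) 1 B)
    (hB : ∀ y, B y ∈ formExtension α q F y) (z : M) :
    ∃ Y : Model 3, ∃ U ∈ 𝓝 (extChartAt (𝓡 3) z z), ∀ u ∈ U, ∀ v ∈ U, ∀ t : ℝ, u - v = t • Y →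
      t ^ 2 / 2 ≤ B (chartInv z u) (F (chartInv z u) - F (chartInv z v))
        (F (chartInv z u) - F (chartInv z v)) := by
  obtain ⟨p, s, hg, hq⟩ := h z
  obtain ⟨X, Y, Z, -, -, -, hfr⟩ := hg.exists_frame
  have hct : extChartAt (𝓡 3) z z ∈ (extChartAt (𝓡 3) z).target := mem_extChartAt_target z
  have hf : ContDiffAt ℝ ∞ (fun u => F (chartInv z u)) (extChartAt (𝓡 3) z z) :=
    contDiffAt_comp_chartInv le_rfl hct (hF _)
  have hBc : ContDiffAt ℝ 1 (fun u => B (chartInv z u)) (extChartAt (𝓡 3) z z) :=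
    contDiffAt_comp_chartInv (by simp) hct (hBs _)
  have hw := (eventually_formExtension_chart hF hB hq).self_of_nhds
  have hfr0 := hfr.self_of_nhds
  have key := eventually_cone_of_pos (hf.hasStrictFDerivAt (by simp)) hBc.continuousAt
    (Y := Y (extChartAt (𝓡 3) z z)) (by
      rw [hw, hfr0.pY, hfr0.sY, hfr0.bY]
      norm_num)
  rw [nhds_prod_eq] at key
  obtain ⟨U, hU, hsub⟩ := Filter.mem_prod_same_iff.1 key
  exact ⟨_, U, hU, fun u hu v hv => hsub (mk_mem_prod hu hv)⟩

lemma exists_reebDeriv_lipschitz_diag (h : ∀ x, HasGermAt μ α q x) {F : M → G}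
    (hF : ContMDiff (𝓡 3) 𝓘(ℝ, G) ∞ F)
    (hinj : ∀ x, Function.Injective (mfderiv (𝓡 3) 𝓘(ℝ, G) F x)) (z : M) :
    ∃ L : ℝ, ∀ᶠ p : M × M in 𝓝 (z, z),
      ‖reebDeriv α F p.1 - reebDeriv α F p.2‖ ≤ L * ‖F p.1 - F p.2‖ := by
  obtain ⟨X, hX, hr⟩ := exists_reeb_chart h z
  have hct : extChartAt (𝓡 3) z z ∈ (extChartAt (𝓡 3) z).target := mem_extChartAt_target z
  have hf : ContDiffAt ℝ ∞ (fun u => F (chartInv z u)) (extChartAt (𝓡 3) z z) :=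
    contDiffAt_comp_chartInv le_rfl hct (hF _)
  obtain ⟨L, hL⟩ := eventually_norm_sub_le_of_injective (hf.hasStrictFDerivAt (by simp))
    (injective_fderiv_comp_chartInv hct ((hF _).mdifferentiableAt (by simp)) (hinj _))
    ((hf.fderiv_apply_field hX).hasStrictFDerivAt (by simp))
  have hFd := eventually_reebDeriv (φ := F) (hF.of_le (by simp)) hr
  refine ⟨L, eventually_diag_of_chart ?_⟩
  filter_upwards [hL, hFd.prod_nhds hFd] with p hp ⟨e1, e3⟩
  rw [e1, e3]
  exact hp

lemma continuous_reebDeriv (h : ∀ x, HasGermAt μ α q x) {F : M → G}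
    (hF : ContMDiff (𝓡 3) 𝓘(ℝ, G) ∞ F) : Continuous (reebDeriv α F) := by
  refine continuous_iff_continuousAt.2 fun z => ?_
  obtain ⟨X, hX, hr⟩ := exists_reeb_chart h z
  have hct : extChartAt (𝓡 3) z z ∈ (extChartAt (𝓡 3) z).target := mem_extChartAt_target z
  have hf : ContDiffAt ℝ ∞ (fun u => F (chartInv z u)) (extChartAt (𝓡 3) z z) :=
    contDiffAt_comp_chartInv le_rfl hct (hF _)
  have hFd := eventually_reebDeriv (φ := F) (hF.of_le (by simp)) hr
  have h1 : ContinuousAt (fun u => reebDeriv α F (chartInv z u)) (extChartAt (𝓡 3) z z) :=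
    (hf.fderiv_apply_field hX).continuousAt.congr (hFd.mono fun u hu => hu.symm)
  refine (h1.comp (continuousAt_extChartAt (I := 𝓡 3) z)).congr ?_
  filter_upwards [extChartAt_source_mem_nhds (I := 𝓡 3) z] with y hy
  exact congrArg (reebDeriv α F) (chartInv_extChartAt hy)

/-- The Reeb field, seen in an embedding, is Lipschitz. -/
lemma exists_reebDeriv_lipschitz [CompactSpace M] (h : ∀ x, HasGermAt μ α q x) {F : M → G}
    (hF : ContMDiff (𝓡 3) 𝓘(ℝ, G) ∞ F) (hFi : Function.Injective F)
    (hinj : ∀ x, Function.Injective (mfderiv (𝓡 3) 𝓘(ℝ, G) F x)) :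
    ∃ L : ℝ, ∀ x y, ‖reebDeriv α F x - reebDeriv α F y‖ ≤ L * ‖F x - F y‖ := by
  have hV := continuous_reebDeriv h hF
  have hFc := hF.continuous
  have hcov : ∃ L : ℝ, ∀ p ∈ (univ : Set (M × M)),
      ‖reebDeriv α F p.1 - reebDeriv α F p.2‖ ≤ L * ‖F p.1 - F p.2‖ := by
    -- Near the diagonal the bound comes from F being an immersion; elsewhere ‖F x - F y‖ is bounded
    -- below because F is injective.
    refine isCompact_univ.induction_on ⟨0, fun p hp => hp.elim⟩ (fun s t hst ⟨L, hL⟩ =>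
      ⟨L, fun p hp => hL p (hst hp)⟩) (fun s t ⟨L, hL⟩ ⟨L', hL'⟩ => ⟨max L L', ?_⟩) ?_
    · rintro p (hp | hp)
      · exact (hL p hp).trans (mul_le_mul_of_nonneg_right (le_max_left _ _) (norm_nonneg _))
      · exact (hL' p hp).trans (mul_le_mul_of_nonneg_right (le_max_right _ _) (norm_nonneg _))
    · rintro ⟨x, y⟩ -
      rw [nhdsWithin_univ]
      by_cases hxy : x = y
      · subst hxy
        obtain ⟨L, hL⟩ := exists_reebDeriv_lipschitz_diag h hF hinj x
        exact ⟨_, hL, L, fun p hp => hp⟩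
      · have hpos : 0 < ‖F x - F y‖ := norm_pos_iff.2 (sub_ne_zero.2 fun he => hxy (hFi he))
        have c1 : Continuous fun p : M × M => ‖F p.1 - F p.2‖ := by fun_prop
        have c2 : Continuous fun p : M × M => ‖reebDeriv α F p.1 - reebDeriv α F p.2‖ := by fun_prop
        have e1 := (c1.tendsto (x, y)).eventually (lt_mem_nhds (half_lt_self hpos))
        have e2 := (c2.tendsto (x, y)).eventually (gt_mem_nhds (lt_add_one _))
        refine ⟨_, e1.and e2, (‖reebDeriv α F x - reebDeriv α F y‖ + 1) / (‖F x - F y‖ / 2), ?_⟩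
        rintro p ⟨h1, h2⟩
        refine h2.le.trans ?_
        rw [div_mul_eq_mul_div, le_div_iff₀ (half_pos hpos)]
        exact mul_le_mul_of_nonneg_left h1.le (by positivity)
  obtain ⟨L, hL⟩ := hcov
  exact ⟨L, fun x y => hL (x, y) (mem_univ _)⟩

end LocalGrowth

section Expansion

variable {G : Type*} [NormedAddCommGroup G] [NormedSpace ℝ G]

/-- The function e^{-λt}w(t) is monotone. No sign of w is assumed, which matters because the
quadratic form is indefinite. -/
lemma exp_mul_le_of_deriv {w w' : ℝ → ℝ} {lam : ℝ} (hw : ∀ t, HasDerivAt w (w' t) t)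
    (h : ∀ t ∈ Icc (0 : ℝ) 1, lam * w t ≤ w' t) : Real.exp lam * w 0 ≤ w 1 := by
  have hd : ∀ t, HasDerivAt (fun t => Real.exp (-(lam * t)) * w t)
      (Real.exp (-(lam * t)) * (w' t - lam * w t)) t := fun t => by
    have h1 : HasDerivAt (fun t : ℝ => Real.exp (-(lam * t))) (Real.exp (-(lam * t)) * -(lam * 1)) t :=
      (((hasDerivAt_id t).const_mul lam).neg).exp
    refine (h1.mul (hw t)).congr_deriv ?_
    ring
  have hmono := monotoneOn_of_deriv_nonneg (convex_Icc (0 : ℝ) 1)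
    (fun t _ => (hd t).continuousAt.continuousWithinAt)
    (fun t _ => (hd t).differentiableAt.differentiableWithinAt) fun t ht => by
      rw [(hd t).deriv]
      exact mul_nonneg (Real.exp_pos _).le (sub_nonneg.2 (h t (interior_subset ht)))
  have h2 := hmono (left_mem_Icc.2 zero_le_one) (right_mem_Icc.2 zero_le_one) zero_le_one
  simp only [mul_zero, neg_zero, Real.exp_zero, one_mul, mul_one] at h2
  rw [Real.exp_neg] at h2
  have h3 := mul_le_mul_of_nonneg_left h2 (Real.exp_pos lam).le
  rwa [← mul_assoc, mul_inv_cancel₀ (Real.exp_pos lam).ne', one_mul] at h3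

lemma norm_le_exp_mul_of_deriv {d d' : ℝ → G} {L : ℝ} (hL : 0 ≤ L)
    (hd : ∀ t, HasDerivAt d (d' t) t) (h : ∀ t, ‖d' t‖ ≤ L * ‖d t‖) {t : ℝ}
    (ht : t ∈ Icc (0 : ℝ) 1) : ‖d t‖ ≤ ‖d 0‖ * Real.exp L := by
  have h1 := norm_le_gronwallBound_of_norm_deriv_right_le (f := d) (f' := d') (a := 0) (b := 1)
    (K := L) (ε := 0) (δ := ‖d 0‖) (fun t _ => (hd t).continuousAt.continuousWithinAt)
    (fun t _ => (hd t).hasDerivWithinAt) le_rfl (fun t _ => by simpa using h t) t ht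
  rw [gronwallBound_ε0, sub_zero] at h1
  refine h1.trans (mul_le_mul_of_nonneg_left (Real.exp_le_exp.2 ?_) (norm_nonneg _))
  exact mul_le_of_le_one_right hL ht.2

variable {M : Type*} [TopologicalSpace M] [ChartedSpace (Model 3) M] [IsManifold (𝓡 3) ∞ M]
variable {μ : ℝ} {α : OneForm M} {q : ∀ x : M, TangentSpace (𝓡 3) x → ℂ}
variable [FiniteDimensional ℝ G]

/-- The time-one map of the Reeb flow expands the quadratic form of small differences. -/
lemma exists_expansion [T2Space M] [CompactSpace M] (h : ∀ x, HasGermAt μ α q x) {F : M → G}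
    (hF : ContMDiff (𝓡 3) 𝓘(ℝ, G) ∞ F) (hFi : Function.Injective F)
    (hinj : ∀ x, Function.Injective (mfderiv (𝓡 3) 𝓘(ℝ, G) F x)) {B : M → G →L[ℝ] G →L[ℝ] ℝ}
    (hBs : ContMDiff (𝓡 3) 𝓘(ℝ, G →L[ℝ] G →L[ℝ] ℝ) 1 B)
    (hB : ∀ y, B y ∈ formExtension α q F y) {lam : ℝ} (h0 : 0 < lam) (h1 : lam < 2 * μ) :
    ∃ ε > 0, ∀ x y, ‖F x - F y‖ < ε → Real.exp lam * B x (F x - F y) (F x - F y) ≤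
      B (reebFlow α 1 x) (F (reebFlow α 1 x) - F (reebFlow α 1 y))
        (F (reebFlow α 1 x) - F (reebFlow α 1 y)) := by
  obtain ⟨L, hL⟩ := exists_reebDeriv_lipschitz h hF hFi hinj
  obtain ⟨ε, hε, hgr⟩ := exists_pos_forall_of_diag hF.continuous hFi
    fun z => eventually_growth h hF hBs hB h0 h1 z
  -- Over unit time the Lipschitz bound lets two orbits separate by a factor of at most e^{max L 0},
  -- so they stay in the region where growth is known.
  refine ⟨ε * Real.exp (-(max L 0)), by positivity, fun x y hxy => ?_⟩
  obtain ⟨γ, hγ0, hγ1, hγ⟩ := exists_integralCurve_reebFlow h x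
  obtain ⟨η, hη0, hη1, hη⟩ := exists_integralCurve_reebFlow h y
  have hF1 : ContMDiff (𝓡 3) 𝓘(ℝ, G) 1 F := hF.of_le (by simp)
  have hd : ∀ t, HasDerivAt (fun t => F (γ t) - F (η t))
      (reebDeriv α F (γ t) - reebDeriv α F (η t)) t := fun t =>
    (hasDerivAt_comp_integralCurve hF1 hγ t).sub (hasDerivAt_comp_integralCurve hF1 hη t)
  have hsmall : ∀ t ∈ Icc (0 : ℝ) 1, ‖F (γ t) - F (η t)‖ < ε := fun t ht => by
    have h2 := norm_le_exp_mul_of_deriv (le_max_right L 0) hd (fun t => (hL _ _).trans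
      (mul_le_mul_of_nonneg_right (le_max_left _ _) (norm_nonneg _))) ht
    refine h2.trans_lt ?_
    rw [hγ0, hη0]
    refine (mul_lt_mul_of_pos_right hxy (Real.exp_pos (max L 0))).trans_eq ?_
    rw [mul_assoc, ← Real.exp_add, neg_add_cancel, Real.exp_zero, mul_one]
  have hw : ∀ t, HasDerivAt (fun t => B (γ t) (F (γ t) - F (η t)) (F (γ t) - F (η t)))
      (reebDeriv α B (γ t) (F (γ t) - F (η t)) (F (γ t) - F (η t)) +
      B (γ t) (reebDeriv α F (γ t) - reebDeriv α F (η t)) (F (γ t) - F (η t)) +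
      B (γ t) (F (γ t) - F (η t)) (reebDeriv α F (γ t) - reebDeriv α F (η t))) t := fun t => by
    refine (((hasDerivAt_comp_integralCurve hBs hγ t).clm_apply (hd t)).clm_apply
      (hd t)).congr_deriv ?_
    rw [add_apply]
  have key := exp_mul_le_of_deriv hw fun t ht => hgr _ _ (hsmall t ht)
  rwa [hγ0, hη0, hγ1, hη1] at key

end Expansion

/-! ### Small cylinders and the entropy bound -/

section Cylinders

variable {M G : Type*} [NormedAddCommGroup G] [NormedSpace ℝ G]

lemma exp_mul_le_iterate {T : M → M} {F : M → G} {W : M → M → ℝ} {ε lam : ℝ}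
    (h : ∀ x y, ‖F x - F y‖ < ε → Real.exp lam * W x y ≤ W (T x) (T y)) (n : ℕ) {x y : M}
    (hxy : ∀ i < n, ‖F (T^[i] x) - F (T^[i] y)‖ < ε) :
    Real.exp (lam * n) * W x y ≤ W (T^[n] x) (T^[n] y) := by
  induction n with
  | zero => simp
  | succ n ih =>
    have h1 := ih fun i hi => hxy i (hi.trans n.lt_succ_self)
    have h2 := h _ _ (hxy n n.lt_succ_self)
    rw [Function.iterate_succ_apply', Function.iterate_succ_apply']
    refine le_trans ?_ h2
    have h3 := mul_le_mul_of_nonneg_left h1 (Real.exp_pos lam).le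
    refine le_trans (le_of_eq ?_) h3
    rw [← mul_assoc, ← Real.exp_add]
    push_cast
    ring_nf

variable [TopologicalSpace M]

/-- A compact space has a finite measurable partition into pieces with small image. -/
lemma exists_measurable_partition [CompactSpace M] [MeasurableSpace M] [OpensMeasurableSpace M]
    [Nonempty M] {F : M → G} (hF : Continuous F) {ε : ℝ} (hε : 0 < ε) :
    ∃ (k : ℕ) (P : M → Fin k), Measurable P ∧ ∀ x y, P x = P y → ‖F x - F y‖ < ε := by
  have hO : ∀ z : M, F ⁻¹' Metric.ball (F z) (ε / 2) ∈ 𝓝 z := fun z =>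
    hF.continuousAt.preimage_mem_nhds (Metric.ball_mem_nhds _ (half_pos hε))
  obtain ⟨t, -, ht⟩ := isCompact_univ.elim_nhds_subcover (fun z => F ⁻¹' Metric.ball (F z) (ε / 2))
    fun z _ => hO z
  set e := t.equivFin
  have hex : ∀ x : M, ∃ n : ℕ, ∃ hn : n < t.card,
      x ∈ F ⁻¹' Metric.ball (F (e.symm ⟨n, hn⟩)) (ε / 2) := fun x => by
    obtain ⟨z, hz, hx⟩ := mem_iUnion₂.1 (ht (mem_univ x))
    refine ⟨e ⟨z, hz⟩, (e ⟨z, hz⟩).2, ?_⟩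
    rw [Fin.eta, Equiv.symm_apply_apply]
    exact hx
  classical
  refine ⟨t.card, fun x => ⟨Nat.find (hex x), (Nat.find_spec (hex x)).1⟩, ?_, fun x y hxy => ?_⟩
  · have hm : Measurable fun x => Nat.find (hex x) := measurable_find hex fun n => by
      by_cases hn : n < t.card
      · simp only [hn, exists_true_left]
        exact (Metric.isOpen_ball.preimage hF).measurableSet
      · simp [hn]
    refine measurable_to_countable' fun j => ?_
    have : (fun x => (⟨Nat.find (hex x), (Nat.find_spec (hex x)).1⟩ : Fin t.card)) ⁻¹' {j} =
        (fun x => Nat.find (hex x)) ⁻¹' {(j : ℕ)} := by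
      ext x
      simp [Fin.ext_iff]
    rw [this]
    exact hm (measurableSet_singleton _)
  · have hn : Nat.find (hex x) = Nat.find (hex y) := congrArg Fin.val hxy
    obtain ⟨h1, h2⟩ := Nat.find_spec (hex x)
    obtain ⟨h3, h4⟩ := Nat.find_spec (hex y)
    have h5 : F y ∈ Metric.ball (F (e.symm ⟨_, h1⟩)) (ε / 2) := by
      simp only [hn]
      exact h4
    have h6 : F x ∈ Metric.ball (F (e.symm ⟨_, h1⟩)) (ε / 2) := h2
    rw [← dist_eq_norm]
    have h7 := dist_triangle_right (F x) (F y) (F (e.symm ⟨_, h1⟩))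
    rw [Metric.mem_ball] at h5 h6
    linarith

end Cylinders

section Volume

variable {M : Type*} [TopologicalSpace M] [ChartedSpace (Model 3) M] [IsManifold (𝓡 3) ∞ M]
variable {α : OneForm M}

/-- Sets on which a function that is quadratic along some direction is small have small volume. -/
lemma IsContactForm.exists_volume_le_sqrt [T2Space M] [CompactSpace M] [MeasurableSpace M]
    [BorelSpace M] (h : IsContactForm α) {W : M → M → ℝ} (hcone : ∀ z : M, ∃ Y : Model 3,
      ∃ U ∈ 𝓝 (extChartAt (𝓡 3) z z), ∀ u ∈ U, ∀ v ∈ U, ∀ t : ℝ, u - v = t • Y →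
        t ^ 2 / 2 ≤ W (chartInv z u) (chartInv z v)) :
    ∃ D : ℝ≥0∞, D ≠ (⊤ : ℝ≥0∞) ∧ ∀ (A : Set M) (δ : ℝ), IsClosed A →
      (∀ x ∈ A, ∀ y ∈ A, W x y ≤ δ) → contactVolume α A ≤ ENNReal.ofReal (Real.sqrt (2 * δ)) * D := by
  choose Y U hU hW using hcone
  obtain ⟨t, K, V, R, hK, hV⟩ := h.exists_volume_le hU
  refine ⟨∑ z ∈ t, K * volume (Metric.closedBall (extChartAt (𝓡 3) z z) (R z + ‖Y z‖)),
    ENNReal.sum_ne_top.2 fun z _ => ENNReal.mul_ne_top hK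
      (isCompact_closedBall _ _).measure_lt_top.ne, fun A δ hA hAW => ?_⟩
  rcases isEmpty_or_nonempty M with hM | ⟨⟨z₀⟩⟩
  · rw [eq_empty_of_isEmpty A, measure_empty]
    exact zero_le
  refine ((hV z₀).2.2.2.2 A hA.measurableSet).trans ?_
  rw [Finset.mul_sum]
  refine Finset.sum_le_sum fun z _ => ?_
  obtain ⟨hVc, hVs, hVU, hVR, -⟩ := hV z
  rw [mul_left_comm]
  refine mul_le_mul_right ?_ K
  have hcomp : IsCompact (extChartAt (𝓡 3) z '' (A ∩ V z)) :=
    (hA.inter hVc).isCompact.image_of_continuousOn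
      ((continuousOn_extChartAt (I := 𝓡 3) z).mono (inter_subset_right.trans hVs))
  refine measure_le_of_lines volume hcomp.measurableSet
    ((image_mono inter_subset_right).trans hVR) (Y z) fun u => ?_
  -- Two points of A on a line in the direction Y z, with parameters a and b, satisfy (a - b)²/2 ≤ W
  -- ≤ δ, so the trace on the line has diameter at most √(2δ).
  refine (Real.volume_le_diam _).trans (Metric.ediam_le fun a ha b hb => ?_)
  obtain ⟨x, hx, hxa⟩ := ha
  obtain ⟨y, hy, hyb⟩ := hb
  have h1 := hW z _ (hVU (mem_image_of_mem _ hx.2)) _ (hVU (mem_image_of_mem _ hy.2)) (a - b)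
    (by rw [hxa, hyb, sub_smul]; abel)
  rw [chartInv_extChartAt (hVs hx.2), chartInv_extChartAt (hVs hy.2)] at h1
  rw [edist_dist, Real.dist_eq]
  refine ENNReal.ofReal_le_ofReal (Real.le_sqrt_of_sq_le ?_)
  rw [sq_abs]
  linarith [hAW x hx.1 y hy.1]

end Volume

section Lower

variable {M : Type*} [TopologicalSpace M] [ChartedSpace (Model 3) M] [IsManifold (𝓡 3) ∞ M]
  [T2Space M] [CompactSpace M] [Nonempty M] [MeasurableSpace M] [BorelSpace M]
variable {μ : ℝ} {α : OneForm M} {q : ∀ x : M, TangentSpace (𝓡 3) x → ℂ}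

lemma IsContactForm.isProbabilityMeasure_liouvilleMeasure (h : IsContactForm α) :
    IsProbabilityMeasure (liouvilleMeasure α) :=
  ⟨ENNReal.inv_mul_cancel h.contactVolume_univ_ne_zero h.contactVolume_univ_ne_top⟩

/-- W is bounded above and grows by e^λ per step while the orbits stay close, so it is at most a
constant times e^{-λn} on an n-cylinder. As W controls squared lengths, the volume of the cylinder
decays like e^{-λn/2}. -/
lemma ofReal_half_le_liouvilleEntropy (h : ∀ x, HasGermAt μ α q x) {lam : ℝ} (h0 : 0 < lam)
    (h1 : lam < 2 * μ) : ENNReal.ofReal (lam / 2) ≤ liouvilleEntropy α := by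
  have hα := isContactForm_of_germ h
  have := hα.isProbabilityMeasure_liouvilleMeasure
  obtain ⟨m, F, hF, hFe, hinj⟩ := exists_embedding_euclidean_of_compact (I := 𝓡 3) (M := M)
  obtain ⟨B, hBs, hB⟩ := exists_form_extension h hF hinj
  have hBc := hBs.continuous
  have hFc := hF.continuous
  obtain ⟨ε, hε, hexp⟩ := exists_expansion h hF hFe.injective hinj hBs hB h0 h1
  obtain ⟨k, P, hP, hPε⟩ := exists_measurable_partition hFc hε
  set W : M → M → ℝ := fun x y => B x (F x - F y) (F x - F y)
  have hWc : Continuous fun p : M × M => W p.1 p.2 :=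
    ((hBc.comp continuous_fst).clm_apply (by fun_prop)).clm_apply (by fun_prop)
  obtain ⟨D, hD, hvol⟩ := hα.exists_volume_le_sqrt (W := W) fun z => exists_cone h hF hBs hB z
  obtain ⟨C, hC⟩ := (isCompact_range hWc).bddAbove
  have hC' : ∀ x y, W x y ≤ max C 0 := fun x y => (hC ⟨(x, y), rfl⟩).trans (le_max_left _ _)
  set a := Real.sqrt (2 * max C 0) * ((contactVolume α univ)⁻¹ * D).toReal
  have ha : 0 ≤ a := by positivity
  refine ofReal_le_measureEntropy (liouvilleMeasure α) (reebFlow α 1) hP (half_pos h0)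
    (c := Real.log (a + 1)) fun n c => ?_
  set S := {x | ∀ i : Fin n, P ((reebFlow α 1)^[i] x) = c i}
  have hS : ∀ x ∈ S, ∀ y ∈ S, W x y ≤ max C 0 * Real.exp (-(lam * n)) := fun x hx y hy => by
    have h2 := exp_mul_le_iterate (T := reebFlow α 1) (F := F) (W := W) (ε := ε) hexp n
      (x := x) (y := y) fun i hi => hPε _ _ ((hx ⟨i, hi⟩).trans (hy ⟨i, hi⟩).symm)
    rw [Real.exp_neg, ← div_eq_mul_inv, le_div_iff₀ (Real.exp_pos _), mul_comm]
    exact h2.trans (hC' _ _)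
  -- Passing to the closure gives a closed set with the same bound on W, as the volume estimate
  -- requires, without regularity of the flow map.
  have hcl : ∀ x ∈ closure S, ∀ y ∈ closure S, W x y ≤ max C 0 * Real.exp (-(lam * n)) :=
    fun x hx y hy => by
    have h2 : (x, y) ∈ closure (S ×ˢ S) := by
      rw [closure_prod_eq]
      exact ⟨hx, hy⟩
    exact closure_minimal (t := {p : M × M | W p.1 p.2 ≤ max C 0 * Real.exp (-(lam * n))})
      (fun p hp => hS _ hp.1 _ hp.2) (isClosed_le hWc continuous_const) h2
  have h3 := (measure_mono subset_closure).trans (hvol _ _ isClosed_closure hcl)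
  have hsq : Real.sqrt (2 * (max C 0 * Real.exp (-(lam * n)))) =
      Real.sqrt (2 * max C 0) * Real.exp (-(lam / 2 * n)) := by
    rw [← mul_assoc, Real.sqrt_mul (by positivity)]
    congr 1
    rw [show -(lam * n) = -(lam / 2 * n) + -(lam / 2 * n) by ring, Real.exp_add,
      Real.sqrt_mul_self (Real.exp_pos _).le]
  have h4 : liouvilleMeasure α S ≤ ENNReal.ofReal (a * Real.exp (-(lam / 2 * n))) := by
    have e1 : liouvilleMeasure α S = (contactVolume α univ)⁻¹ * contactVolume α S := rfl
    rw [e1]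
    refine (mul_le_mul_right h3 _).trans_eq ?_
    have hfin : (contactVolume α univ)⁻¹ * D ≠ (⊤ : ℝ≥0∞) :=
      ENNReal.mul_ne_top (ENNReal.inv_ne_top.2 hα.contactVolume_univ_ne_zero) hD
    rw [hsq, mul_left_comm, ← ENNReal.ofReal_toReal hfin, ← ENNReal.ofReal_mul (by positivity)]
    congr 1
    simp only [a]
    ring
  refine (ENNReal.toReal_le_of_le_ofReal (by positivity) h4).trans ?_
  rw [sub_eq_add_neg, Real.exp_add, Real.exp_log (by positivity)]
  exact mul_le_mul_of_nonneg_right (by linarith) (Real.exp_pos _).le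

/-- The Liouville entropy of an algebraic Anosov contact manifold is at least the expansion rate. -/
theorem ofReal_le_liouvilleEntropy (hμ : 0 < μ) (h : ∀ x, HasGermAt μ α q x) :
    ENNReal.ofReal μ ≤ liouvilleEntropy α := by
  by_contra hn
  rw [not_le] at hn
  have hfin : liouvilleEntropy α ≠ (⊤ : ℝ≥0∞) := hn.ne_top
  set r := (liouvilleEntropy α).toReal
  have hr0 : 0 ≤ r := ENNReal.toReal_nonneg
  have hr : r < μ := (ENNReal.lt_ofReal_iff_toReal_lt hfin).1 hn
  -- If the entropy r were less than μ, then λ = r + μ would be admissible and would give (r + μ)/2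
  -- ≤ r, a contradiction.
  have h1 := ofReal_half_le_liouvilleEntropy h (lam := r + μ) (by linarith) (by linarith)
  rw [ENNReal.ofReal_le_iff_le_toReal hfin] at h1
  have h2 : (r + μ) / 2 ≤ r := h1
  linarith

end Lower

end

theorem mainTheorem9 :
    (∀ (M : Type*) [TopologicalSpace M] [ChartedSpace (Model 3) M] [IsManifold (𝓡 3) ∞ M]
        [T2Space M] [CompactSpace M] [ConnectedSpace M] [MeasurableSpace M] [BorelSpace M]
        (α : OneForm M), IsContactForm α → IsAlgebraicAnosov α →
        ∀ C : ℝ, (C : EReal) ≤ 2 - 2 * (liouvilleEntropy α : EReal) ^ 2 →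
          ∃ g : SmoothMetric 3 M, IsContactMetric α g ∧
            ∀ x : M, ricci g x (reeb α x) (reeb α x) = C) ∧
    (∀ (S : Type*) [TopologicalSpace S] [ChartedSpace (Model 2) S] [IsManifold (𝓡 2) ∞ S]
        [T2Space S] [CompactSpace S] [ConnectedSpace S] (gS : SmoothMetric 2 S) (K : ℝ),
        K < 0 → HasConstantCurvature gS K →
        ∀ [ChartedSpace (Model 3) (UnitTangent gS)] [IsManifold (𝓡 3) ∞ (UnitTangent gS)],
        IsSubmanifoldStructure gS →
        IsContactForm (canonicalForm gS) ∧
        ∀ C : ℝ, C ≤ 2 + 2 * K →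
          ∃ g : SmoothMetric 3 (UnitTangent gS), IsContactMetric (canonicalForm gS) g ∧
            ∀ v : UnitTangent gS,
              ricci g v (reeb (canonicalForm gS) v) (reeb (canonicalForm gS) v) = C) := by
  refine ⟨?_, ?_⟩
  · intro M _ _ _ _ _ _ _ _ α hα hA C hC
    obtain ⟨μ, hμ, q, hq⟩ := hA.exists_germ hα
    refine exists_contactMetric_of_germ hμ hq ?_
    -- Only μ ≤ h̄ is needed: it gives C ≤ 2 - 2h̄² ≤ 2 - 2μ². The comparison in `EReal` also covers
    -- infinite entropy.
    have h1 : ENNReal.ofReal (μ ^ 2) ≤ liouvilleEntropy α ^ 2 := by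
      rw [ENNReal.ofReal_pow hμ.le]
      exact pow_le_pow_left' (ofReal_le_liouvilleEntropy hμ hq) 2
    have h2 := EReal.coe_ennreal_le_coe_ennreal_iff.2 h1
    rw [EReal.coe_ennreal_ofReal, max_eq_left (sq_nonneg μ), EReal.coe_ennreal_pow] at h2
    have h3 := hC.trans (EReal.sub_le_sub le_rfl
      (mul_le_mul_of_nonneg_left h2 (by norm_num : (0 : EReal) ≤ 2)))
    rw [show (2 : EReal) = ((2 : ℝ) : EReal) from rfl, ← EReal.coe_mul, ← EReal.coe_sub] at h3
    exact EReal.coe_le_coe_iff.1 h3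
  · intro S _ _ _ _ _ _ gS K hK hgS _ _ hsub
    obtain ⟨q, hq⟩ := exists_germ_canonicalForm hsub hK hgS
    refine ⟨isContactForm_of_germ hq, fun C hC =>
      exists_contactMetric_of_germ (Real.sqrt_pos.2 (neg_pos.2 hK)) hq ?_⟩
    rw [Real.sq_sqrt (neg_pos.2 hK).le]
    linarith
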